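/- **Conventions.** A vocabulary is a finite set of relation symbols, each with an arity in $\mathbb N=\{0,1,2,\dots\}$. Structures are finite, relational, and have a non-empty universe; $\mathrm{STR}[\tau]$ is the class of structures with vocabulary $\tau$. First-order formulas are built from atoms $Rx_1\cdots x_{\mathrm{ar}(R)}$ and $x=y$ with $\neg,\wedge,\vee,\exists,\forall$; the quantifier rank is the nesting depth of quantifiers. A sentence is *existential* if it contains no $\forall$ and negation only in front of atoms, and *primitive positive* if it is built from atoms by $\wedge$ and $\exists$ only. For $q,r\in\mathbb N$ let $\Sigma_1^q[r]$ and $\mathrm{PP}^q[r]$ be the sets of existential and of primitive positive sentences of quantifier rank at most $q$ in which every relation symbol has arity at most $r$. Formulas $\varphi$ and structures $\mathbf A$ (with universe $\{0,\dots,n\}$) are coded by natural numbers $\ulcorner\varphi\urcorner$, $\ulcorner\mathbf A\urcorner$ in a standard way. **Problems.** A parameterized problem is a class $Q$ of pairs $(\mathbf A,k)$ of a structure and a number $k\in\mathbb N$, together with vocabularies $(\tau_k)_{k\in\mathbb N}$, such that $\{\mathbf A\mid(\mathbf A,k)\in Q\}$ is an isomorphism-closed class of $\tau_k$-structures for every $k$.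 For a set $\Phi$ of sentences let $$p\text{-MC}(\Phi)=\{(\mathbf A,\ulcorner\varphi\urcorner)\mid \varphi\in\Phi,\ \mathbf A\models\varphi\},$$ where $\mathbf A$ has as its vocabulary the set of symbols of $\varphi$, and for a class $\mathcal A$ of structures let $$p\text{-Hom}(\mathcal A)=\{(\mathbf B,\ulcorner\mathbf A\urcorner)\mid \mathbf A\in\mathcal A,\ \text{there is a homomorphism from }\mathbf A\text{ to }\mathbf B\},$$ where $\mathbf A$ and $\mathbf B$ have the same vocabulary. (For $k$ not coding a member of $\Phi$, respectively $\mathcal A$, the slice is empty and $\tau_k=\emptyset$.) For $d\ge 0$ let $\mathcal F_d$ be the class of (finite, non-empty) forests of height at most $d$, i.e. acyclic graphs in each component of which some vertex (a root) can be chosen such that all paths starting at it have at most $d$ edges. For a graph $\mathbf G$, the structure $\mathbf G^*$ is $\mathbf G$, with its binary edge relation $E$, expanded by a unary relation $C_v=\{v\}$ for each vertex $v$; $\mathcal F_d^*=\{\mathbf F^*\mid\mathbf F\in\mathcal F_d\}$. **Reductions.** For structures $\mathbf A,\mathbf B$ let $\langle\mathbf A,\mathbf B\rangle$ be their disjoint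 union (a symbol is interpreted by the union of its interpretations in those of $\mathbf A,\mathbf B$ whose vocabulary contains it), with two new unary symbols $P_1,P_2$ interpreted by the universes of $\mathbf A$ and $\mathbf B$. A quantifier-free interpretation $I$ of dimension $w$, with output vocabulary $\tau$, consists of quantifier-free formulas $\varphi_U(\bar x)$ and $\varphi_R(\bar x_1,\dots,\bar x_{\mathrm{ar}(R)})$ for $R\in\tau$, all tuples of variables having length $w$. If these are formulas in the vocabulary of $\mathbf A$ and the set $\varphi_U(\mathbf A)\subseteq A^w$ of tuples satisfying $\varphi_U$ in $\mathbf A$ is not empty, then $I(\mathbf A)$ is defined: it is the $\tau$-structure with universe $\varphi_U(\mathbf A)$ in which $R\in\tau$ is interpreted by the tuples of elements of $\varphi_U(\mathbf A)$ that satisfy $\varphi_R$ in $\mathbf A$. For parameterized problems $Q$ (with vocabularies $\tau_k$) and $Q'$ (with vocabularies $\tau_k'$) write $Q\le_{\mathit{qfap}}Q'$ if there are $w\in\mathbb N$ and computable functions $p:\mathbb N\to\mathbb N$, $a$ from $\mathbb N$ to structures, and $d$ from $\mathbb N$ to quantifier-free interpretations of dimension $w$, such that for all $k\in\mathbb N$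 and all $\mathbf A\in\mathrm{STR}[\tau_k]$ the structure $\mathbf A':=d(k)(\langle a(k),\mathbf A\rangle)$ is defined, is a $\tau'_{p(k)}$-structure, and satisfies $$(\mathbf A,k)\in Q\iff(\mathbf A',p(k))\in Q'.$$ Write $Q\equiv_{\mathit{qfap}}Q'$ if $Q\le_{\mathit{qfap}}Q'$ and $Q'\le_{\mathit{qfap}}Q$. **Theorem.** Let $q,r\in\mathbb N$ with $q\ge1$ and $r\ge2$. Then the problems $p\text{-MC}(\Sigma_1^q[r])$, $p\text{-MC}(\mathrm{PP}^q[2])$ and $p\text{-Hom}(\mathcal F^*_{q-1})$ are pairwise $\equiv_{\mathit{qfap}}$-equivalent. -/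

import Mathlib

/-! Finite relational structures, first-order logic, quantifier-free interpretations, and
reductions between parameterized problems that are quantifier-free after a pre-computation. -/

namespace QFRed

/-! ### Relation symbols and vocabularies -/

/-- Types of relation symbols, each symbol having an arity. -/
class Arity (S : Type) where
  ar : S → ℕ

/-- The supply of relation symbols `(name, arity)`: countably many of each arity.
A vocabulary is a finite set of symbols. -/
abbrev Sym : Type := ℕ × ℕ

instance : Arity Sym := ⟨fun R => R.2⟩

/-- The symbols available in a structure of the form `⟨A, B⟩`: the ordinary ones, and two unary
symbols `P₁ = Sum.inr false` and `P₂ = Sum.inr true`, which are therefore always new. -/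
abbrev PairSym : Type := Sym ⊕ Bool

def pairAr : PairSym → ℕ
  | Sum.inl R => Arity.ar R
  | Sum.inr _ => 1

instance : Arity PairSym := ⟨pairAr⟩

/-! ### Structures -/

/-- Finite structures (with non-empty universe) whose symbols are taken from `S`. The vocabulary
is part of the structure; `rel R` carries information for the symbols `R ∈ voc` only. -/
structure Str (S : Type) [Arity S] where
  carrier : Type
  finite : Finite carrier
  nonempty : Nonempty carrier
  voc : Finset S
  rel : (R : S) → (Fin (Arity.ar R) → carrier) → Prop
  mem_voc : ∀ R x, rel R x → R ∈ voc

section Structures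

variable {S : Type} [Arity S]

/-- `h` is a homomorphism from `A` to `B`; the two structures have to be similar. -/
def IsHom (A B : Str S) (h : A.carrier → B.carrier) : Prop :=
  A.voc = B.voc ∧ ∀ R x, A.rel R x → B.rel R (fun i => h (x i))

/-- There is a homomorphism from `A` to `B`. -/
def HomTo (A B : Str S) : Prop := ∃ h : A.carrier → B.carrier, IsHom A B h

/-- `A` and `B` are isomorphic. -/
def IsIso (A B : Str S) : Prop :=
  A.voc = B.voc ∧
    ∃ e : A.carrier ≃ B.carrier, ∀ R x, A.rel R x ↔ B.rel R (fun i => e (x i))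

end Structures

/-- The structure `⟨A, B⟩`: the disjoint union of `A` and `B`, with the (copies of the) universes
of `A` and `B` marked by `P₁` and `P₂`. -/
def pair (A B : Str Sym) : Str PairSym where
  carrier := A.carrier ⊕ B.carrier
  finite := by
    have := A.finite
    have := B.finite
    infer_instance
  nonempty := A.nonempty.map Sum.inl
  voc := (A.voc ∪ B.voc).image Sum.inl ∪ {Sum.inr false, Sum.inr true}
  rel := fun R => match R with
    | Sum.inl R => fun x =>
        (∃ a : Fin (Arity.ar R) → A.carrier, A.rel R a ∧ x = fun i => Sum.inl (a i)) ∨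
        (∃ b : Fin (Arity.ar R) → B.carrier, B.rel R b ∧ x = fun i => Sum.inr (b i))
    | Sum.inr false => fun x => ∃ a : A.carrier, x = fun _ => Sum.inl a
    | Sum.inr true => fun x => ∃ b : B.carrier, x = fun _ => Sum.inr b
  mem_voc := by
    rintro (R | (_ | _)) x h
    · rcases h with ⟨a, h, -⟩ | ⟨b, h, -⟩
      · simp [A.mem_voc R a h]
      · simp [B.mem_voc R b h]
    · simp
    · simp

/-- Explicit descriptions of finite structures by finite data. The description `(n, L)` denotes the
structure with universe `{0, …, n}` whose vocabulary consists of the symbols listed in `L`, each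
listed together with the tuples in its interpretation. Every structure with a universe
`{0, …, n}` has such a description, and it is coded by the number `Encodable.encode (n, L)`. -/
abbrev StrCode : Type := ℕ × List (Sym × List (List ℕ))

/-- The structure denoted by a description. -/
def StrCode.toStr (c : StrCode) : Str Sym where
  carrier := Fin (c.1 + 1)
  finite := inferInstance
  nonempty := inferInstance
  voc := (c.2.map Prod.fst).toFinset
  rel := fun R x => ∃ T, (R, T) ∈ c.2 ∧ List.ofFn (fun i => (x i : ℕ)) ∈ T
  mem_voc := by
    rintro R x ⟨T, h, -⟩
    exact List.mem_toFinset.2 (List.mem_map.2 ⟨_, h, rfl⟩)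

/-! ### First-order formulas -/

/-- First-order formulas; the variables are the natural numbers. -/
inductive Formula (S : Type) [Arity S] : Type
  | rel (R : S) (x : Fin (Arity.ar R) → ℕ) : Formula S
  | eq (x y : ℕ) : Formula S
  | neg (φ : Formula S) : Formula S
  | and (φ ψ : Formula S) : Formula S
  | or (φ ψ : Formula S) : Formula S
  | ex (x : ℕ) (φ : Formula S) : Formula S
  | all (x : ℕ) (φ : Formula S) : Formula S

namespace Formula

variable {S : Type} [Arity S]

/-- The set of free variables. -/
def freeVars : Formula S → Finset ℕ
  | rel _ x => Finset.univ.image x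
  | eq x y => {x, y}
  | neg φ => φ.freeVars
  | and φ ψ => φ.freeVars ∪ ψ.freeVars
  | or φ ψ => φ.freeVars ∪ ψ.freeVars
  | ex x φ => φ.freeVars.erase x
  | all x φ => φ.freeVars.erase x

/-- The vocabulary of a formula: the relation symbols that appear in it. -/
def voc [DecidableEq S] : Formula S → Finset S
  | rel R _ => {R}
  | eq _ _ => ∅
  | neg φ => φ.voc
  | and φ ψ => φ.voc ∪ ψ.voc
  | or φ ψ => φ.voc ∪ ψ.voc
  | ex _ φ => φ.voc
  | all _ φ => φ.voc

/-- The quantifier rank. -/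
def qr : Formula S → ℕ
  | rel _ _ => 0
  | eq _ _ => 0
  | neg φ => φ.qr
  | and φ ψ => max φ.qr ψ.qr
  | or φ ψ => max φ.qr ψ.qr
  | ex _ φ => 1 + φ.qr
  | all _ φ => 1 + φ.qr

/-- Satisfaction: `φ` holds in `A` under the assignment `v`. -/
def Sat (A : Str S) : (ℕ → A.carrier) → Formula S → Prop
  | v, rel R x => A.rel R (fun i => v (x i))
  | v, eq x y => v x = v y
  | v, neg φ => ¬ Sat A v φ
  | v, and φ ψ => Sat A v φ ∧ Sat A v ψ
  | v, or φ ψ => Sat A v φ ∨ Sat A v ψ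
  | v, ex x φ => ∃ a : A.carrier, Sat A (Function.update v x a) φ
  | v, all x φ => ∀ a : A.carrier, Sat A (Function.update v x a) φ

/-- `A ⊨ φ`, used for sentences `φ` (whose truth value does not depend on the assignment). -/
def Holds (A : Str S) (φ : Formula S) : Prop := ∀ v : ℕ → A.carrier, Sat A v φ

def IsSentence (φ : Formula S) : Prop := φ.freeVars = ∅

def IsAtom : Formula S → Prop
  | rel _ _ => True
  | eq _ _ => True
  | _ => False

def IsQuantifierFree : Formula S → Prop
  | rel _ _ => True
  | eq _ _ => True
  | neg φ => φ.IsQuantifierFree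
  | and φ ψ => φ.IsQuantifierFree ∧ ψ.IsQuantifierFree
  | or φ ψ => φ.IsQuantifierFree ∧ ψ.IsQuantifierFree
  | ex _ _ => False
  | all _ _ => False

/-- No universal quantifier occurs and negation appears in front of atoms only. -/
def IsExistential : Formula S → Prop
  | rel _ _ => True
  | eq _ _ => True
  | neg φ => φ.IsAtom
  | and φ ψ => φ.IsExistential ∧ ψ.IsExistential
  | or φ ψ => φ.IsExistential ∧ ψ.IsExistential
  | ex _ φ => φ.IsExistential
  | all _ _ => False

/-- Built from atoms by means of conjunction and existential quantification. -/
def IsPrimitivePositive : Formula S → Prop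
  | rel _ _ => True
  | eq _ _ => True
  | neg _ => False
  | and φ ψ => φ.IsPrimitivePositive ∧ ψ.IsPrimitivePositive
  | or _ _ => False
  | ex _ φ => φ.IsPrimitivePositive
  | all _ _ => False

/-- The natural number coding a formula. -/
def code [Encodable S] : Formula S → ℕ
  | rel R x => Nat.pair 0 (Nat.pair (Encodable.encode R) (Encodable.encode (List.ofFn x)))
  | eq x y => Nat.pair 1 (Nat.pair x y)
  | neg φ => Nat.pair 2 φ.code
  | and φ ψ => Nat.pair 3 (Nat.pair φ.code ψ.code)
  | or φ ψ => Nat.pair 4 (Nat.pair φ.code ψ.code)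
  | ex x φ => Nat.pair 5 (Nat.pair x φ.code)
  | all x φ => Nat.pair 6 (Nat.pair x φ.code)

theorem code_injective [Encodable S] : Function.Injective (code (S := S)) := by
  intro φ
  induction φ with
  | rel R x =>
    intro ψ h
    cases ψ <;> simp only [code, Nat.pair_eq_pair] at h <;> try omega
    obtain ⟨-, h1, h2⟩ := h
    obtain rfl := Encodable.encode_injective h1
    rw [List.ofFn_injective (Encodable.encode_injective h2)]
  | eq x y =>
    intro ψ h
    cases ψ <;> simp only [code, Nat.pair_eq_pair] at h <;> try omega
    obtain ⟨-, rfl, rfl⟩ := h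
    rfl
  | neg φ ih =>
    intro ψ h
    cases ψ <;> simp only [code, Nat.pair_eq_pair] at h <;> try omega
    rw [ih h.2]
  | and φ φ' ih ih' =>
    intro ψ h
    cases ψ <;> simp only [code, Nat.pair_eq_pair] at h <;> try omega
    rw [ih h.2.1, ih' h.2.2]
  | or φ φ' ih ih' =>
    intro ψ h
    cases ψ <;> simp only [code, Nat.pair_eq_pair] at h <;> try omega
    rw [ih h.2.1, ih' h.2.2]
  | ex x φ ih =>
    intro ψ h
    cases ψ <;> simp only [code, Nat.pair_eq_pair] at h <;> try omega
    rw [h.2.1, ih h.2.2]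
  | all x φ ih =>
    intro ψ h
    cases ψ <;> simp only [code, Nat.pair_eq_pair] at h <;> try omega
    rw [h.2.1, ih h.2.2]

theorem sat_equiv {A B : Str S} (e : A.carrier ≃ B.carrier)
    (he : ∀ R x, A.rel R x ↔ B.rel R (fun i => e (x i))) (φ : Formula S) :
    ∀ v : ℕ → A.carrier, Sat A v φ ↔ Sat B (fun n => e (v n)) φ := by
  have upd : ∀ (v : ℕ → A.carrier) (x : ℕ) (a : A.carrier),
      (fun n => e (Function.update v x a n)) = Function.update (fun n => e (v n)) x (e a) := by
    intro v x a
    funext n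
    by_cases h : n = x
    · subst h; simp
    · simp [h]
  induction φ with
  | rel R x => intro v; exact he R _
  | eq x y => intro v; simp [Sat]
  | neg φ ih => intro v; simp [Sat, ih v]
  | and φ ψ ih ih' => intro v; simp [Sat, ih v, ih' v]
  | or φ ψ ih ih' => intro v; simp [Sat, ih v, ih' v]
  | ex x φ ih =>
    intro v
    simp only [Sat, ih, upd]
    exact e.exists_congr_left.trans (by simp)
  | all x φ ih =>
    intro v
    simp only [Sat, ih, upd]
    exact e.forall_congr_left.trans (by simp)

theorem holds_of_isIso {A B : Str S} (h : IsIso A B) (φ : Formula S) (hA : Holds A φ) :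
    Holds B φ := by
  obtain ⟨-, e, he⟩ := h
  intro v
  have := (sat_equiv e he φ (fun n => e.symm (v n))).1 (hA _)
  simpa using this

end Formula

/-! ### Interpretations -/

/-- An interpretation of dimension `dim`: a formula `univ = φ_U(x̄)` and a finite family
`φ_R(x̄₁, …, x̄_{ar R})`, `R` ranging over the output vocabulary, where every `x̄ᵢ` is a tuple of
`dim` variables. The `j`-th component of `x̄ᵢ` is the variable `j + dim * i` (counting `i` and `j`
from `0`). -/
structure Interp (S : Type) [Arity S] where
  dim : ℕ
  univ : Formula S
  rels : List (Sym × Formula S)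
  nodup : (rels.map Prod.fst).Nodup
  univ_free : univ.freeVars ⊆ Finset.range dim
  rels_free : ∀ p ∈ rels, p.2.freeVars ⊆ Finset.range (Arity.ar p.1 * dim)

/-- The assignment that maps the variables in `x̄₁ ⋯ x̄ₘ` to the entries of the given `w`-tuples
(and all other variables, which are irrelevant, to an arbitrary element). -/
noncomputable def tupleAssign {A : Type} [Nonempty A] {m w : ℕ} (x : Fin m → Fin w → A) : ℕ → A :=
  fun n => if h : n < m * w then
      x (finProdFinEquiv.symm ⟨n, h⟩).1 (finProdFinEquiv.symm ⟨n, h⟩).2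
    else Classical.arbitrary A

namespace Interp

variable {S : Type} [Arity S]

def IsQuantifierFree (I : Interp S) : Prop :=
  I.univ.IsQuantifierFree ∧ ∀ p ∈ I.rels, p.2.IsQuantifierFree

/-- The finite data coding an interpretation. -/
def code [Encodable S] (I : Interp S) : ℕ × ℕ × List (Sym × ℕ) :=
  (I.dim, I.univ.code, I.rels.map fun p => (p.1, p.2.code))

/-- The set `φ_U(A)` of tuples. -/
def univSet (I : Interp S) (A : Str S) : Set (Fin I.dim → A.carrier) :=
  {x | have := A.nonempty
    Formula.Sat A (tupleAssign (fun _ : Fin 1 => x)) I.univ}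

/-- `I(A)` is defined: all formulas of `I` are formulas in the vocabulary of `A`, and
`φ_U(A)` is not empty. -/
def DefinedOn [DecidableEq S] (I : Interp S) (A : Str S) : Prop :=
  (I.univ.voc ⊆ A.voc ∧ ∀ p ∈ I.rels, p.2.voc ⊆ A.voc) ∧ (I.univSet A).Nonempty

/-- The structure `I(A)`. -/
noncomputable def apply [DecidableEq S] (I : Interp S) (A : Str S) (h : I.DefinedOn A) :
    Str Sym where
  carrier := I.univSet A
  finite := by
    have := A.finite
    infer_instance
  nonempty := h.2.to_subtype
  voc := (I.rels.map Prod.fst).toFinset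
  rel := fun R x => ∃ φ, (R, φ) ∈ I.rels ∧
    have := A.nonempty
    Formula.Sat A (tupleAssign (fun i => (x i : Fin I.dim → A.carrier))) φ
  mem_voc := by
    rintro R x ⟨φ, h, -⟩
    exact List.mem_toFinset.2 (List.mem_map.2 ⟨_, h, rfl⟩)

end Interp

/-! ### Parameterized problems and reductions -/

/-- A parameterized problem: a class of pairs of a structure and a parameter such that, for
every `k`, the `k`-th slice is an isomorphism closed class of structures in the vocabulary
`voc k`. -/
structure ParamProblem where
  voc : ℕ → Finset Sym
  mem : Str Sym → ℕ → Prop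
  mem_voc : ∀ A k, mem A k → A.voc = voc k
  iso_closed : ∀ A B k, IsIso A B → mem A k → mem B k

/-- Reducibility that is quantifier-free after a pre-computation: instances `(A, k)` of `Q` are
mapped to instances `(d(k)(⟨a(k), A⟩), p(k))` of `R`, where `p`, `a`, `d` are computable, `a(k)` is
a structure, and `d(k)` is a quantifier-free interpretation of a constant dimension `w`. -/
def QfapReducible (Q R : ParamProblem) : Prop :=
  ∃ (w : ℕ) (p : ℕ → ℕ) (a : ℕ → StrCode) (d : ℕ → Interp PairSym),
    Computable p ∧ Computable a ∧ Computable (fun k => (d k).code) ∧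
    (∀ k, (d k).dim = w ∧ (d k).IsQuantifierFree) ∧
    ∀ (k : ℕ) (A : Str Sym), A.voc = Q.voc k →
      ∃ h : (d k).DefinedOn (pair (a k).toStr A),
        ((d k).apply _ h).voc = R.voc (p k) ∧
        (Q.mem A k ↔ R.mem ((d k).apply _ h) (p k))

def QfapEquivalent (Q R : ParamProblem) : Prop := QfapReducible Q R ∧ QfapReducible R Q

open Classical in
/-- The parameterized model checking problem of a class `Φ` of formulas (used for classes of
sentences): pairs of a structure `A` and (the code of) some `φ ∈ Φ` with `A ⊨ φ`, where `A` is a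
structure in the vocabulary of `φ`. Slices at numbers that do not code any `φ ∈ Φ` are empty,
and are classes of structures in the empty vocabulary. -/
noncomputable def pMC (Φ : Set (Formula Sym)) : ParamProblem where
  voc := fun k => if h : ∃ φ, φ ∈ Φ ∧ φ.code = k then h.choose.voc else ∅
  mem := fun A k => ∃ φ, φ ∈ Φ ∧ φ.code = k ∧ A.voc = φ.voc ∧ Formula.Holds A φ
  mem_voc := by
    rintro A k ⟨φ, hφ, rfl, hA, -⟩
    have h : ∃ ψ, ψ ∈ Φ ∧ ψ.code = φ.code := ⟨φ, hφ, rfl⟩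
    rw [dif_pos h, hA, Formula.code_injective h.choose_spec.2]
  iso_closed := by
    rintro A B k hAB ⟨φ, hφ, hk, hA, hs⟩
    exact ⟨φ, hφ, hk, hAB.1.symm.trans hA, Formula.holds_of_isIso hAB φ hs⟩

open Classical in
/-- The parameterized homomorphism problem of a class `𝒜` of structures: pairs of a structure `B`
and (a code of) some `A ∈ 𝒜` such that there is a homomorphism from `A` to `B`. Slices at numbers
that do not code any `A ∈ 𝒜` are empty, and are classes of structures in the empty vocabulary. -/
noncomputable def pHom (𝒜 : Set (Str Sym)) : ParamProblem where
  voc := fun k => if h : ∃ c : StrCode, c.toStr ∈ 𝒜 ∧ Encodable.encode c = k then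
    h.choose.toStr.voc else ∅
  mem := fun B k => ∃ c : StrCode, c.toStr ∈ 𝒜 ∧ Encodable.encode c = k ∧ HomTo c.toStr B
  mem_voc := by
    rintro A k ⟨c, hc, rfl, f, hf, -⟩
    have h : ∃ c' : StrCode, c'.toStr ∈ 𝒜 ∧ Encodable.encode c' = Encodable.encode c :=
      ⟨c, hc, rfl⟩
    rw [dif_pos h, Encodable.encode_injective h.choose_spec.2, hf]
  iso_closed := by
    rintro A B k ⟨hv, e, he⟩ ⟨c, hc, hk, f, hf, hr⟩
    exact ⟨c, hc, hk, fun x => e (f x), hf.trans hv, fun R x hx => (he R _).1 (hr R x hx)⟩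

/-! ### The classes of sentences and of structures -/

/-- The existential sentences of quantifier rank at most `q` in which all relation symbols have
arity at most `r`. -/
def existentialSentences (q r : ℕ) : Set (Formula Sym) :=
  {φ | φ.IsSentence ∧ φ.IsExistential ∧ φ.qr ≤ q ∧ ∀ R ∈ φ.voc, Arity.ar R ≤ r}

/-- The primitive positive sentences of quantifier rank at most `q` in which all relation symbols
have arity at most `r`. -/
def primitivePositiveSentences (q r : ℕ) : Set (Formula Sym) :=
  {φ | φ.IsSentence ∧ φ.IsPrimitivePositive ∧ φ.qr ≤ q ∧ ∀ R ∈ φ.voc, Arity.ar R ≤ r}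

/-- `G` is a forest of height at most `d`: it is acyclic, and every component contains a root from
which all paths have length (number of edges) at most `d`. -/
def IsForestOfHeightLE {V : Type} (G : SimpleGraph V) (d : ℕ) : Prop :=
  G.IsAcyclic ∧ ∀ C : G.ConnectedComponent, ∃ r ∈ C.supp,
    ∀ (u : V) (p : G.Walk r u), p.IsPath → p.length ≤ d

/-- The binary relation symbol of graphs. -/
def edgeSym : Sym := (0, 2)

/-- The unary relation symbol naming the vertex `i`. -/
def colorSym (i : ℕ) : Sym := (i, 1)

/-- The structure `G*`: the graph `G`, expanded by a unary relation `C_i = {i}` for every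
vertex `i`. -/
def starGraph {n : ℕ} (G : SimpleGraph (Fin (n + 1))) : Str Sym where
  carrier := Fin (n + 1)
  finite := inferInstance
  nonempty := inferInstance
  voc := insert edgeSym ((Finset.range (n + 1)).image colorSym)
  rel := fun R x =>
    (∃ i j, G.Adj i j ∧ R = edgeSym ∧ List.ofFn x = [i, j]) ∨
    (∃ i : Fin (n + 1), R = colorSym i ∧ List.ofFn x = [i])
  mem_voc := by
    rintro R x (⟨i, j, -, rfl, -⟩ | ⟨i, rfl, -⟩)
    · simp
    · exact Finset.mem_insert_of_mem
        (Finset.mem_image.2 ⟨i, Finset.mem_range.2 i.2, rfl⟩)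

/-- The class of the structures `F*` for `F` a forest of height at most `d`
(closed under isomorphism). -/
def starForests (d : ℕ) : Set (Str Sym) :=
  {A | ∃ (n : ℕ) (F : SimpleGraph (Fin (n + 1))), IsForestOfHeightLE F d ∧ IsIso A (starGraph F)}

end QFRed

/-!
Truth of an existential sentence `φ` of quantifier rank `q` in a structure `A` is turned into the
existence of a homomorphism from a coloured forest of height `q - 1`, where the forest depends on
`φ` only.

To get rid of the conjunctions and disjunctions between the quantifiers, truth is described by a
game with exactly `q` rounds (`GameWon`). In round `d` the first player chooses one conjunct of
every conjunction that occurs in the scope of exactly `d` quantifiers; all these choices together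
are coded by the binary digits of one number `S d < M`, with `M` a power of two computed from `φ`
(`branching`). Then the second player names one element `X d`, which is used as the witness of all
existential quantifiers on this level. Once the conjunctions are resolved, every level is a
disjunction, and the existential quantifier commutes with disjunctions; hence a single witness
suffices, and the second player wins iff `φ` is true (`holds_iff_gameWon`). Who has won after `q`
rounds is expressed by a quantifier-free formula (`matrix`).

A winning strategy of the second player is a labelling of the complete `M`-ary forest with `q`
levels by tuples of elements of `A`, where the tuples at adjacent nodes agree on the entries that
belong to common ancestors and where the tuples at the leaves satisfy the appropriate
quantifier-free formulas (`exists_labelling_iff`). Given the forest as a pre-computed structure, the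
pairs of a node and a tuple form a coloured graph that is obtained by a quantifier-free
interpretation of dimension `q + 1` (`gameInterp`), and the labellings are the homomorphisms from
the coloured forest to it (`colorHom_game_iff`). This reduces model checking to the homomorphism
problem (`pMC_reducible`).

Conversely, that a given forest `F` of height at most `q - 1` maps to `B` can be said by a primitive
positive sentence of quantifier rank `q` with symbols of arity at most two, which describes the
walks of length at most `q - 1` in `F`; a homomorphism is read off from the walks that are the paths
from the roots (`holds_forestFormula_iff`). The sentence does not depend on a choice of the roots,
so it is easily computed from `F`. It replaces the homomorphism problem as the target of the first
reduction (`pMC_reducible_pMC`) and yields the reduction in the other direction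
(`pHom_reducible_pMC`), so that composing reductions is not necessary.

All maps involved are primitive recursive: they are obtained by recursion on the codes of formulas
(`codeRec`), with the list of the variables bound so far as a parameter.
-/

namespace QFRed

/-! ### Primitive recursion along formula codes -/

section CodeRecursion

variable {α σ : Type*}

/-- Recursion along the codes of formulas with a parameter. A code is a pair `(tag, m)`; the tags
`0`, `1`, `2` (atoms and negations) are base cases, and for the other ones the recursive calls are
made at the two components of `m`. The parameter is passed on unchanged to the first component and
transformed by `e` for the second one: this is where a quantified variable gets recorded. -/
def codeRec (b : α → ℕ → σ) (e : α → ℕ → α) (g : α → ℕ → σ → σ → σ) (a : α) (n : ℕ) : σ :=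
  if n.unpair.1 ≤ 2 then b a n
  else g a n (codeRec b e g a n.unpair.2.unpair.1) (codeRec b e g (e a n) n.unpair.2.unpair.2)
termination_by n
decreasing_by
  all_goals
    have h1 := Nat.add_le_pair n.unpair.1 n.unpair.2
    rw [Nat.pair_unpair] at h1
  · have := Nat.unpair_left_le n.unpair.2
    omega
  · have := Nat.unpair_right_le n.unpair.2
    omega

theorem codeRec_base (b : α → ℕ → σ) (e : α → ℕ → α) (g : α → ℕ → σ → σ → σ) (a : α) {t m : ℕ}
    (ht : t ≤ 2) : codeRec b e g a (Nat.pair t m) = b a (Nat.pair t m) := by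
  rw [codeRec, if_pos (by simpa using ht)]

theorem codeRec_step (b : α → ℕ → σ) (e : α → ℕ → α) (g : α → ℕ → σ → σ → σ) (a : α) {t m : ℕ}
    (ht : 2 < t) : codeRec b e g a (Nat.pair t m) =
      g a (Nat.pair t m) (codeRec b e g a m.unpair.1)
        (codeRec b e g (e a (Nat.pair t m)) m.unpair.2) := by
  rw [codeRec, if_neg (by simpa using ht)]
  simp

variable [Primcodable α] [Primcodable σ]

theorem primrec_codeRec {b : α → ℕ → σ} {e : α → ℕ → α} {g : α → ℕ → σ → σ → σ}
    (hb : Primrec₂ b) (he : Primrec₂ e)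
    (hg : Primrec fun x : (α × ℕ) × (σ × σ) => g x.1.1 x.1.2 x.2.1 x.2.2) :
    Primrec₂ (codeRec b e g) := by
  have htag : Primrec fun p : α × ℕ => p.2.unpair.1 :=
    Primrec.fst.comp (Primrec.unpair.comp Primrec.snd)
  have hm : Primrec fun p : α × ℕ => p.2.unpair.2.unpair :=
    Primrec.unpair.comp (Primrec.snd.comp (Primrec.unpair.comp Primrec.snd))
  have htest : PrimrecPred fun p : α × ℕ => p.2.unpair.1 ≤ 2 :=
    Primrec.nat_le.comp htag (Primrec.const 2)
  refine Primrec.nat_omega_rec' (fun p : α × ℕ => codeRec b e g p.1 p.2) (m := Prod.snd)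
    (l := fun p => if p.2.unpair.1 ≤ 2 then [] else
      [(p.1, p.2.unpair.2.unpair.1), (e p.1 p.2, p.2.unpair.2.unpair.2)])
    (g := fun p s => if p.2.unpair.1 ≤ 2 then some (b p.1 p.2) else
      s[0]?.bind fun x => s[1]?.map fun y => g p.1 p.2 x y) Primrec.snd ?_ ?_ ?_ ?_
  · refine Primrec.ite htest (Primrec.const []) ?_
    refine Primrec.list_cons.comp (Primrec.fst.pair (Primrec.fst.comp hm)) ?_
    exact Primrec.list_cons.comp ((he.comp Primrec.fst Primrec.snd).pair (Primrec.snd.comp hm))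
      (Primrec.const [])
  · refine Primrec.ite (htest.comp Primrec.fst)
      (Primrec.option_some.comp (hb.comp (Primrec.fst.comp Primrec.fst)
        (Primrec.snd.comp Primrec.fst))) ?_
    refine Primrec.option_bind (Primrec.list_getElem?.comp Primrec.snd (Primrec.const 0)) ?_
    refine Primrec.option_map (Primrec.list_getElem?.comp (Primrec.snd.comp Primrec.fst)
      (Primrec.const 1)) ?_
    exact hg.comp ((Primrec.fst.comp (Primrec.fst.comp Primrec.fst)).pair
      ((Primrec.snd.comp Primrec.fst).pair Primrec.snd))
  · rintro ⟨a, n⟩ b' hb'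
    split_ifs at hb' with h
    · simp at hb'
    · have h1 := Nat.add_le_pair n.unpair.1 n.unpair.2
      rw [Nat.pair_unpair] at h1
      have h2 := Nat.unpair_left_le n.unpair.2
      have h3 := Nat.unpair_right_le n.unpair.2
      simp only at h
      simp only [List.mem_cons, List.not_mem_nil, or_false] at hb'
      rcases hb' with rfl | rfl <;> simp only <;> omega
  · rintro ⟨a, n⟩
    by_cases h : n.unpair.1 ≤ 2
    · simp only [h, if_true]
      rw [codeRec, if_pos h]
    · simp only [h, if_false]
      conv_rhs => rw [codeRec, if_neg h]
      simp

end CodeRecursion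

theorem primrecPred_mem {α : Type*} [Primcodable α] [DecidableEq α] :
    PrimrecPred fun p : α × List α => p.1 ∈ p.2 := by
  refine (Primrec.nat_lt.comp (Primrec.list_idxOf.comp Primrec.fst Primrec.snd)
    (Primrec.list_length.comp Primrec.snd)).of_eq fun p => ?_
  exact List.idxOf_lt_length_iff

/-! ### Admissible formulas -/

namespace Formula

/-- Admissible formulas relative to a list `env` of variables that are bound already: existential
formulas (primitive positive ones if `pp` is true) whose free variables are in `env`, with symbols
of arity at most `r` only, such that at most `q` quantifiers are nested if the ones that bound the
variables in `env` are counted. The list `env` has the most recently bound variable first; a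
variable can occur in it several times. -/
def Admissible (pp : Bool) (r q : ℕ) : List ℕ → Formula Sym → Prop
  | env, rel R x => Arity.ar R ≤ r ∧ ∀ i, x i ∈ env
  | env, eq x y => x ∈ env ∧ y ∈ env
  | env, neg φ => pp = false ∧ φ.IsAtom ∧ Admissible pp r q env φ
  | env, and φ ψ => Admissible pp r q env φ ∧ Admissible pp r q env ψ
  | env, or φ ψ => pp = false ∧ Admissible pp r q env φ ∧ Admissible pp r q env ψ
  | env, ex x φ => env.length < q ∧ Admissible pp r q (x :: env) φ
  | _, all _ _ => False

variable {pp : Bool} {r q : ℕ}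

theorem Admissible.to_existential {φ : Formula Sym} :
    ∀ {env : List ℕ}, Admissible pp r q env φ → Admissible false r q env φ := by
  induction φ with
  | rel R x => exact fun h => h
  | eq x y => exact fun h => h
  | neg φ ih => exact fun h => ⟨rfl, h.2.1, ih h.2.2⟩
  | and φ ψ ih ih' => exact fun h => ⟨ih h.1, ih' h.2⟩
  | or φ ψ ih ih' => exact fun h => ⟨rfl, ih h.2.1, ih' h.2.2⟩
  | ex x φ ih => exact fun h => ⟨h.1, ih h.2⟩
  | all x φ ih => exact fun h => h

/-- The syntactic shape selected by the flag `pp`. -/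
def HasShape (pp : Bool) (φ : Formula Sym) : Prop :=
  if pp then φ.IsPrimitivePositive else φ.IsExistential

theorem IsAtom.isExistential {φ : Formula Sym} (h : φ.IsAtom) : φ.IsExistential := by
  cases φ <;> trivial

theorem admissible_iff {φ : Formula Sym} : ∀ {env : List ℕ}, env.length ≤ q →
    (Admissible pp r q env φ ↔ (∀ x ∈ φ.freeVars, x ∈ env) ∧ HasShape pp φ ∧
      env.length + φ.qr ≤ q ∧ ∀ R ∈ φ.voc, Arity.ar R ≤ r) := by
  induction φ with
  | rel R x =>
    intro env h
    cases pp <;> simp [Admissible, HasShape, IsPrimitivePositive, IsExistential, freeVars, qr,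
      voc, h, and_comm]
  | eq x y =>
    intro env h
    cases pp <;> simp [Admissible, HasShape, IsPrimitivePositive, IsExistential, freeVars, qr,
      voc, h]
  | neg φ ih =>
    intro env h
    cases pp
    · simp only [Admissible, HasShape, IsExistential, freeVars, qr, voc, ih h]
      constructor
      · rintro ⟨-, h1, h2, h3, h4, h5⟩
        exact ⟨h2, h1, h4, h5⟩
      · rintro ⟨h2, h1, h4, h5⟩
        exact ⟨trivial, h1, h2, h1.isExistential, h4, h5⟩
    · simp [Admissible, HasShape, IsPrimitivePositive]
  | and φ ψ ih ih' =>
    intro env h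
    cases pp <;>
    · simp only [Admissible, HasShape, IsExistential, IsPrimitivePositive, freeVars, qr, voc,
        ih h, ih' h, Finset.mem_union, or_imp, forall_and]
      simp only [if_true, Bool.false_eq_true, if_false]
      have : env.length + max φ.qr ψ.qr ≤ q ↔ env.length + φ.qr ≤ q ∧ env.length + ψ.qr ≤ q := by
        omega
      rw [this]
      tauto
  | or φ ψ ih ih' =>
    intro env h
    cases pp
    · simp only [Admissible, HasShape, IsExistential, freeVars, qr, voc,
        ih h, ih' h, Finset.mem_union, or_imp, forall_and]
      simp only [true_and, Bool.false_eq_true, if_false]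
      have : env.length + max φ.qr ψ.qr ≤ q ↔ env.length + φ.qr ≤ q ∧ env.length + ψ.qr ≤ q := by
        omega
      rw [this]
      tauto
    · simp [Admissible, HasShape, IsPrimitivePositive]
  | ex x φ ih =>
    intro env h
    have hs : HasShape pp (ex x φ) ↔ HasShape pp φ := by cases pp <;> rfl
    simp only [Admissible, hs, freeVars, qr, voc]
    by_cases hl : env.length < q
    · rw [ih (env := x :: env) (by simpa using hl)]
      simp only [hl, true_and, List.length_cons, List.mem_cons, Finset.mem_erase]
      have e1 : env.length + 1 + φ.qr ≤ q ↔ env.length + (1 + φ.qr) ≤ q := by omega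
      have e2 : (∀ y ∈ φ.freeVars, y = x ∨ y ∈ env) ↔
          ∀ y, y ≠ x ∧ y ∈ φ.freeVars → y ∈ env := by
        refine forall_congr' fun y => ?_
        tauto
      rw [e1, e2]
    · simp only [hl, false_and, false_iff]
      rintro ⟨-, -, h3, -⟩
      omega
  | all x φ ih =>
    intro env h
    cases pp <;> simp [Admissible, HasShape, IsPrimitivePositive, IsExistential]

theorem admissible_false_iff (φ : Formula Sym) :
    Admissible false r q [] φ ↔ φ ∈ existentialSentences q r := by
  rw [admissible_iff (by simp)]
  simp [existentialSentences, IsSentence, HasShape, Finset.eq_empty_iff_forall_notMem]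

theorem admissible_true_iff (φ : Formula Sym) :
    Admissible true r q [] φ ↔ φ ∈ primitivePositiveSentences q r := by
  rw [admissible_iff (by simp)]
  simp [primitivePositiveSentences, IsSentence, HasShape, Finset.eq_empty_iff_forall_notMem]

/-! ### Deciding admissibility -/

/-- Admissibility of an atom, in terms of codes. -/
def AtomCodeOK (r : ℕ) (env : List ℕ) (n : ℕ) : Prop :=
  (n.unpair.1 = 0 ∧
    (Denumerable.ofNat (List ℕ) n.unpair.2.unpair.2).length = n.unpair.2.unpair.1.unpair.2 ∧
    n.unpair.2.unpair.1.unpair.2 ≤ r ∧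
    ∀ x ∈ Denumerable.ofNat (List ℕ) n.unpair.2.unpair.2, x ∈ env) ∨
  (n.unpair.1 = 1 ∧ n.unpair.2.unpair.1 ∈ env ∧ n.unpair.2.unpair.2 ∈ env)

instance (r : ℕ) (env : List ℕ) (n : ℕ) : Decidable (AtomCodeOK r env n) := by
  unfold AtomCodeOK
  infer_instance

theorem encode_sym (R : Sym) : Encodable.encode R = Nat.pair R.1 R.2 := rfl

theorem atomCodeOK_iff {env : List ℕ} {n : ℕ} :
    AtomCodeOK r env n ↔
      ∃ φ : Formula Sym, φ.code = n ∧ φ.IsAtom ∧ Admissible pp r q env φ := by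
  constructor
  · rintro (⟨h0, hl, hr, hx⟩ | ⟨h1, hx, hy⟩)
    · let R : Sym := n.unpair.2.unpair.1.unpair
      let xs := Denumerable.ofNat (List ℕ) n.unpair.2.unpair.2
      have hR : Arity.ar R = xs.length := hl.symm
      refine ⟨rel R (fun i => xs.get (i.cast hR)), ?_, trivial, hr,
        fun i => hx _ (List.get_mem _ _)⟩
      have e1 : List.ofFn (fun i : Fin (Arity.ar R) => xs.get (i.cast hR)) = xs := by
        rw [← List.ofFn_congr hR.symm, List.ofFn_get]
      rw [code, e1, encode_sym, Denumerable.encode_ofNat, Nat.pair_unpair, Nat.pair_unpair, ← h0,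
        Nat.pair_unpair]
    · refine ⟨eq n.unpair.2.unpair.1 n.unpair.2.unpair.2, ?_, trivial, hx, hy⟩
      rw [code, Nat.pair_unpair, ← h1, Nat.pair_unpair]
  · rintro ⟨φ, rfl, ha, h⟩
    cases φ with
    | rel R x =>
      left
      simp only [code, Nat.unpair_pair, Denumerable.ofNat_encode, encode_sym, List.length_ofFn,
        List.forall_mem_ofFn_iff, true_and]
      exact ⟨rfl, h⟩
    | eq x y =>
      right
      simpa [code, Admissible] using h
    | _ => exact ha.elim

theorem primrecPred_atomCodeOK (r : ℕ) :
    PrimrecPred fun p : List ℕ × ℕ => AtomCodeOK r p.1 p.2 := by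
  have hn : Primrec fun p : List ℕ × ℕ => p.2.unpair := Primrec.unpair.comp Primrec.snd
  have h1 : Primrec fun p : List ℕ × ℕ => p.2.unpair.2.unpair.1 :=
    Primrec.fst.comp (Primrec.unpair.comp (Primrec.snd.comp hn))
  have h2 : Primrec fun p : List ℕ × ℕ => p.2.unpair.2.unpair.2 :=
    Primrec.snd.comp (Primrec.unpair.comp (Primrec.snd.comp hn))
  have hl : Primrec fun p : List ℕ × ℕ => Denumerable.ofNat (List ℕ) p.2.unpair.2.unpair.2 :=
    (Primrec.ofNat (List ℕ)).comp h2
  have har : Primrec fun p : List ℕ × ℕ => p.2.unpair.2.unpair.1.unpair.2 :=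
    Primrec.snd.comp (Primrec.unpair.comp h1)
  have hall : PrimrecRel fun (L : List ℕ) (env : List ℕ) => ∀ x ∈ L, x ∈ env :=
    PrimrecRel.forall_mem_list (R := fun (x : ℕ) (env : List ℕ) => x ∈ env) primrecPred_mem
  refine PrimrecPred.or (PrimrecPred.and ?_ (PrimrecPred.and ?_ (PrimrecPred.and ?_ ?_)))
    (PrimrecPred.and ?_ (PrimrecPred.and ?_ ?_))
  · exact Primrec.eq.comp (Primrec.fst.comp hn) (Primrec.const 0)
  · exact Primrec.eq.comp (Primrec.list_length.comp hl) har
  · exact Primrec.nat_le.comp har (Primrec.const r)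
  · exact hall.comp hl Primrec.fst
  · exact Primrec.eq.comp (Primrec.fst.comp hn) (Primrec.const 1)
  · exact primrecPred_mem.comp (h1.pair Primrec.fst)
  · exact primrecPred_mem.comp (h2.pair Primrec.fst)

/-- The environment below a connective with code `n`: a quantifier adds its variable. -/
def nextEnv (env : List ℕ) (n : ℕ) : List ℕ :=
  if n.unpair.1 = 5 then n.unpair.2.unpair.1 :: env else env

theorem primrec_nextEnv : Primrec₂ nextEnv := by
  have hn : Primrec fun p : List ℕ × ℕ => p.2.unpair := Primrec.unpair.comp Primrec.snd
  exact Primrec.ite (Primrec.eq.comp (Primrec.fst.comp hn) (Primrec.const 5))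
    (Primrec.list_cons.comp (Primrec.fst.comp (Primrec.unpair.comp (Primrec.snd.comp hn)))
      Primrec.fst) Primrec.fst

/-- The decision procedure for admissibility on atoms and negated atoms. -/
def checkBase (pp : Bool) (r : ℕ) (env : List ℕ) (n : ℕ) : Bool :=
  decide (AtomCodeOK r env n ∨ (pp = false ∧ n.unpair.1 = 2 ∧ AtomCodeOK r env n.unpair.2))

/-- The decision procedure for admissibility at connectives and quantifiers; `x` and `y` are
the answers for the two parts. -/
def checkStep (pp : Bool) (q : ℕ) (env : List ℕ) (n : ℕ) (x y : Bool) : Bool :=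
  decide ((n.unpair.1 = 3 ∧ x = true ∧ y = true) ∨
    (n.unpair.1 = 4 ∧ pp = false ∧ x = true ∧ y = true) ∨
    (n.unpair.1 = 5 ∧ env.length < q ∧ y = true))

/-- The decision procedure for admissibility. -/
def check (pp : Bool) (r q : ℕ) : List ℕ → ℕ → Bool :=
  codeRec (checkBase pp r) nextEnv (checkStep pp q)

theorem check_iff (n : ℕ) : ∀ env : List ℕ,
    (check pp r q env n = true ↔ ∃ φ : Formula Sym, φ.code = n ∧ Admissible pp r q env φ) := by
  induction n using Nat.strong_induction_on with
  | _ n ih =>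
  intro env
  obtain ⟨t, m, rfl⟩ : ∃ t m, n = Nat.pair t m := ⟨_, _, (Nat.pair_unpair n).symm⟩
  have h1 := Nat.add_le_pair t m
  have h2 := Nat.unpair_left_le m
  have h3 := Nat.unpair_right_le m
  by_cases ht : t ≤ 2
  · rw [check, codeRec_base _ _ _ _ ht, checkBase, decide_eq_true_iff]
    rw [atomCodeOK_iff (pp := pp) (q := q), atomCodeOK_iff (pp := pp) (q := q)]
    simp only [Nat.unpair_pair]
    constructor
    · rintro (⟨φ, hc, -, h⟩ | ⟨hp, rfl, φ, hc, ha, h⟩)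
      · exact ⟨φ, hc, h⟩
      · exact ⟨neg φ, by rw [code, hc], hp, ha, h⟩
    · rintro ⟨φ, hc, h⟩
      cases φ with
      | rel R x => exact Or.inl ⟨_, hc, trivial, h⟩
      | eq R x => exact Or.inl ⟨_, hc, trivial, h⟩
      | neg φ =>
        simp only [code, Nat.pair_eq_pair] at hc
        exact Or.inr ⟨h.1, hc.1.symm, φ, hc.2, h.2.1, h.2.2⟩
      | _ =>
        simp only [code, Nat.pair_eq_pair] at hc
        omega
  · have e1 := ih m.unpair.1 (by omega)
    have e2 := ih m.unpair.2 (by omega)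
    rw [check] at e1 e2 ⊢
    rw [codeRec_step _ _ _ _ (by omega), checkStep, decide_eq_true_iff, e1, e2]
    simp only [nextEnv, Nat.unpair_pair]
    constructor
    · rintro (⟨rfl, ⟨φ, hφ, h⟩, ⟨ψ, hψ, h'⟩⟩ | ⟨rfl, hp, ⟨φ, hφ, h⟩, ⟨ψ, hψ, h'⟩⟩ |
        ⟨rfl, hl, ⟨ψ, hψ, h⟩⟩)
      · exact ⟨and φ ψ, by rw [code, hφ, hψ, Nat.pair_unpair], h, h'⟩
      · exact ⟨or φ ψ, by rw [code, hφ, hψ, Nat.pair_unpair], hp, h, h'⟩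
      · exact ⟨ex m.unpair.1 ψ, by rw [code, hψ, Nat.pair_unpair], hl, h⟩
    · rintro ⟨φ, hc, h⟩
      cases φ with
      | and φ ψ =>
        simp only [code, Nat.pair_eq_pair] at hc
        obtain ⟨rfl, rfl⟩ := hc
        simp only [Nat.unpair_pair]
        exact Or.inl ⟨trivial, ⟨φ, rfl, h.1⟩, ⟨ψ, rfl, h.2⟩⟩
      | or φ ψ =>
        simp only [code, Nat.pair_eq_pair] at hc
        obtain ⟨rfl, rfl⟩ := hc
        simp only [Nat.unpair_pair]
        exact Or.inr (Or.inl ⟨trivial, h.1, ⟨φ, rfl, h.2.1⟩, ⟨ψ, rfl, h.2.2⟩⟩)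
      | ex x φ =>
        simp only [code, Nat.pair_eq_pair] at hc
        obtain ⟨rfl, rfl⟩ := hc
        simp only [Nat.unpair_pair]
        exact Or.inr (Or.inr ⟨trivial, h.1, ⟨φ, rfl, h.2⟩⟩)
      | all x φ => exact h.elim
      | _ =>
        simp only [code, Nat.pair_eq_pair] at hc
        omega

theorem primrec_check (pp : Bool) (r q : ℕ) : Primrec₂ (check pp r q) := by
  have hn : Primrec fun p : List ℕ × ℕ => p.2.unpair := Primrec.unpair.comp Primrec.snd
  refine primrec_codeRec ?_ primrec_nextEnv ?_
  · refine PrimrecPred.decide (p := fun p : List ℕ × ℕ => AtomCodeOK r p.1 p.2 ∨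
      (pp = false ∧ p.2.unpair.1 = 2 ∧ AtomCodeOK r p.1 p.2.unpair.2)) ?_
    refine (primrecPred_atomCodeOK r).or (PrimrecPred.and ?_ (PrimrecPred.and ?_ ?_))
    · exact Primrec.eq.comp (Primrec.const pp) (Primrec.const false)
    · exact Primrec.eq.comp (Primrec.fst.comp hn) (Primrec.const 2)
    · exact (primrecPred_atomCodeOK r).comp (Primrec.fst.pair (Primrec.snd.comp hn))
  · have ht : Primrec fun x : (List ℕ × ℕ) × (Bool × Bool) => x.1.2.unpair.1 :=
      Primrec.fst.comp (hn.comp Primrec.fst)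
    have hx : PrimrecPred fun x : (List ℕ × ℕ) × (Bool × Bool) => x.2.1 = true :=
      Primrec.eq.comp (Primrec.fst.comp Primrec.snd) (Primrec.const true)
    have hy : PrimrecPred fun x : (List ℕ × ℕ) × (Bool × Bool) => x.2.2 = true :=
      Primrec.eq.comp (Primrec.snd.comp Primrec.snd) (Primrec.const true)
    refine PrimrecPred.decide (p := fun x : (List ℕ × ℕ) × (Bool × Bool) =>
      (x.1.2.unpair.1 = 3 ∧ x.2.1 = true ∧ x.2.2 = true) ∨
      (x.1.2.unpair.1 = 4 ∧ pp = false ∧ x.2.1 = true ∧ x.2.2 = true) ∨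
      (x.1.2.unpair.1 = 5 ∧ x.1.1.length < q ∧ x.2.2 = true)) ?_
    refine PrimrecPred.or ((Primrec.eq.comp ht (Primrec.const 3)).and (hx.and hy))
      (PrimrecPred.or ((Primrec.eq.comp ht (Primrec.const 4)).and (PrimrecPred.and ?_ (hx.and hy)))
        ((Primrec.eq.comp ht (Primrec.const 5)).and (PrimrecPred.and ?_ hy)))
    · exact Primrec.eq.comp (Primrec.const pp) (Primrec.const false)
    · exact Primrec.nat_lt.comp (Primrec.list_length.comp (Primrec.fst.comp Primrec.fst))
        (Primrec.const q)

end Formula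

/-! ### Truth as a game of bounded length -/

/-- The depth at which the current binding of the variable `y` took place. The value is
irrelevant if `y` is not in `env`. -/
def level (env : List ℕ) (y : ℕ) : ℕ := env.length - 1 - env.idxOf y

theorem level_lt {env : List ℕ} {y : ℕ} (h : y ∈ env) : level env y < env.length := by
  have := List.length_pos_of_mem h
  unfold level
  omega

theorem level_cons_self (env : List ℕ) (y : ℕ) : level (y :: env) y = env.length := by
  simp [level]

theorem level_cons_of_ne (env : List ℕ) {x y : ℕ} (h : y ≠ x) :
    level (x :: env) y = level env y := by
  simp only [level, List.length_cons]
  rw [List.idxOf_cons_ne _ h.symm]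
  omega

section Game

variable {C : Type}

/-- The assignment of the variables in `env`, if `X` lists the elements chosen at the depths
`0, 1, …`. -/
def assign (env : List ℕ) (X : ℕ → C) : ℕ → C := fun y => X (level env y)

/-- A game with `j` rounds left out of `q`. In the round at depth `d` the first player chooses a
number below `M`, which becomes `S d`, and the second player answers with an element, which
becomes `X d`. The second player wins the plays that end with `P S X`; the proposition says that
she has a winning strategy. -/
def GameWon (q M : ℕ) (P : (ℕ → ℕ) → (ℕ → C) → Prop) : ℕ → (ℕ → ℕ) → (ℕ → C) → Prop
  | 0, S, X => P S X
  | j + 1, S, X => ∀ s < M, ∃ a, GameWon q M P j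
      (Function.update S (q - (j + 1)) s) (Function.update X (q - (j + 1)) a)

variable {q M : ℕ} {P P' : (ℕ → ℕ) → (ℕ → C) → Prop}

theorem update_eq_of_lt {β : Type} (f : ℕ → β) {i n : ℕ} (a : β) (h : i < n) :
    Function.update f n a i = f i := Function.update_of_ne (by omega) _ _

/-- The final condition needs to be compared only on plays that extend the given position. -/
theorem GameWon.mono {j : ℕ} : ∀ {S : ℕ → ℕ} {X : ℕ → C}, GameWon q M P j S X →
    (∀ S' X', (∀ i < q - j, S' i = S i) → (∀ i < q - j, X' i = X i) → P S' X' → P' S' X') →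
    GameWon q M P' j S X := by
  induction j with
  | zero => exact fun h hP => hP _ _ (fun _ _ => rfl) (fun _ _ => rfl) h
  | succ j ih =>
    intro S X h hP s hs
    obtain ⟨a, ha⟩ := h s hs
    refine ⟨a, ih ha fun S' X' hS hX => hP S' X' ?_ ?_⟩
    · intro i hi
      rw [hS i (by omega), update_eq_of_lt _ _ hi]
    · intro i hi
      rw [hX i (by omega), update_eq_of_lt _ _ hi]

theorem GameWon.of_forall [Nonempty C] {j : ℕ} : ∀ {S : ℕ → ℕ} {X : ℕ → C},
    (∀ S' X', (∀ i < q - j, X' i = X i) → P S' X') → GameWon q M P j S X := by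
  induction j with
  | zero => exact fun hP => hP _ _ (fun _ _ => rfl)
  | succ j ih =>
    intro S X hP s hs
    refine ⟨Classical.arbitrary C, ih fun S' X' hX => hP S' X' fun i hi => ?_⟩
    rw [hX i (by omega), update_eq_of_lt _ _ hi]

/-- A position is determined by what has been chosen so far. -/
theorem GameWon.congr {j : ℕ} (hj : j ≤ q)
    (hP : ∀ S S' X X', (∀ i < q, S i = S' i) → (∀ i < q, X i = X' i) → P S X → P S' X') :
    ∀ {S S' : ℕ → ℕ} {X X' : ℕ → C}, (∀ i < q - j, S i = S' i) → (∀ i < q - j, X i = X' i) →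
      GameWon q M P j S X → GameWon q M P j S' X' := by
  induction j with
  | zero => exact fun hS hX h => hP _ _ _ _ hS hX h
  | succ j ih =>
    intro S S' X X' hS hX h s hs
    obtain ⟨a, ha⟩ := h s hs
    refine ⟨a, ih (by omega) (fun i hi => ?_) (fun i hi => ?_) ha⟩
    · by_cases hd : i = q - (j + 1)
      · subst hd; simp
      · rw [Function.update_of_ne hd, Function.update_of_ne hd, hS i (by omega)]
    · by_cases hd : i = q - (j + 1)
      · subst hd; simp
      · rw [Function.update_of_ne hd, Function.update_of_ne hd, hX i (by omega)]

end Game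

namespace Formula

/-- The number naming the occurrence of a formula with code `n` below the bindings `env`. -/
def positionCode (env : List ℕ) (n : ℕ) : ℕ := Encodable.encode (env, n)

/-- The truth value of an existential formula after a play of the game. The binary digits of `S d`
tell which conjunct has to be verified for the conjunctions at depth `d` (a digit `1` selects the
left one). All existential quantifiers at depth `d` use the same witness `X d`: this suffices, as
only one of the existential formulas at depth `d` that are not excluded by `S d` needs to be true.
Below depth `q` there are no quantifiers, and conjunctions have their usual meaning. -/
def Eval (A : Str Sym) (q : ℕ) (S : ℕ → ℕ) (X : ℕ → A.carrier) :
    List ℕ → Formula Sym → Prop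
  | env, rel R x => A.rel R (fun i => X (level env (x i)))
  | env, eq x y => X (level env x) = X (level env y)
  | env, neg φ => ¬ Eval A q S X env φ
  | env, and φ ψ =>
      if env.length < q then
        if (S env.length).testBit (positionCode env (code (and φ ψ)))
        then Eval A q S X env φ else Eval A q S X env ψ
      else Eval A q S X env φ ∧ Eval A q S X env ψ
  | env, or φ ψ => Eval A q S X env φ ∨ Eval A q S X env ψ
  | env, ex x φ => Eval A q S X (x :: env) φ
  | _, all _ _ => True

variable {A : Str Sym} {pp : Bool} {r q : ℕ}

theorem sat_congr {φ : Formula Sym} : ∀ {v w : ℕ → A.carrier}, (∀ x ∈ φ.freeVars, v x = w x) →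
    (Sat A v φ ↔ Sat A w φ) := by
  have upd : ∀ (φ : Formula Sym) (x : ℕ) (v w : ℕ → A.carrier),
      (∀ y ∈ φ.freeVars.erase x, v y = w y) → ∀ a, ∀ y ∈ φ.freeVars,
        Function.update v x a y = Function.update w x a y := by
    intro φ x v w h a y hy
    by_cases hxy : y = x
    · subst hxy; simp
    · simpa [hxy] using h y (Finset.mem_erase.2 ⟨hxy, hy⟩)
  induction φ with
  | rel R x =>
    intro v w h
    simp only [Sat]
    rw [show (fun i => v (x i)) = fun i => w (x i) from funext fun i => h _ (by simp [freeVars])]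
  | eq x y =>
    intro v w h
    simp only [Sat]
    rw [h x (by simp [freeVars]), h y (by simp [freeVars])]
  | neg φ ih => exact fun h => not_congr (ih h)
  | and φ ψ ih ih' =>
    exact fun h => and_congr (ih fun x hx => h x (Finset.mem_union_left _ hx))
      (ih' fun x hx => h x (Finset.mem_union_right _ hx))
  | or φ ψ ih ih' =>
    exact fun h => or_congr (ih fun x hx => h x (Finset.mem_union_left _ hx))
      (ih' fun x hx => h x (Finset.mem_union_right _ hx))
  | ex x φ ih => exact fun h => exists_congr fun a => ih (upd φ x _ _ h a)
  | all x φ ih => exact fun h => forall_congr' fun a => ih (upd φ x _ _ h a)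

theorem Admissible.freeVars_mem {φ : Formula Sym} : ∀ {env : List ℕ},
    Admissible pp r q env φ → ∀ x ∈ φ.freeVars, x ∈ env := by
  induction φ with
  | rel R x =>
    intro env h y hy
    obtain ⟨i, -, rfl⟩ := Finset.mem_image.1 hy
    exact h.2 i
  | eq x y =>
    intro env h z hz
    simp only [freeVars, Finset.mem_insert, Finset.mem_singleton] at hz
    rcases hz with rfl | rfl
    exacts [h.1, h.2]
  | neg φ ih => exact fun h => ih h.2.2
  | and φ ψ ih ih' =>
    exact fun h x hx => (Finset.mem_union.1 hx).elim (ih h.1 x) (ih' h.2 x)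
  | or φ ψ ih ih' =>
    exact fun h x hx => (Finset.mem_union.1 hx).elim (ih h.2.1 x) (ih' h.2.2 x)
  | ex y φ ih =>
    intro env h x hx
    obtain ⟨hne, hx⟩ := Finset.mem_erase.1 hx
    exact (List.mem_cons.1 (ih h.2 x hx)).resolve_left hne
  | all x φ ih => exact fun h => h.elim

/-- Choosing an element at the next depth amounts to assigning it to the quantified variable. -/
theorem sat_assign_cons {φ : Formula Sym} {env : List ℕ} {x : ℕ}
    (h : Admissible pp r q (x :: env) φ) (X : ℕ → A.carrier) (a : A.carrier) :
    Sat A (assign (x :: env) (Function.update X env.length a)) φ ↔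
      Sat A (Function.update (assign env X) x a) φ := by
  refine sat_congr fun y hy => ?_
  by_cases hxy : y = x
  · subst hxy
    simp [assign, level_cons_self]
  · have hy' : y ∈ env := (List.mem_cons.1 (h.freeVars_mem y hy)).resolve_left hxy
    rw [Function.update_of_ne hxy]
    simp only [assign, level_cons_of_ne env hxy]
    exact update_eq_of_lt _ _ (level_lt hy')

theorem eval_congr {S S' : ℕ → ℕ} {X X' : ℕ → A.carrier} (hS : ∀ i < q, S i = S' i)
    (hX : ∀ i < q, X i = X' i) {φ : Formula Sym} : ∀ {env : List ℕ}, env.length ≤ q →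
    Admissible pp r q env φ → (Eval A q S X env φ ↔ Eval A q S' X' env φ) := by
  induction φ with
  | rel R x =>
    intro env hl h
    simp only [Eval]
    rw [show (fun i => X (level env (x i))) = fun i => X' (level env (x i)) from
      funext fun i => hX _ ((level_lt (h.2 i)).trans_le hl)]
  | eq x y =>
    intro env hl h
    simp only [Eval]
    rw [hX _ ((level_lt h.1).trans_le hl), hX _ ((level_lt h.2).trans_le hl)]
  | neg φ ih => exact fun hl h => not_congr (ih hl h.2.2)
  | and φ ψ ih ih' =>
    intro env hl h
    simp only [Eval]
    rw [ih hl h.1, ih' hl h.2]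
    split_ifs with h1 h2 h3 h3
    · rfl
    · rw [hS _ h1] at h2; exact absurd h2 h3
    · rw [hS _ h1] at h2; exact absurd h3 h2
    · rfl
    · rfl
  | or φ ψ ih ih' => exact fun hl h => or_congr (ih hl h.2.1) (ih' hl h.2.2)
  | ex x φ ih => exact fun hl h => ih (by simpa using h.1) h.2
  | all x φ ih => exact fun _ h => h.elim

theorem eval_atom_iff {S : ℕ → ℕ} {X : ℕ → A.carrier} {φ : Formula Sym} (h : φ.IsAtom)
    (env : List ℕ) : Eval A q S X env φ ↔ Sat A (assign env X) φ := by
  cases φ <;> first | rfl | exact h.elim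

/-- At depth `q` there are no quantifiers left, and evaluation is satisfaction. -/
theorem eval_iff_of_length_eq {S : ℕ → ℕ} {X : ℕ → A.carrier} {env : List ℕ}
    (hl : env.length = q) {φ : Formula Sym} (h : Admissible pp r q env φ) :
    Eval A q S X env φ ↔ Sat A (assign env X) φ := by
  induction φ with
  | rel R x => rfl
  | eq x y => rfl
  | neg φ ih => exact not_congr (ih h.2.2)
  | and φ ψ ih ih' =>
    simp only [Eval, hl, lt_irrefl, if_false]
    exact and_congr (ih h.1) (ih' h.2)
  | or φ ψ ih ih' => exact or_congr (ih h.2.1) (ih' h.2.2)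
  | ex x φ ih => exact absurd h.1 (by omega)
  | all x φ ih => exact h.elim

theorem assign_eq_of_agree {C : Type} {env : List ℕ} {X X' : ℕ → C}
    (h : ∀ i < env.length, X' i = X i) {x : ℕ} (hx : x ∈ env) :
    assign env X' x = assign env X x := h _ (level_lt hx)

/-- If an existential formula is true, then the second player wins by playing witnesses. -/
theorem gameWon_of_sat {M : ℕ} {φ : Formula Sym} : ∀ {env : List ℕ} {j : ℕ},
    env.length + j = q → Admissible pp r q env φ → ∀ (S : ℕ → ℕ) (X : ℕ → A.carrier),
    Sat A (assign env X) φ → GameWon q M (fun S X => Eval A q S X env φ) j S X := by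
  have := A.nonempty
  have hlit : ∀ (φ : Formula Sym) {env : List ℕ} {j : ℕ}, env.length + j = q →
      (∀ S X, Eval A q S X env φ ↔ Sat A (assign env X) φ) →
      Admissible pp r q env φ → ∀ (S : ℕ → ℕ) (X : ℕ → A.carrier),
      Sat A (assign env X) φ → GameWon q M (fun S X => Eval A q S X env φ) j S X := by
    intro φ env j hj he h S X hs
    refine GameWon.of_forall fun S' X' hX => (he _ _).2 ?_
    refine (sat_congr fun x hx => ?_).2 hs
    exact assign_eq_of_agree (fun i hi => hX i (by omega)) (h.freeVars_mem x hx)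
  induction φ with
  | rel R x => exact fun hj h => hlit _ hj (fun _ _ => eval_atom_iff (by trivial) _) h
  | eq x y => exact fun hj h => hlit _ hj (fun _ _ => eval_atom_iff (by trivial) _) h
  | neg φ ih =>
    exact fun hj h => hlit _ hj (fun _ _ => not_congr (eval_atom_iff h.2.1 _)) h
  | and φ ψ ih ih' =>
    intro env j hj h S X hs
    have h1 := ih hj h.1 S X hs.1
    have h2 := ih' hj h.2 S X hs.2
    rcases j with _ | j
    · exact (eval_iff_of_length_eq (by omega) h).2 hs
    · intro s hs
      have hd : q - (j + 1) = env.length := by omega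
      have hb : ∀ S' : ℕ → ℕ, (∀ i < q - j, S' i = Function.update S (q - (j + 1)) s i) →
          S' env.length = s := by
        intro S' hS
        rw [hS _ (by omega), hd]
        simp
      -- the first move reveals which conjunct matters, and the strategy for this one is followed
      by_cases hbit : s.testBit (positionCode env (code (and φ ψ)))
      · obtain ⟨a, ha⟩ := h1 s hs
        refine ⟨a, ha.mono fun S' X' hS hX he => ?_⟩
        simp only [Eval]
        rwa [if_pos (by omega), hb S' hS, if_pos hbit]
      · obtain ⟨a, ha⟩ := h2 s hs
        refine ⟨a, ha.mono fun S' X' hS hX he => ?_⟩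
        simp only [Eval]
        rwa [if_pos (by omega), hb S' hS, if_neg hbit]
  | or φ ψ ih ih' =>
    intro env j hj h S X hs
    rcases hs with hs | hs
    · exact (ih hj h.2.1 S X hs).mono fun _ _ _ _ he => Or.inl he
    · exact (ih' hj h.2.2 S X hs).mono fun _ _ _ _ he => Or.inr he
  | ex x φ ih =>
    intro env j hj h S X hs
    obtain ⟨a, ha⟩ := hs
    have hlt := h.1
    obtain ⟨j, rfl⟩ : ∃ i, j = i + 1 := ⟨j - 1, by omega⟩
    intro s _
    have hd : q - (j + 1) = env.length := by omega
    refine ⟨a, ih (env := x :: env) (by simp only [List.length_cons]; omega) h.2 _ _ ?_⟩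
    rw [hd]
    exact (sat_assign_cons h.2 X a).2 ha
  | all x φ ih => exact fun _ h => h.elim

/-! ### Soundness of the game -/

/-- An upper bound for the numbers naming the positions of a formula, by recursion on its code. -/
def positionBound : List ℕ → ℕ → ℕ :=
  codeRec (fun _ _ => 0) nextEnv
    (fun env n x y => max (positionCode env n + 1) (max x y))

theorem primrec_positionBound : Primrec₂ positionBound := by
  refine primrec_codeRec (Primrec.const 0) primrec_nextEnv ?_
  refine Primrec.nat_max.comp (Primrec.succ.comp (Primrec.encode.comp Primrec.fst))
    (Primrec.nat_max.comp (Primrec.fst.comp Primrec.snd) (Primrec.snd.comp Primrec.snd))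

theorem positionBound_and (env : List ℕ) (φ ψ : Formula Sym) :
    positionBound env (code (and φ ψ)) = max (positionCode env (code (and φ ψ)) + 1)
      (max (positionBound env φ.code) (positionBound env ψ.code)) := by
  conv_lhs => rw [positionBound, code, codeRec_step _ _ _ _ (by norm_num)]
  simp [nextEnv, positionBound, code]

theorem positionBound_or (env : List ℕ) (φ ψ : Formula Sym) :
    positionBound env (code (or φ ψ)) = max (positionCode env (code (or φ ψ)) + 1)
      (max (positionBound env φ.code) (positionBound env ψ.code)) := by
  conv_lhs => rw [positionBound, code, codeRec_step _ _ _ _ (by norm_num)]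
  simp [nextEnv, positionBound, code]

theorem positionBound_ex (env : List ℕ) (x : ℕ) (φ : Formula Sym) :
    positionBound (x :: env) φ.code ≤ positionBound env (code (ex x φ)) := by
  conv_rhs => rw [positionBound, code, codeRec_step _ _ _ _ (by norm_num)]
  simp [nextEnv, positionBound]

/-- The false formulas at the depth `d`, with all positions below them bounded by `N`. -/
def FalseAt (A : Str Sym) (pp : Bool) (r q N d : ℕ) (X : ℕ → A.carrier) (env : List ℕ)
    (φ : Formula Sym) : Prop :=
  env.length = d ∧ Admissible pp r q env φ ∧ positionBound env φ.code ≤ N ∧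
    ¬ Sat A (assign env X) φ

/-- There is a number whose binary digits select a false conjunct of every false conjunction. -/
theorem exists_selection (A : Str Sym) (N : ℕ) (X : ℕ → A.carrier) :
    ∃ s < 2 ^ N, ∀ (env : List ℕ) (φ ψ : Formula Sym), positionCode env (code (and φ ψ)) < N →
      (s.testBit (positionCode env (code (and φ ψ))) ↔ ¬ Sat A (assign env X) φ) := by
  classical
  let T : ℕ → Prop := fun n => ∃ (env : List ℕ) (φ ψ : Formula Sym),
    n = positionCode env (code (and φ ψ)) ∧ ¬ Sat A (assign env X) φ
  refine ⟨Nat.ofBits (fun i : Fin N => decide (T i)), Nat.ofBits_lt_two_pow _, ?_⟩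
  intro env φ ψ hlt
  rw [Nat.testBit_ofBits_lt _ _ hlt, decide_eq_true_iff]
  constructor
  · rintro ⟨env', φ', ψ', h, hs⟩
    have h' := Encodable.encode_injective h
    simp only [Prod.mk.injEq] at h'
    obtain ⟨rfl, h2⟩ := h'
    have h3 := code_injective h2
    simp only [and.injEq] at h3
    rwa [h3.1]
  · exact fun h => ⟨env, φ, ψ, rfl, h⟩

/-- The first player wins by always selecting false conjuncts: whatever the second player does, only
false formulas remain for her to verify. -/
theorem not_gameWon_falseAt {N : ℕ} : ∀ {j : ℕ}, j ≤ q → ∀ (S : ℕ → ℕ) (X : ℕ → A.carrier),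
    ¬ GameWon q (2 ^ N) (fun S' X' => ∃ env φ, FalseAt A pp r q N (q - j) X env φ ∧
      Eval A q S' X' env φ) j S X := by
  intro j
  induction j with
  | zero =>
    rintro - S X ⟨env, φ, ⟨hl, h, -, hs⟩, he⟩
    exact hs ((eval_iff_of_length_eq (by omega) h).1 he)
  | succ j ih =>
    intro hj S X hw
    obtain ⟨s, hs, hsel⟩ := exists_selection A N X
    obtain ⟨a, ha⟩ := hw s hs
    refine ih (by omega) _ _ (ha.mono fun S' X' hS hX => ?_)
    set d := q - (j + 1) with hd
    have hSd : S' d = s := by rw [hS d (by omega)]; simp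
    have hXd : ∀ i < d, X' i = X i := fun i hi => by
      rw [hX i (by omega), update_eq_of_lt _ _ hi]
    rintro ⟨env, φ, hF, he⟩
    have hlit : ∀ (φ : Formula Sym), (Eval A q S' X' env φ ↔ Sat A (assign env X') φ) →
        FalseAt A pp r q N d X env φ → ¬ Eval A q S' X' env φ := by
      rintro φ hiff ⟨hl, h, -, hns⟩ he
      refine hns ((sat_congr fun x hx => ?_).1 (hiff.1 he))
      exact assign_eq_of_agree (fun i hi => hXd i (by omega)) (h.freeVars_mem x hx)
    induction φ with
    | rel R x => exact absurd he (hlit _ (eval_atom_iff (by trivial) _) hF)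
    | eq x y => exact absurd he (hlit _ (eval_atom_iff (by trivial) _) hF)
    | neg φ _ =>
      exact absurd he (hlit _ (not_congr (eval_atom_iff hF.2.1.2.1 _)) hF)
    | and φ ψ ih1 ih2 =>
      obtain ⟨hl, h, hb, hns⟩ := hF
      rw [positionBound_and] at hb
      have hb' := hsel env φ ψ (by omega)
      simp only [Eval] at he
      rw [if_pos (by omega), hl, hSd] at he
      split_ifs at he with hbit
      · exact ih1 ⟨hl, h.1, by omega, hb'.1 hbit⟩ he
      · refine ih2 ⟨hl, h.2, by omega, fun hψ => hns ⟨?_, hψ⟩⟩ he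
        by_contra hφ
        exact hbit (hb'.2 hφ)
    | or φ ψ ih1 ih2 =>
      obtain ⟨hl, h, hb, hns⟩ := hF
      rw [positionBound_or] at hb
      rcases he with he | he
      · exact ih1 ⟨hl, h.2.1, by omega, fun hφ => hns (Or.inl hφ)⟩ he
      · exact ih2 ⟨hl, h.2.2, by omega, fun hψ => hns (Or.inr hψ)⟩ he
    | ex x φ _ =>
      obtain ⟨hl, h, hb, hns⟩ := hF
      refine ⟨x :: env, φ, ⟨by simp only [List.length_cons]; omega, h.2,
        (positionBound_ex env x φ).trans hb, fun hφ => hns ⟨a, ?_⟩⟩, he⟩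
      rw [← hl] at hφ
      exact (sat_assign_cons h.2 X a).1 hφ
    | all x φ _ => exact hF.2.1.elim

/-- An existential sentence is true iff the second player wins the game. -/
theorem holds_iff_gameWon {φ : Formula Sym} (h : Admissible pp r q [] φ) (S : ℕ → ℕ)
    (X : ℕ → A.carrier) : Holds A φ ↔
      GameWon q (2 ^ positionBound [] φ.code) (fun S X => Eval A q S X [] φ) q S X := by
  have hfree : ∀ v w : ℕ → A.carrier, Sat A v φ ↔ Sat A w φ := fun v w =>
    sat_congr fun x hx => absurd (h.freeVars_mem x hx) (by simp)
  constructor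
  · exact fun hφ => gameWon_of_sat (by simp) h S X (hφ _)
  · intro hw
    by_contra hn
    obtain ⟨v, hv⟩ := not_forall.1 hn
    refine not_gameWon_falseAt (pp := pp) (r := r) le_rfl S X (hw.mono fun S' X' _ _ he => ?_)
    exact ⟨[], φ, ⟨by simp, h, le_rfl, fun hs => hv ((hfree _ _).1 hs)⟩, he⟩

end Formula

/-! ### The complete forest with a given branching number -/

/-- The number of nodes of the complete forest with `j` levels in which there are `M` roots, and
all nodes that are not on the last level have `M` children. The nodes are numbered level by
level, so the nodes on level `l` are the numbers `u` with `treeSize M l ≤ u < treeSize M (l + 1)`,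
and the children of `u` are the numbers `M * (u + 1) + s` with `s < M`. -/
def treeSize (M : ℕ) : ℕ → ℕ
  | 0 => 0
  | j + 1 => M * (treeSize M j + 1)

/-- The parent of a node that is not a root, i.e. of a number `u ≥ M`. -/
def parent (M u : ℕ) : ℕ := u / M - 1

/-- The numbers of the branches that lead to a node `u` on level `l`. -/
def digits (M l u : ℕ) : ℕ → ℕ := fun i => (parent M)^[l - i] u % M

section Arithmetic

variable {M : ℕ}

theorem treeSize_lt_succ (hM : 0 < M) (j : ℕ) : treeSize M j < treeSize M (j + 1) := by
  show _ < M * (treeSize M j + 1)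
  nlinarith

theorem treeSize_strictMono (hM : 0 < M) : StrictMono (treeSize M) :=
  strictMono_nat_of_lt_succ (treeSize_lt_succ hM)

theorem treeSize_one : treeSize M 1 = M := by simp [treeSize]

theorem parent_lt (hM : 0 < M) {u : ℕ} (hu : M ≤ u) : parent M u < u := by
  have h1 := Nat.div_le_self u M
  have h2 : 0 < u / M := Nat.div_pos hu hM
  unfold parent
  omega

theorem treeSize_succ_le_iff (hM : 0 < M) {u : ℕ} (hu : M ≤ u) (j : ℕ) :
    treeSize M (j + 1) ≤ u ↔ treeSize M j ≤ parent M u := by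
  have h2 : 0 < u / M := Nat.div_pos hu hM
  show M * (treeSize M j + 1) ≤ u ↔ _
  rw [mul_comm, ← Nat.le_div_iff_mul_le hM]
  unfold parent
  omega

theorem parent_child (hM : 0 < M) {u s : ℕ} (hs : s < M) : parent M (M * (u + 1) + s) = u := by
  unfold parent
  rw [Nat.mul_add_div hM, Nat.div_eq_of_lt hs]
  omega

theorem child_mod {u s : ℕ} (hs : s < M) : (M * (u + 1) + s) % M = s := by
  rw [Nat.mul_add_mod, Nat.mod_eq_of_lt hs]

theorem digits_self (l u : ℕ) : digits M l u l = u % M := by simp [digits]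

theorem digits_succ {l u i : ℕ} (hi : i ≤ l) :
    digits M (l + 1) u i = digits M l (parent M u) i := by
  simp only [digits]
  rw [show l + 1 - i = (l - i) + 1 by omega, Function.iterate_succ_apply]

end Arithmetic

/-- A winning strategy in the game amounts to a labelling of the complete forest with `q` levels:
the label of a node consists of the answers of the second player on the way to this node (and of
irrelevant further entries). -/
theorem exists_labelling_iff {C : Type} {q M : ℕ} (hq : 1 ≤ q) (hM : 0 < M)
    {P : (ℕ → ℕ) → (ℕ → C) → Prop}
    (hP : ∀ S S' X X', (∀ i < q, S i = S' i) → (∀ i < q, X i = X' i) → P S X → P S' X')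
    (S : ℕ → ℕ) (X : ℕ → C) :
    (∃ α : ℕ → ℕ → C,
      -- the hypothesis on `i` says that the parent of `u` is on level `i` or below
      (∀ u < treeSize M q, M ≤ u → ∀ i, treeSize M i ≤ parent M u →
        α u i = α (parent M u) i) ∧
      ∀ u < treeSize M q, treeSize M (q - 1) ≤ u → P (digits M (q - 1) u) (α u)) ↔
    GameWon q M P q S X := by
  have hmono := treeSize_strictMono hM
  constructor
  · rintro ⟨α, hα, hleaf⟩
    -- with `j` rounds left, the label of a node on level `q - 1 - j` is a position that is won
    have key : ∀ j < q, ∀ u, treeSize M (q - 1 - j) ≤ u → u < treeSize M (q - j) →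
        GameWon q M P j (digits M (q - 1 - j) u) (α u) := by
      intro j
      induction j with
      | zero => exact fun _ u h1 h2 => hleaf u h2 h1
      | succ j ih =>
        intro hj u h1 h2 s hs
        obtain ⟨l, hl⟩ : ∃ l, q = l + 1 + j + 1 := ⟨q - 2 - j, by omega⟩
        rw [show q - 1 - (j + 1) = l by omega] at h1 ⊢
        rw [show q - (j + 1) = l + 1 by omega] at h2 ⊢
        have ih' := ih (by omega) (M * (u + 1) + s)
        rw [show q - 1 - j = l + 1 by omega, show q - j = l + 1 + 1 by omega] at ih'
        have hMu : M ≤ M * (u + 1) + s := by nlinarith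
        have hpar := parent_child (u := u) hM hs
        have hlt : M * (u + 1) + s < treeSize M (l + 1 + 1) := by
          by_contra hn
          have := (treeSize_succ_le_iff hM hMu (l + 1)).1 (not_lt.1 hn)
          omega
        have hw := ih' ((treeSize_succ_le_iff hM hMu l).2 (hpar.symm ▸ h1)) hlt
        refine ⟨α (M * (u + 1) + s) (l + 1), GameWon.congr (by omega) hP ?_ ?_ hw⟩
        · intro i hi
          by_cases hil : i = l + 1
          · subst hil
            rw [digits_self, child_mod hs]
            simp
          · rw [Function.update_of_ne hil, digits_succ (by omega), hpar]
        · intro i hi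
          by_cases hil : i = l + 1
          · subst hil
            simp
          · rw [Function.update_of_ne hil]
            have hle : treeSize M i ≤ u := (hmono.monotone (by omega)).trans h1
            rw [hα _ (hlt.trans_le (hmono.monotone (by omega))) hMu i (hpar.symm ▸ hle), hpar]
    obtain ⟨j, rfl⟩ : ∃ j, q = j + 1 := ⟨q - 1, by omega⟩
    intro s hs
    have h0 := key j (by omega) s
    rw [show j + 1 - 1 - j = 0 by omega, show j + 1 - j = 1 by omega, treeSize_one] at h0
    refine ⟨α s 0, GameWon.congr (by omega) hP ?_ ?_ (h0 (Nat.zero_le _) hs)⟩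
    · intro i hi
      obtain rfl : i = 0 := by omega
      rw [digits_self, Nat.mod_eq_of_lt hs]
      simp
    · intro i hi
      obtain rfl : i = 0 := by omega
      simp
  · -- conversely, the labels are constructed level by level, extending that of the parent
    intro hw
    have key : ∀ l < q, ∃ α : ℕ → ℕ → C,
        (∀ u < treeSize M (l + 1), M ≤ u → ∀ i, treeSize M i ≤ parent M u →
          α u i = α (parent M u) i) ∧
        ∀ u < treeSize M (l + 1), treeSize M l ≤ u →
          GameWon q M P (q - (l + 1)) (digits M l u) (α u) := by
      intro l
      induction l with
      | zero =>
        intro _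
        obtain ⟨j, rfl⟩ : ∃ j, q = j + 1 := ⟨q - 1, by omega⟩
        have hw' : ∀ s, ∃ a, s < M → GameWon (j + 1) M P j (Function.update S 0 s)
            (Function.update X 0 a) := by
          intro s
          by_cases hs : s < M
          · obtain ⟨a, ha⟩ := hw s hs
            exact ⟨a, fun _ => by simpa using ha⟩
          · exact ⟨X 0, fun h => absurd h hs⟩
        choose f hf using hw'
        refine ⟨fun u => Function.update X 0 (f u), ?_, ?_⟩
        · intro u hu hMu
          rw [treeSize_one] at hu
          omega
        · intro u hu _
          rw [treeSize_one] at hu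
          refine GameWon.congr (by omega) hP ?_ (fun _ _ => rfl) (hf u hu)
          intro i hi
          obtain rfl : i = 0 := by omega
          rw [digits_self, Nat.mod_eq_of_lt hu]
          simp
      | succ l ih =>
        intro hl
        obtain ⟨α, hα, hlast⟩ := ih (by omega)
        have hnode : ∀ u, u < treeSize M (l + 1 + 1) → treeSize M (l + 1) ≤ u →
            M ≤ u ∧ treeSize M l ≤ parent M u ∧ parent M u < treeSize M (l + 1) := by
          intro u h1 h2
          have hMu : M ≤ u := by
            refine le_trans ?_ h2
            calc M = treeSize M 1 := treeSize_one.symm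
              _ ≤ _ := hmono.monotone (by omega)
          refine ⟨hMu, (treeSize_succ_le_iff hM hMu l).1 h2, ?_⟩
          by_contra hn
          have := (treeSize_succ_le_iff hM hMu (l + 1)).2 (not_lt.1 hn)
          omega
        have hstep : ∀ u, ∃ a, u < treeSize M (l + 1 + 1) → treeSize M (l + 1) ≤ u →
            GameWon q M P (q - (l + 1 + 1))
              (Function.update (digits M l (parent M u)) (l + 1) (u % M))
              (Function.update (α (parent M u)) (l + 1) a) := by
          intro u
          by_cases hu : u < treeSize M (l + 1 + 1) ∧ treeSize M (l + 1) ≤ u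
          · obtain ⟨-, h1, h2⟩ := hnode u hu.1 hu.2
            have hw' := hlast _ h2 h1
            rw [show q - (l + 1) = (q - (l + 1 + 1)) + 1 by omega] at hw'
            obtain ⟨a, ha⟩ := hw' (u % M) (Nat.mod_lt _ hM)
            rw [show q - (q - (l + 1 + 1) + 1) = l + 1 by omega] at ha
            exact ⟨a, fun _ _ => ha⟩
          · exact ⟨X 0, fun h1 h2 => absurd ⟨h1, h2⟩ hu⟩
        choose f hf using hstep
        refine ⟨fun u => if u < treeSize M (l + 1) then α u else
          Function.update (α (parent M u)) (l + 1) (f u), ?_, ?_⟩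
        · intro u hu hMu i hi
          have hpu := parent_lt hM hMu
          by_cases hul : u < treeSize M (l + 1)
          · simp only [hul, hpu.trans hul, if_true]
            exact hα u hul hMu i hi
          · obtain ⟨-, h1, h2⟩ := hnode u hu (not_lt.1 hul)
            simp only [hul, h2, if_true, if_false]
            have hil : i < l + 1 := hmono.lt_iff_lt.1 (hi.trans_lt h2)
            rw [Function.update_of_ne (by omega)]
        · intro u hu hul
          obtain ⟨hMu, h1, h2⟩ := hnode u hu hul
          simp only [not_lt.2 hul, if_false]
          refine GameWon.congr (by omega) hP ?_ (fun _ _ => rfl) (hf u hu hul)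
          intro i hi
          by_cases hil : i = l + 1
          · subst hil
            rw [digits_self]
            simp
          · rw [Function.update_of_ne hil, digits_succ (by omega)]
    obtain ⟨α, hα, hlast⟩ := key (q - 1) (by omega)
    rw [show q - 1 + 1 = q by omega] at hα hlast
    rw [Nat.sub_self] at hlast
    exact ⟨α, hα, hlast⟩

/-- The complete forest with branching number `M`, restricted to the first `n + 1` nodes. -/
def completeForest (M n : ℕ) : SimpleGraph (Fin (n + 1)) where
  Adj u v := u ≠ v ∧ ((M ≤ u ∧ (v : ℕ) = parent M u) ∨ (M ≤ v ∧ (u : ℕ) = parent M v))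
  symm := ⟨fun _ _ h => ⟨h.1.symm, h.2.symm⟩⟩
  loopless := ⟨fun _ h => h.1 rfl⟩

/-- A graph on a linear order is acyclic if no vertex has two smaller neighbours: consider the
largest vertex of a cycle. -/
theorem isAcyclic_of_smaller_unique {V : Type} [LinearOrder V] {G : SimpleGraph V}
    (h : ∀ u v w, G.Adj u v → G.Adj u w → v < u → w < u → v = w) : G.IsAcyclic := by
  intro x c hc
  obtain ⟨u, hu, hmax⟩ := c.support.toFinset.exists_max_image id
    ⟨x, List.mem_toFinset.2 c.start_mem_support⟩
  rw [List.mem_toFinset] at hu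
  have hmax' : ∀ v ∈ c.support, v ≤ u := fun v hv => hmax v (List.mem_toFinset.2 hv)
  have hc' := hc.rotate hu
  have hmem : ∀ v ∈ (c.rotate u hu).support, v ≤ u := by
    intro v hv
    refine hmax' v ?_
    rcases (SimpleGraph.Walk.mem_support_iff _).1 hv with rfl | hv
    · exact hu
    · exact List.mem_of_mem_tail
        ((SimpleGraph.Walk.support_rotate c u hu).mem_iff.1 hv)
  have h1 := SimpleGraph.Walk.adj_snd hc'.not_nil
  have h2 := (SimpleGraph.Walk.adj_penultimate hc'.not_nil).symm
  refine hc'.snd_ne_penultimate (h _ _ _ h1 h2 ?_ ?_)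
  · exact lt_of_le_of_ne (hmem _ (SimpleGraph.Walk.getVert_mem_support _ _)) h1.ne'
  · exact lt_of_le_of_ne (hmem _ (SimpleGraph.Walk.getVert_mem_support _ _)) h2.ne'

theorem completeForest_isForest {M n q : ℕ} (hM : 0 < M) (hn : n + 1 = treeSize M q) :
    IsForestOfHeightLE (completeForest M n) (q - 1) := by
  have hdir : ∀ u v : Fin (n + 1), (completeForest M n).Adj u v → v < u →
      M ≤ u ∧ (v : ℕ) = parent M u := by
    rintro u v ⟨hne, h | ⟨hMv, h⟩⟩ hlt
    · exact h
    · have := parent_lt hM hMv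
      rw [Fin.lt_def] at hlt
      omega
  refine ⟨isAcyclic_of_smaller_unique fun u v w hv hw hvu hwu =>
    Fin.ext ((hdir u v hv hvu).2.trans (hdir u w hw hwu).2.symm), fun C => ?_⟩
  obtain ⟨x, hx⟩ := C.nonempty_supp
  obtain ⟨r, hrC, hmin⟩ := (Set.toFinite C.supp).exists_minimalFor id _ ⟨x, hx⟩
  have hroot : (r : ℕ) < M := by
    by_contra hge
    rw [not_lt] at hge
    have hlt := parent_lt hM hge
    let p : Fin (n + 1) := ⟨parent M r, hlt.trans r.2⟩
    have hadj : (completeForest M n).Adj r p :=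
      ⟨fun h => hlt.ne' (congrArg Fin.val h), Or.inl ⟨hge, rfl⟩⟩
    have hpC : p ∈ C.supp :=
      (SimpleGraph.ConnectedComponent.mem_supp_congr_adj C hadj).1 hrC
    have := hmin hpC (by simpa [Fin.le_def, p] using hlt.le)
    simp only [id, Fin.le_def, p] at this
    omega
  refine ⟨r, hrC, ?_⟩
  -- along a path from the root, every step leads to a child
  have key : ∀ (k : ℕ) (u : Fin (n + 1)) (p : (completeForest M n).Walk r u), p.IsPath →
      p.length = k → treeSize M k ≤ u ∧
        (0 < k → M ≤ u ∧ (p.penultimate : ℕ) = parent M u) := by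
    intro k
    induction k with
    | zero => exact fun u p _ _ => ⟨Nat.zero_le _, fun h => absurd h (lt_irrefl _)⟩
    | succ k ih =>
      intro u p hp hk
      have hnil : ¬ p.Nil := by
        rw [← SimpleGraph.Walk.length_eq_zero_iff]
        omega
      have hlen : p.dropLast.length = k := by
        rw [SimpleGraph.Walk.length_dropLast]
        omega
      obtain ⟨h1, h2⟩ := ih _ p.dropLast hp.dropLast hlen
      have hadj := p.adj_penultimate hnil
      obtain ⟨hMu, hpar⟩ : M ≤ (u : ℕ) ∧ (p.penultimate : ℕ) = parent M u := by
        obtain ⟨hne, ⟨hMp, hu⟩ | h⟩ := hadj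
        · exfalso
          rcases Nat.eq_zero_or_pos k with rfl | hk0
          · have := SimpleGraph.Walk.eq_of_length_eq_zero hlen
            rw [← this] at hMp
            omega
          · have hpen := (h2 hk0).2
            have hu' : u = p.dropLast.penultimate := Fin.ext (hu.trans hpen.symm)
            have hmem : p.dropLast.penultimate ∈ p.dropLast.support :=
              SimpleGraph.Walk.getVert_mem_support _ _
            rw [← hu'] at hmem
            have hp' := hp
            rw [← p.concat_dropLast (p.adj_penultimate hnil),
              SimpleGraph.Walk.concat_isPath_iff] at hp'
            exact hp'.2 hmem
        · exact h
      refine ⟨(treeSize_succ_le_iff hM hMu k).2 (hpar ▸ h1), fun _ => ⟨hMu, hpar⟩⟩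
  intro u p hp
  have h1 := (key _ u p hp rfl).1
  have h2 : treeSize M p.length < treeSize M q := by
    have := u.2
    omega
  have := (treeSize_strictMono hM).lt_iff_lt.1 h2
  omega

/-! ### Coloured homomorphisms from forests and primitive positive sentences -/

/-- The edge relation of a structure, as a binary relation. -/
def Str.Edge (B : Str Sym) (a b : B.carrier) : Prop :=
  B.rel edgeSym (fun i => if i.val = 0 then a else b)

/-- The relation `C_i` of a structure, as a unary relation. -/
def Str.Color (B : Str Sym) (i : ℕ) (a : B.carrier) : Prop :=
  B.rel (colorSym i) (fun _ => a)

/-- Homomorphisms from `F*` to `B`, where `B` may have any vocabulary. -/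
def ColorHom {n : ℕ} (F : SimpleGraph (Fin (n + 1))) (B : Str Sym) : Prop :=
  ∃ h : Fin (n + 1) → B.carrier, (∀ i : Fin (n + 1), B.Color i (h i)) ∧
    ∀ i j, F.Adj i j → B.Edge (h i) (h j)

/-- The vocabulary of the structures `F*`, `F` a graph on `{0, …, n}`. -/
def starVoc (n : ℕ) : Finset Sym := insert edgeSym ((Finset.range (n + 1)).image colorSym)

theorem homTo_starGraph_iff {n : ℕ} (F : SimpleGraph (Fin (n + 1))) (B : Str Sym) :
    HomTo (starGraph F) B ↔ starVoc n = B.voc ∧ ColorHom F B := by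
  constructor
  · rintro ⟨h, hv, hr⟩
    refine ⟨hv, h, fun i => ?_, fun i j hij => ?_⟩
    · exact hr (colorSym i) (fun _ => i) (Or.inr ⟨i, rfl, rfl⟩)
    · have := hr edgeSym (fun k => if k.val = 0 then i else j) (Or.inl ⟨i, j, hij, rfl, rfl⟩)
      exact Eq.mp (congrArg (B.rel edgeSym) (funext fun k => apply_ite h _ _ _)) this
  · rintro ⟨hv, h, hc, he⟩
    refine ⟨h, hv, ?_⟩
    rintro R x (⟨i, j, hij, rfl, hx⟩ | ⟨i, rfl, hx⟩)
    · have h0 : x = fun k => if k.val = 0 then i else j := by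
        refine List.ofFn_injective (hx.trans ?_)
        rfl
      subst h0
      exact Eq.mpr (congrArg (B.rel edgeSym) (funext fun k => apply_ite h _ _ _)) (he i j hij)
    · have h0 : x = fun _ => i := by
        refine List.ofFn_injective (hx.trans ?_)
        rfl
      subst h0
      exact hc i

theorem forall_lt_iff_fin {m : ℕ} {p : ℕ → Prop} : (∀ a < m, p a) ↔ ∀ i : Fin m, p i :=
  ⟨fun h i => h i i.2, fun h a ha => h ⟨a, ha⟩⟩

namespace Formula

section Conj

variable {S : Type} [Arity S]

/-- The conjunction of `φ` and the formulas in a list. -/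
def conj (φ : Formula S) (l : List (Formula S)) : Formula S := l.foldr and φ

theorem sat_conj {A : Str S} {v : ℕ → A.carrier} {φ : Formula S} {l : List (Formula S)} :
    Sat A v (conj φ l) ↔ Sat A v φ ∧ ∀ ψ ∈ l, Sat A v ψ := by
  induction l with
  | nil => simp [conj]
  | cons ψ l ih =>
    show Sat A v ψ ∧ Sat A v (conj φ l) ↔ _
    rw [ih]
    simp only [List.mem_cons, forall_eq_or_imp]
    tauto

theorem mem_freeVars_conj {φ : Formula S} {l : List (Formula S)} {x : ℕ} :
    x ∈ (conj φ l).freeVars ↔ x ∈ φ.freeVars ∨ ∃ ψ ∈ l, x ∈ ψ.freeVars := by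
  induction l with
  | nil => simp [conj]
  | cons ψ l ih =>
    show x ∈ ψ.freeVars ∪ (conj φ l).freeVars ↔ _
    rw [Finset.mem_union, ih]
    simp only [List.mem_cons, exists_eq_or_imp]
    tauto

theorem mem_voc_conj [DecidableEq S] {φ : Formula S} {l : List (Formula S)} {R : S} :
    R ∈ (conj φ l).voc ↔ R ∈ φ.voc ∨ ∃ ψ ∈ l, R ∈ ψ.voc := by
  induction l with
  | nil => simp [conj]
  | cons ψ l ih =>
    show R ∈ ψ.voc ∪ (conj φ l).voc ↔ _
    rw [Finset.mem_union, ih]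
    simp only [List.mem_cons, exists_eq_or_imp]
    tauto

theorem qr_conj_le_iff {φ : Formula S} {l : List (Formula S)} {k : ℕ} :
    (conj φ l).qr ≤ k ↔ φ.qr ≤ k ∧ ∀ ψ ∈ l, ψ.qr ≤ k := by
  induction l with
  | nil => simp [conj]
  | cons ψ l ih =>
    show max ψ.qr (conj φ l).qr ≤ k ↔ _
    rw [max_le_iff, ih]
    simp only [List.mem_cons, forall_eq_or_imp]
    tauto

theorem isPrimitivePositive_conj {φ : Formula S} {l : List (Formula S)} :
    (conj φ l).IsPrimitivePositive ↔
      φ.IsPrimitivePositive ∧ ∀ ψ ∈ l, ψ.IsPrimitivePositive := by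
  induction l with
  | nil => simp [conj]
  | cons ψ l ih =>
    show ψ.IsPrimitivePositive ∧ (conj φ l).IsPrimitivePositive ↔ _
    rw [ih]
    simp only [List.mem_cons, forall_eq_or_imp]
    tauto

theorem isQuantifierFree_conj {φ : Formula S} {l : List (Formula S)} :
    (conj φ l).IsQuantifierFree ↔ φ.IsQuantifierFree ∧ ∀ ψ ∈ l, ψ.IsQuantifierFree := by
  induction l with
  | nil => simp [conj]
  | cons ψ l ih =>
    show ψ.IsQuantifierFree ∧ (conj φ l).IsQuantifierFree ↔ _
    rw [ih]
    simp only [List.mem_cons, forall_eq_or_imp]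
    tauto

theorem code_conj [Encodable S] (φ : Formula S) (l : List (Formula S)) :
    (conj φ l).code = (l.map code).foldr (fun m n => Nat.pair 3 (Nat.pair m n)) φ.code := by
  induction l with
  | nil => rfl
  | cons ψ l ih =>
    show Nat.pair 3 (Nat.pair ψ.code (conj φ l).code) = _
    rw [ih]
    rfl

end Conj

/-- The atom `E x y`. -/
def edgeAtom (x y : ℕ) : Formula Sym := rel edgeSym (fun i => if i.val = 0 then x else y)

/-- The atom `C_i x`. -/
def colorAtom (i x : ℕ) : Formula Sym := rel (colorSym i) (fun _ => x)

theorem sat_edgeAtom {B : Str Sym} {v : ℕ → B.carrier} {x y : ℕ} :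
    Sat B v (edgeAtom x y) ↔ B.Edge (v x) (v y) := by
  simp only [edgeAtom, Sat, Str.Edge, apply_ite v]

theorem freeVars_edgeAtom (x y : ℕ) : (edgeAtom x y).freeVars ⊆ {x, y} := by
  intro z hz
  obtain ⟨i, -, rfl⟩ := Finset.mem_image.1 hz
  split_ifs <;> simp

theorem mem_freeVars_colorAtom {i x y : ℕ} (h : y ∈ (colorAtom i x).freeVars) : y = x := by
  obtain ⟨i, -, rfl⟩ := Finset.mem_image.1 h
  rfl

/-- The part of the sentence describing a forest that talks about walks with `j` steps from the
vertex `i`; the variable `x_j` stands for the image of `i`. All vertices are considered in each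
step, and the ones that are not adjacent to the previous one are subject to no edge condition. -/
def walkFormula (n : ℕ) (E : List (ℕ × ℕ)) : ℕ → ℕ → Formula Sym
  | 0, i => colorAtom i 0
  | j + 1, i => conj (colorAtom i (j + 1)) ((List.range (n + 1)).map fun i' =>
      ex j (and (if (i, i') ∈ E then and (edgeAtom (j + 1) j) (edgeAtom j (j + 1)) else eq j j)
        (walkFormula n E j i')))

/-- A sentence of quantifier rank `q` describing the existence of a homomorphism from `F*`, where
`F` is the graph with edges `E` on `{0, …, n}`. The first conjunct makes sure that the edge symbol
occurs even if there are no edges. -/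
def forestFormula (q n : ℕ) (E : List (ℕ × ℕ)) : Formula Sym :=
  conj (ex 0 (edgeAtom 0 0)) ((List.range (n + 1)).map fun i =>
    ex (q - 1) (walkFormula n E (q - 1) i))

section Shape

variable {n : ℕ} {E : List (ℕ × ℕ)}

theorem walkFormula_isPrimitivePositive (j : ℕ) :
    ∀ i, (walkFormula n E j i).IsPrimitivePositive := by
  induction j with
  | zero => exact fun i => trivial
  | succ j ih =>
    intro i
    refine isPrimitivePositive_conj.2 ⟨trivial, ?_⟩
    simp only [List.mem_map, forall_exists_index, and_imp, forall_apply_eq_imp_iff₂]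
    intro i' _
    refine ⟨?_, ih i'⟩
    split_ifs
    exacts [⟨trivial, trivial⟩, trivial]

theorem walkFormula_qr (j : ℕ) : ∀ i, (walkFormula n E j i).qr ≤ j := by
  induction j with
  | zero => exact fun i => le_rfl
  | succ j ih =>
    intro i
    refine qr_conj_le_iff.2 ⟨Nat.zero_le _, ?_⟩
    simp only [List.mem_map, forall_exists_index, and_imp, forall_apply_eq_imp_iff₂]
    intro i' _
    have h := ih i'
    split_ifs <;> simp only [qr, edgeAtom] <;> omega

theorem walkFormula_freeVars (j : ℕ) :
    ∀ i, ∀ x ∈ (walkFormula n E j i).freeVars, x = j := by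
  induction j with
  | zero => exact fun i x hx => mem_freeVars_colorAtom hx
  | succ j ih =>
    intro i x hx
    rcases mem_freeVars_conj.1 hx with hx | ⟨ψ, hψ, hx⟩
    · exact mem_freeVars_colorAtom hx
    · obtain ⟨i', -, rfl⟩ := List.mem_map.1 hψ
      obtain ⟨hne, hx⟩ := Finset.mem_erase.1 hx
      rcases Finset.mem_union.1 hx with hx | hx
      · split_ifs at hx
        · rcases Finset.mem_union.1 hx with hx | hx <;>
          · have := freeVars_edgeAtom _ _ hx
            simp only [Finset.mem_insert, Finset.mem_singleton] at this
            tauto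
        · simp [freeVars] at hx
          exact absurd hx hne
      · exact absurd (ih i' x hx) hne

theorem walkFormula_voc (j : ℕ) :
    ∀ i ≤ n, (walkFormula n E j i).voc ⊆ starVoc n := by
  have hcol : ∀ i ≤ n, colorSym i ∈ starVoc n := fun i hi =>
    Finset.mem_insert_of_mem (Finset.mem_image_of_mem _ (Finset.mem_range.2 (by omega)))
  induction j with
  | zero =>
    intro i hi R hR
    rw [Finset.mem_singleton.1 hR]
    exact hcol i hi
  | succ j ih =>
    intro i hi R hR
    rcases mem_voc_conj.1 hR with hR | ⟨ψ, hψ, hR⟩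
    · rw [Finset.mem_singleton.1 hR]
      exact hcol i hi
    · obtain ⟨i', hi', rfl⟩ := List.mem_map.1 hψ
      have hi'' : i' ≤ n := by
        have := List.mem_range.1 hi'
        omega
      rcases Finset.mem_union.1 hR with hR | hR
      · split_ifs at hR
        · rcases Finset.mem_union.1 hR with hR | hR <;>
          · rw [Finset.mem_singleton.1 hR]
            exact Finset.mem_insert_self _ _
        · exact absurd hR (Finset.notMem_empty _)
      · exact ih i' hi'' hR

theorem colorSym_mem_walkFormula_voc (j i : ℕ) : colorSym i ∈ (walkFormula n E j i).voc := by
  cases j with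
  | zero => exact Finset.mem_singleton_self _
  | succ j => exact mem_voc_conj.2 (Or.inl (Finset.mem_singleton_self _))

theorem forestFormula_voc (q : ℕ) : (forestFormula q n E).voc = starVoc n := by
  refine Finset.Subset.antisymm (fun R hR => ?_) (fun R hR => ?_)
  · rcases mem_voc_conj.1 hR with hR | ⟨ψ, hψ, hR⟩
    · rw [Finset.mem_singleton.1 hR]
      exact Finset.mem_insert_self _ _
    · obtain ⟨i, hi, rfl⟩ := List.mem_map.1 hψ
      have := List.mem_range.1 hi
      exact walkFormula_voc _ i (by omega) hR
  · rcases Finset.mem_insert.1 hR with rfl | hR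
    · exact mem_voc_conj.2 (Or.inl (Finset.mem_singleton_self _))
    · obtain ⟨i, hi, rfl⟩ := Finset.mem_image.1 hR
      refine mem_voc_conj.2 (Or.inr ⟨_, List.mem_map.2 ⟨i, ?_, rfl⟩,
        colorSym_mem_walkFormula_voc _ _⟩)
      exact List.mem_range.2 (Finset.mem_range.1 hi)

theorem forestFormula_mem {q : ℕ} (hq : 1 ≤ q) :
    forestFormula q n E ∈ primitivePositiveSentences q 2 := by
  refine ⟨?_, ?_, ?_, ?_⟩
  · refine Finset.eq_empty_iff_forall_notMem.2 fun x hx => ?_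
    rcases mem_freeVars_conj.1 hx with hx | ⟨ψ, hψ, hx⟩
    · obtain ⟨hne, hx⟩ := Finset.mem_erase.1 hx
      have := freeVars_edgeAtom _ _ hx
      simp only [Finset.mem_insert, Finset.mem_singleton] at this
      tauto
    · obtain ⟨i', -, rfl⟩ := List.mem_map.1 hψ
      obtain ⟨hne, hx⟩ := Finset.mem_erase.1 hx
      exact hne (walkFormula_freeVars _ _ _ hx)
  · refine isPrimitivePositive_conj.2 ⟨trivial, ?_⟩
    simp only [List.mem_map, forall_exists_index, and_imp, forall_apply_eq_imp_iff₂]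
    exact fun i _ => walkFormula_isPrimitivePositive _ i
  · refine qr_conj_le_iff.2 ⟨?_, ?_⟩
    · simpa [qr, edgeAtom] using hq
    · simp only [List.mem_map, forall_exists_index, and_imp, forall_apply_eq_imp_iff₂]
      intro i _
      have := walkFormula_qr (n := n) (E := E) (q - 1) i
      simp only [qr]
      omega
  · intro R hR
    rw [forestFormula_voc] at hR
    rcases Finset.mem_insert.1 hR with rfl | hR
    · exact le_rfl
    · obtain ⟨i, -, rfl⟩ := Finset.mem_image.1 hR
      exact one_le_two

end Shape

/-- The meaning of `walkFormula`. -/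
def WalkSat {n : ℕ} (F : SimpleGraph (Fin (n + 1))) (B : Str Sym) :
    ℕ → Fin (n + 1) → B.carrier → Prop
  | 0, i, b => B.Color i b
  | j + 1, i, b => B.Color i b ∧ ∀ i', ∃ b',
      (F.Adj i i' → B.Edge b b' ∧ B.Edge b' b) ∧ WalkSat F B j i' b'

section Semantics

variable {n : ℕ} {F : SimpleGraph (Fin (n + 1))} {B : Str Sym} {E : List (ℕ × ℕ)}

theorem sat_walkFormula (hE : ∀ i j : Fin (n + 1), ((i : ℕ), (j : ℕ)) ∈ E ↔ F.Adj i j) (j : ℕ) :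
    ∀ (i : Fin (n + 1)) (v : ℕ → B.carrier),
      Sat B v (walkFormula n E j i) ↔ WalkSat F B j i (v j) := by
  induction j with
  | zero => exact fun i v => Iff.rfl
  | succ j ih =>
    intro i v
    rw [walkFormula, sat_conj]
    refine and_congr Iff.rfl ?_
    simp only [List.mem_map, List.mem_range, forall_exists_index, and_imp,
      forall_apply_eq_imp_iff₂]
    refine forall_lt_iff_fin.trans (forall_congr' fun i' => ?_)
    refine exists_congr fun b => and_congr ?_ ((ih i' _).trans (by simp))
    by_cases h : F.Adj i i'
    · rw [if_pos ((hE i i').2 h)]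
      simp only [Sat, sat_edgeAtom, h, forall_true_left]
      simp
    · rw [if_neg (fun h' => h ((hE i i').1 h'))]
      simp [Sat, h]

theorem WalkSat.color {j : ℕ} {i : Fin (n + 1)} {b : B.carrier} (h : WalkSat F B j i b) :
    B.Color i b := by
  cases j with
  | zero => exact h
  | succ j => exact h.1

theorem walkSat_of_hom {h : Fin (n + 1) → B.carrier} (hc : ∀ i : Fin (n + 1), B.Color i (h i))
    (he : ∀ i j, F.Adj i j → B.Edge (h i) (h j)) (j : ℕ) : ∀ i, WalkSat F B j i (h i) := by
  induction j with
  | zero => exact hc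
  | succ j ih => exact fun i => ⟨hc i, fun i' => ⟨h i', fun ha => ⟨he _ _ ha, he _ _ ha.symm⟩,
      ih i'⟩⟩

/-- The element reached from `b` along a walk, if each step is made by means of `f`, and there are
`j` steps at most. -/
def walkValue (f : ℕ → Fin (n + 1) → B.carrier → Fin (n + 1) → B.carrier) :
    ∀ {u v : Fin (n + 1)}, F.Walk u v → ℕ → B.carrier → B.carrier
  | _, _, .nil, _, b => b
  | u, _, .cons (v := w) _ p, j, b => walkValue f p (j - 1) (f (j - 1) u b w)

theorem walkValue_concat (f : ℕ → Fin (n + 1) → B.carrier → Fin (n + 1) → B.carrier)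
    {u v w : Fin (n + 1)} (p : F.Walk u v) (h : F.Adj v w) : ∀ (j : ℕ) (b : B.carrier),
    walkValue f (p.concat h) j b = f (j - p.length - 1) v (walkValue f p j b) w := by
  induction p with
  | nil => exact fun j b => rfl
  | cons h' p ih =>
    intro j b
    rw [SimpleGraph.Walk.concat_cons, walkValue, ih, walkValue, SimpleGraph.Walk.length_cons]
    congr 1
    omega

/-- In a forest of height at most `d`, the vertices are mapped by following the paths that start
at the roots. -/
theorem colorHom_of_walkSat {d : ℕ} (hF : IsForestOfHeightLE F d)
    (h : ∀ i, ∃ b, WalkSat F B d i b) : ColorHom F B := by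
  have hstep : ∀ j u b w, ∃ b', WalkSat F B (j + 1) u b →
      (F.Adj u w → B.Edge b b' ∧ B.Edge b' b) ∧ WalkSat F B j w b' := by
    intro j u b w
    by_cases hb : WalkSat F B (j + 1) u b
    · obtain ⟨b', hb'⟩ := hb.2 w
      exact ⟨b', fun _ => hb'⟩
    · exact ⟨b, fun hb' => absurd hb' hb⟩
  choose f hf using hstep
  choose g hg using h
  choose root hroot hheight using hF.2
  have hpath : ∀ v, ∃ p : F.Walk (root (F.connectedComponentMk v)) v, p.IsPath := fun v =>
    (SimpleGraph.ConnectedComponent.exact (hroot (F.connectedComponentMk v))).exists_isPath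
  choose P hP using hpath
  -- every step uses up one of the `d` steps allowed, so the bound on the height is what is needed
  have hval : ∀ {u v : Fin (n + 1)} (p : F.Walk u v) (j : ℕ) (b : B.carrier), p.length ≤ j →
      WalkSat F B j u b → WalkSat F B (j - p.length) v (walkValue f p j b) := by
    intro u v p
    induction p with
    | nil => exact fun j b _ hb => hb
    | cons h' p ih =>
      intro j b hj hb
      rw [SimpleGraph.Walk.length_cons] at hj ⊢
      obtain ⟨j, rfl⟩ : ∃ i, j = i + 1 := ⟨j - 1, by omega⟩
      have := ih j _ (by omega) (hf j _ _ _ hb).2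
      rw [walkValue, show j + 1 - (p.length + 1) = j - p.length by omega]
      exact this
  have hsat : ∀ v, WalkSat F B (d - (P v).length) v
      (walkValue f (P v) d (g (root (F.connectedComponentMk v)))) := fun v =>
    hval _ d _ (hheight _ _ _ (hP v)) (hg _)
  -- one of the two vertices of an edge comes directly before the other one on the path to it
  have hedge : ∀ (r u v : Fin (n + 1)) (p : F.Walk r u) (p' : F.Walk r v), p.IsPath →
      p'.IsPath → (∀ w (s : F.Walk r w), s.IsPath → s.length ≤ d) → F.Adj u v →
      u ∈ p'.support → ∀ b, WalkSat F B d r b →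
      B.Edge (walkValue f p d b) (walkValue f p' d b) ∧
        B.Edge (walkValue f p' d b) (walkValue f p d b) := by
    intro r u v p p' hp hp' hd hadj hmem b hb
    have hcat := hF.1.path_concat hp hp' hadj hmem
    have hlen := hd _ p' hp'
    rw [hcat, SimpleGraph.Walk.length_concat] at hlen
    rw [hcat, walkValue_concat]
    have h1 := hval p d b (by omega) hb
    rw [show d - p.length = (d - p.length - 1) + 1 by omega] at h1
    exact (hf _ _ _ v h1).1 hadj
  have huniq : ∀ (v r : Fin (n + 1)) (p : F.Walk r v), p.IsPath →
      r = root (F.connectedComponentMk v) →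
      walkValue f (P v) d (g (root (F.connectedComponentMk v))) = walkValue f p d (g r) := by
    rintro v r p hp rfl
    have : P v = p := congrArg Subtype.val ((hF.1.subsingleton_path _ _).elim ⟨P v, hP v⟩ ⟨p, hp⟩)
    rw [this]
  refine ⟨_, fun v => (hsat v).color, fun u v hadj => ?_⟩
  have hcomp : F.connectedComponentMk v = F.connectedComponentMk u :=
    SimpleGraph.ConnectedComponent.sound hadj.symm.reachable
  obtain ⟨p, hp⟩ : ∃ p : F.Walk (root (F.connectedComponentMk u)) v, p.IsPath :=
    hcomp ▸ ⟨P v, hP v⟩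
  have hd := hheight (F.connectedComponentMk u)
  rw [huniq v _ p hp (by rw [hcomp])]
  by_cases hmem : u ∈ p.support
  · exact (hedge _ u v (P u) p (hP u) hp hd hadj hmem _ (hg _)).1
  · have hmem' := hF.1.mem_support_of_ne_mem_support_of_adj_of_isPath (hP u) hp hadj hmem
    exact (hedge _ v u p (P u) hp (hP u) hd hadj.symm hmem' _ (hg _)).2

/-- A forest has a coloured homomorphism to `B` iff `B` satisfies the sentence describing it. -/
theorem holds_forestFormula_iff {q : ℕ} (hF : IsForestOfHeightLE F (q - 1))
    (hE : ∀ i j : Fin (n + 1), ((i : ℕ), (j : ℕ)) ∈ E ↔ F.Adj i j)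
    (hloop : ∃ b, B.Edge b b) : Holds B (forestFormula q n E) ↔ ColorHom F B := by
  have hsat : ∀ v : ℕ → B.carrier, Sat B v (forestFormula q n E) ↔
      ∀ i, ∃ b, WalkSat F B (q - 1) i b := by
    intro v
    rw [forestFormula, sat_conj]
    have h0 : Sat B v (ex 0 (edgeAtom 0 0)) := by
      obtain ⟨b, hb⟩ := hloop
      refine ⟨b, sat_edgeAtom.2 ?_⟩
      simpa using hb
    simp only [h0, true_and, List.mem_map, List.mem_range, forall_exists_index, and_imp,
      forall_apply_eq_imp_iff₂]
    refine forall_lt_iff_fin.trans (forall_congr' fun i => exists_congr fun b => ?_)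
    rw [sat_walkFormula hE]
    simp
  constructor
  · intro h
    obtain ⟨b⟩ := B.nonempty
    exact colorHom_of_walkSat hF ((hsat fun _ => b).1 (h _))
  · rintro ⟨h, hc, he⟩ v
    exact (hsat v).2 fun i => ⟨h i, walkSat_of_hom hc he _ i⟩

end Semantics

end Formula

/-! ### Computability of the sentences describing forests -/

namespace Formula

section Computability

variable {α β : Type*} [Primcodable α] [Primcodable β]

theorem primrec_code_and {S : Type} [Arity S] [Encodable S] {φ ψ : α → Formula S}
    (hφ : Primrec fun a => (φ a).code) (hψ : Primrec fun a => (ψ a).code) :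
    Primrec fun a => (and (φ a) (ψ a)).code :=
  Primrec₂.natPair.comp (Primrec.const 3) (Primrec₂.natPair.comp hφ hψ)

theorem primrec_code_conj {S : Type} [Arity S] [Encodable S] {φ : α → Formula S}
    {l : α → List β} {ψ : α → β → Formula S} (hφ : Primrec fun a => (φ a).code)
    (hl : Primrec l) (hψ : Primrec₂ fun a b => (ψ a b).code) :
    Primrec fun a => (conj (φ a) ((l a).map (ψ a))).code := by
  refine (Primrec.list_foldr (h := fun (_ : α) (x : ℕ × ℕ) => Nat.pair 3 (Nat.pair x.1 x.2))
    (Primrec.list_map hl hψ) hφ ?_).of_eq fun a => ?_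
  · exact Primrec₂.natPair.comp (Primrec.const 3)
      (Primrec₂.natPair.comp (Primrec.fst.comp Primrec.snd) (Primrec.snd.comp Primrec.snd))
  · rw [code_conj, List.map_map]
    rfl

theorem primrec_colorSym : Primrec colorSym := Primrec.id.pair (Primrec.const 1)

theorem primrec_code_colorAtom {i x : α → ℕ} (hi : Primrec i) (hx : Primrec x) :
    Primrec fun a => (colorAtom (i a) (x a)).code := by
  have : Primrec fun a => Nat.pair 0 (Nat.pair (Encodable.encode (colorSym (i a)))
      (Encodable.encode [x a])) :=
    Primrec₂.natPair.comp (Primrec.const 0) (Primrec₂.natPair.comp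
      (Primrec.encode.comp (primrec_colorSym.comp hi))
      (Primrec.encode.comp (Primrec.list_cons.comp hx (Primrec.const []))))
  exact this

theorem primrec_code_ex {x : α → ℕ} {φ : α → Formula Sym} (hx : Primrec x)
    (hφ : Primrec fun a => (φ a).code) : Primrec fun a => (ex (x a) (φ a)).code :=
  Primrec₂.natPair.comp (Primrec.const 5) (Primrec₂.natPair.comp hx hφ)

theorem primrec_code_walkFormula (j : ℕ) :
    Primrec fun p : (ℕ × List (ℕ × ℕ)) × ℕ => (walkFormula p.1.1 p.1.2 j p.2).code := by
  induction j with
  | zero => exact primrec_code_colorAtom Primrec.snd (Primrec.const 0)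
  | succ j ih =>
    refine primrec_code_conj (l := fun p : (ℕ × List (ℕ × ℕ)) × ℕ => List.range (p.1.1 + 1))
      (ψ := fun p i' => ex j (and (if (p.2, i') ∈ p.1.2 then
        and (edgeAtom (j + 1) j) (edgeAtom j (j + 1)) else eq j j)
        (walkFormula p.1.1 p.1.2 j i')))
      (primrec_code_colorAtom Primrec.snd (Primrec.const (j + 1)))
      (Primrec.list_range.comp (Primrec.succ.comp (Primrec.fst.comp Primrec.fst))) ?_
    refine primrec_code_ex (Primrec.const j) (primrec_code_and ?_ ?_)
    · refine (Primrec.ite (c := fun x : ((ℕ × List (ℕ × ℕ)) × ℕ) × ℕ => (x.1.2, x.2) ∈ x.1.1.2)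
        (primrecPred_mem.comp (((Primrec.snd.comp Primrec.fst).pair Primrec.snd).pair
          (Primrec.snd.comp (Primrec.fst.comp Primrec.fst))))
        (Primrec.const (and (edgeAtom (j + 1) j) (edgeAtom j (j + 1))).code)
        (Primrec.const (eq (S := Sym) j j).code)).of_eq fun x => ?_
      split_ifs <;> rfl
    · exact ih.comp ((Primrec.fst.comp Primrec.fst).pair Primrec.snd)

theorem primrec_code_forestFormula (q : ℕ) :
    Primrec fun p : ℕ × List (ℕ × ℕ) => (forestFormula q p.1 p.2).code := by
  refine primrec_code_conj (l := fun p : ℕ × List (ℕ × ℕ) => List.range (p.1 + 1))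
    (ψ := fun p i => ex (q - 1) (walkFormula p.1 p.2 (q - 1) i))
    (Primrec.const _) (Primrec.list_range.comp (Primrec.succ.comp Primrec.fst)) ?_
  exact primrec_code_ex (Primrec.const _) (primrec_code_walkFormula (q - 1))

end Computability

theorem color_of_sat_walkFormula {n : ℕ} {E : List (ℕ × ℕ)} {B : Str Sym} {v : ℕ → B.carrier}
    {j i : ℕ} (h : Sat B v (walkFormula n E j i)) : B.Color i (v j) := by
  cases j with
  | zero => exact h
  | succ j => exact (sat_conj.1 h).1

theorem exists_color_of_holds_forestFormula {q n : ℕ} {E : List (ℕ × ℕ)} {B : Str Sym}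
    (h : Holds B (forestFormula q n E)) : ∃ b, B.Color 0 b := by
  obtain ⟨b⟩ := B.nonempty
  obtain ⟨b', hb'⟩ := (sat_conj.1 (h fun _ => b)).2 _
    (List.mem_map.2 ⟨0, List.mem_range.2 (Nat.succ_pos n), rfl⟩)
  exact ⟨_, color_of_sat_walkFormula hb'⟩

end Formula

/-! ### Interpretations with the output vocabulary of coloured graphs -/

/-- The interpretation given by a formula for the universe, a formula for the edges, and formulas
for the colours `C_0, …, C_n`. -/
def starInterp (w n : ℕ) (φU φE : Formula PairSym) (φC : ℕ → Formula PairSym)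
    (hU : φU.freeVars ⊆ Finset.range w) (hE : φE.freeVars ⊆ Finset.range (2 * w))
    (hC : ∀ i, (φC i).freeVars ⊆ Finset.range w) : Interp PairSym where
  dim := w
  univ := φU
  rels := (edgeSym, φE) :: (List.range (n + 1)).map fun i => (colorSym i, φC i)
  nodup := by
    rw [List.map_cons, List.map_map, List.nodup_cons]
    constructor
    · intro h
      obtain ⟨i, -, hi⟩ := List.mem_map.1 h
      exact absurd (congrArg Prod.snd hi) (by norm_num [edgeSym, colorSym])
    · refine List.nodup_range.map fun i j h => ?_
      exact congrArg Prod.fst h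
  univ_free := hU
  rels_free := by
    intro p hp
    rcases List.mem_cons.1 hp with rfl | hp
    · exact hE
    · obtain ⟨i, -, rfl⟩ := List.mem_map.1 hp
      have h1 : Arity.ar (colorSym i) * w = w := one_mul w
      rw [h1]
      exact hC i

section StarInterp

variable {w n : ℕ} {φU φE : Formula PairSym} {φC : ℕ → Formula PairSym}
  {hU : φU.freeVars ⊆ Finset.range w} {hE : φE.freeVars ⊆ Finset.range (2 * w)}
  {hC : ∀ i, (φC i).freeVars ⊆ Finset.range w}

theorem starInterp_isQuantifierFree (h1 : φU.IsQuantifierFree) (h2 : φE.IsQuantifierFree)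
    (h3 : ∀ i, (φC i).IsQuantifierFree) :
    (starInterp w n φU φE φC hU hE hC).IsQuantifierFree := by
  refine ⟨h1, fun p hp => ?_⟩
  rcases List.mem_cons.1 hp with rfl | hp
  · exact h2
  · obtain ⟨i, -, rfl⟩ := List.mem_map.1 hp
    exact h3 i

theorem primrec_code_starInterp {α : Type*} [Primcodable α] (w : ℕ) {n : α → ℕ}
    {φU φE : Formula PairSym} {φC : α → ℕ → Formula PairSym}
    {hU : φU.freeVars ⊆ Finset.range w} {hE : φE.freeVars ⊆ Finset.range (2 * w)}
    {hC : ∀ a i, (φC a i).freeVars ⊆ Finset.range w} (hn : Primrec n)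
    (h : Primrec₂ fun a i => (φC a i).code) :
    Primrec fun a => (starInterp w (n a) φU φE (φC a) hU hE (hC a)).code := by
  have : Primrec fun a => (w, φU.code, (edgeSym, φE.code) ::
      (List.range (n a + 1)).map fun i => (colorSym i, (φC a i).code)) := by
    refine (Primrec.const w).pair ((Primrec.const _).pair (Primrec.list_cons.comp
      (Primrec.const _) (Primrec.list_map (Primrec.list_range.comp (Primrec.succ.comp hn)) ?_)))
    exact (Formula.primrec_colorSym.comp Primrec.snd).pair h
  refine this.of_eq fun a => ?_
  simp [Interp.code, starInterp, Function.comp_def]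

theorem starInterp_definedOn {A : Str PairSym} (h1 : φU.voc ⊆ A.voc) (h2 : φE.voc ⊆ A.voc)
    (h3 : ∀ i ≤ n, (φC i).voc ⊆ A.voc)
    (hne : ((starInterp w n φU φE φC hU hE hC).univSet A).Nonempty) :
    (starInterp w n φU φE φC hU hE hC).DefinedOn A := by
  refine ⟨⟨h1, fun p hp => ?_⟩, hne⟩
  rcases List.mem_cons.1 hp with rfl | hp
  · exact h2
  · obtain ⟨i, hi, rfl⟩ := List.mem_map.1 hp
    have := List.mem_range.1 hi
    exact h3 i (by omega)

variable {A : Str PairSym} (h : (starInterp w n φU φE φC hU hE hC).DefinedOn A)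

theorem starInterp_apply_voc :
    ((starInterp w n φU φE φC hU hE hC).apply A h).voc = starVoc n := by
  ext R
  simp [Interp.apply, starInterp, starVoc, eq_comm]

theorem tupleAssign_one {C : Type} [Nonempty C] {w : ℕ} (x : Fin w → C) (j : Fin w) :
    tupleAssign (fun _ : Fin 1 => x) j = x j := by
  have hj : (j : ℕ) < 1 * w := by simp
  rw [tupleAssign, dif_pos hj]
  congr 1
  refine Fin.ext ?_
  exact Nat.mod_eq_of_lt j.2

theorem tupleAssign_two_left {C : Type} [Nonempty C] {w : ℕ} (x : Fin 2 → Fin w → C)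
    (j : Fin w) : tupleAssign x j = x 0 j := by
  have hj : (j : ℕ) < 2 * w := by omega
  rw [tupleAssign, dif_pos hj]
  have h0 : (finProdFinEquiv.symm (⟨j, hj⟩ : Fin (2 * w))).1 = 0 :=
    Fin.ext (Nat.div_eq_of_lt j.2)
  have h1 : (finProdFinEquiv.symm (⟨j, hj⟩ : Fin (2 * w))).2 = j :=
    Fin.ext (Nat.mod_eq_of_lt j.2)
  rw [h0, h1]

theorem tupleAssign_two_right {C : Type} [Nonempty C] {w : ℕ} (x : Fin 2 → Fin w → C)
    (j : Fin w) : tupleAssign x (w + j) = x 1 j := by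
  have hj : w + (j : ℕ) < 2 * w := by omega
  have hw : 0 < w := j.pos
  rw [tupleAssign, dif_pos hj]
  have h0 : (finProdFinEquiv.symm (⟨w + j, hj⟩ : Fin (2 * w))).1 = 1 := by
    refine Fin.ext ?_
    show (w + j) / w = 1
    rw [Nat.add_div_left _ hw, Nat.div_eq_of_lt j.2]
  have h1 : (finProdFinEquiv.symm (⟨w + j, hj⟩ : Fin (2 * w))).2 = j := by
    refine Fin.ext ?_
    show (w + j) % w = j
    rw [Nat.add_mod_left, Nat.mod_eq_of_lt j.2]
  rw [h0, h1]

theorem starInterp_apply_color {i : ℕ} (hi : i ≤ n)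
    (x : (starInterp w n φU φE φC hU hE hC).univSet A) :
    ((starInterp w n φU φE φC hU hE hC).apply A h).Color i x ↔
      have := A.nonempty
      Formula.Sat A (tupleAssign (fun _ : Fin 1 => x.1)) (φC i) := by
  constructor
  · rintro ⟨φ, hφ, hs⟩
    rcases List.mem_cons.1 hφ with hφ | hφ
    · exact absurd (congrArg (fun p => p.1.2) hφ) (by norm_num [edgeSym, colorSym])
    · obtain ⟨i', -, hi'⟩ := List.mem_map.1 hφ
      simp only [colorSym, Prod.mk.injEq, and_true] at hi'
      obtain ⟨rfl, rfl⟩ := hi'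
      exact hs
  · exact fun hs => ⟨φC i, List.mem_cons_of_mem _
      (List.mem_map.2 ⟨i, List.mem_range.2 (by omega), rfl⟩), hs⟩

theorem starInterp_apply_edge (x y : (starInterp w n φU φE φC hU hE hC).univSet A) :
    ((starInterp w n φU φE φC hU hE hC).apply A h).Edge x y ↔
      have := A.nonempty
      Formula.Sat A (tupleAssign (fun i : Fin 2 => if i.val = 0 then x.1 else y.1)) φE := by
  have key : ∀ φ, (have := A.nonempty
      Formula.Sat A (tupleAssign (fun i : Fin 2 =>
        (if i.val = 0 then x else y).1)) φ) ↔ (have := A.nonempty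
      Formula.Sat A (tupleAssign (fun i : Fin 2 => if i.val = 0 then x.1 else y.1)) φ) := by
    intro φ
    simp only [apply_ite Subtype.val]
  constructor
  · rintro ⟨φ, hφ, hs⟩
    rcases List.mem_cons.1 hφ with hφ | hφ
    · obtain rfl : φ = φE := congrArg Prod.snd hφ
      exact (key φ).1 hs
    · obtain ⟨i', -, hi'⟩ := List.mem_map.1 hφ
      exact absurd (congrArg (fun p => p.1.2) hi') (by norm_num [edgeSym, colorSym])
  · exact fun hs => ⟨φE, List.mem_cons_self, (key φE).2 hs⟩

end StarInterp

/-! ### Disjoint unions -/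

section Pair

variable {A B : Str Sym}

theorem pair_rel_inl_iff {R : Sym} {a : Fin (Arity.ar R) → A.carrier} (hR : 0 < Arity.ar R) :
    (pair A B).rel (Sum.inl R) (fun i => Sum.inl (a i)) ↔ A.rel R a := by
  constructor
  · rintro (⟨a', h, h'⟩ | ⟨b, -, h'⟩)
    · have : a = a' := funext fun i => Sum.inl_injective (congrFun h' i)
      rwa [this]
    · exact absurd (congrFun h' ⟨0, hR⟩) (by simp)
  · exact fun h => Or.inl ⟨a, h, rfl⟩

/-- For nullary symbols the disjoint union mixes the information on the two structures, so the
hypothesis excludes that the other one contributes. -/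
theorem pair_rel_inr_iff {R : Sym} {b : Fin (Arity.ar R) → B.carrier}
    (hA : Arity.ar R = 0 → R ∉ A.voc) :
    (pair A B).rel (Sum.inl R) (fun i => Sum.inr (b i)) ↔ B.rel R b := by
  constructor
  · rintro (⟨a, h, h'⟩ | ⟨b', h, h'⟩)
    · by_cases hR : Arity.ar R = 0
      · exact absurd (A.mem_voc R a h) (hA hR)
      · exact absurd (congrFun h' ⟨0, Nat.pos_of_ne_zero hR⟩) (by simp)
    · have : b = b' := funext fun i => Sum.inr_injective (congrFun h' i)
      rwa [this]
  · exact fun h => Or.inr ⟨b, h, rfl⟩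

end Pair

/-! ### The parameterized problems -/

theorem pMC_voc {Φ : Set (Formula Sym)} {φ : Formula Sym} (hφ : φ ∈ Φ) :
    (pMC Φ).voc φ.code = φ.voc := by
  have h : ∃ ψ, ψ ∈ Φ ∧ ψ.code = φ.code := ⟨φ, hφ, rfl⟩
  exact (dif_pos h).trans (by rw [Formula.code_injective h.choose_spec.2])

theorem pMC_voc_of_not_exists {Φ : Set (Formula Sym)} {k : ℕ}
    (h : ¬ ∃ φ, φ ∈ Φ ∧ φ.code = k) : (pMC Φ).voc k = ∅ := dif_neg h

theorem pMC_mem_iff {Φ : Set (Formula Sym)} {φ : Formula Sym} (hφ : φ ∈ Φ) {A : Str Sym} :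
    (pMC Φ).mem A φ.code ↔ A.voc = φ.voc ∧ Formula.Holds A φ := by
  constructor
  · rintro ⟨ψ, -, hc, h⟩
    rwa [Formula.code_injective hc] at h
  · exact fun h => ⟨φ, hφ, rfl, h⟩

theorem pHom_voc {𝒜 : Set (Str Sym)} {c : StrCode} (hc : c.toStr ∈ 𝒜) :
    (pHom 𝒜).voc (Encodable.encode c) = c.toStr.voc := by
  have h : ∃ c' : StrCode, c'.toStr ∈ 𝒜 ∧ Encodable.encode c' = Encodable.encode c :=
    ⟨c, hc, rfl⟩
  exact (dif_pos h).trans (by rw [Encodable.encode_injective h.choose_spec.2])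

theorem pHom_voc_of_not_exists {𝒜 : Set (Str Sym)} {k : ℕ}
    (h : ¬ ∃ c : StrCode, c.toStr ∈ 𝒜 ∧ Encodable.encode c = k) : (pHom 𝒜).voc k = ∅ :=
  dif_neg h

theorem pHom_mem_iff {𝒜 : Set (Str Sym)} {c : StrCode} (hc : c.toStr ∈ 𝒜) {B : Str Sym} :
    (pHom 𝒜).mem B (Encodable.encode c) ↔ HomTo c.toStr B := by
  constructor
  · rintro ⟨c', -, he, h⟩
    rwa [Encodable.encode_injective he] at h
  · exact fun h => ⟨c, hc, rfl, h⟩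

/-! ### Descriptions of coloured graphs -/

/-- The tuples listed for the symbol `R` in a description. -/
def tuples (c : StrCode) (R : Sym) : List (List ℕ) :=
  c.2.flatMap fun p => if p.1 = R then p.2 else []

theorem mem_tuples {c : StrCode} {R : Sym} {t : List ℕ} :
    t ∈ tuples c R ↔ ∃ T, (R, T) ∈ c.2 ∧ t ∈ T := by
  simp only [tuples, List.mem_flatMap]
  constructor
  · rintro ⟨⟨R', T⟩, hp, ht⟩
    split_ifs at ht with h
    · simp only at h ht
      subst h
      exact ⟨T, hp, ht⟩
    · simp at ht
  · rintro ⟨T, hp, ht⟩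
    exact ⟨(R, T), hp, by simpa using ht⟩

theorem toStr_edge_iff {c : StrCode} {a b : Fin (c.1 + 1)} :
    c.toStr.Edge a b ↔ [(a : ℕ), (b : ℕ)] ∈ tuples c edgeSym := mem_tuples.symm

theorem toStr_color_iff {c : StrCode} {i : ℕ} {a : Fin (c.1 + 1)} :
    c.toStr.Color i a ↔ [(a : ℕ)] ∈ tuples c (colorSym i) := mem_tuples.symm

/-- The pairs of a vertex and one of its colours. -/
def vertexColors (c : StrCode) : List (ℕ × ℕ) :=
  (List.range (c.1 + 1)).flatMap fun u => (List.range (c.1 + 1)).flatMap fun i =>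
    if [u] ∈ tuples c (colorSym i) then [(u, i)] else []

/-- The edges of a coloured graph that is given by a description, if each vertex is replaced by
its colour. -/
def colorEdges (c : StrCode) : List (ℕ × ℕ) :=
  (vertexColors c).flatMap fun x => (vertexColors c).flatMap fun y =>
    if [x.1, y.1] ∈ tuples c edgeSym then [(x.2, y.2)] else []

theorem mem_vertexColors {c : StrCode} {u i : ℕ} : (u, i) ∈ vertexColors c ↔
    u < c.1 + 1 ∧ i < c.1 + 1 ∧ [u] ∈ tuples c (colorSym i) := by
  simp only [vertexColors, List.mem_flatMap, List.mem_range]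
  constructor
  · rintro ⟨u', hu, i', hi, h⟩
    split_ifs at h with h'
    · simp only [List.mem_singleton, Prod.mk.injEq] at h
      obtain ⟨rfl, rfl⟩ := h
      exact ⟨hu, hi, h'⟩
    · simp at h
  · rintro ⟨hu, hi, h⟩
    exact ⟨u, hu, i, hi, by rw [if_pos h]; exact List.mem_singleton_self _⟩

theorem mem_colorEdges {c : StrCode} {i j : ℕ} : (i, j) ∈ colorEdges c ↔
    ∃ u v, (u, i) ∈ vertexColors c ∧ (v, j) ∈ vertexColors c ∧ [u, v] ∈ tuples c edgeSym := by
  simp only [colorEdges, List.mem_flatMap]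
  constructor
  · rintro ⟨⟨u, i'⟩, hu, ⟨v, j'⟩, hv, h⟩
    split_ifs at h with h'
    · simp only [List.mem_singleton, Prod.mk.injEq] at h
      obtain ⟨rfl, rfl⟩ := h
      exact ⟨u, v, hu, hv, h'⟩
    · simp at h
  · rintro ⟨u, v, hu, hv, h⟩
    exact ⟨(u, i), hu, (v, j), hv, by rw [if_pos h]; exact List.mem_singleton_self _⟩

theorem primrec_tuples : Primrec₂ tuples := by
  refine Primrec.list_flatMap (Primrec.snd.comp Primrec.fst) ?_
  exact Primrec.ite (c := fun x : (StrCode × Sym) × (Sym × List (List ℕ)) => x.2.1 = x.1.2)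
    (Primrec.eq.comp (Primrec.fst.comp Primrec.snd) (Primrec.snd.comp Primrec.fst))
    (Primrec.snd.comp Primrec.snd) (Primrec.const [])

theorem primrec_vertexColors : Primrec vertexColors := by
  have hr : Primrec fun c : StrCode => List.range (c.1 + 1) :=
    Primrec.list_range.comp (Primrec.succ.comp Primrec.fst)
  refine Primrec.list_flatMap hr (Primrec.list_flatMap (hr.comp Primrec.fst) ?_)
  refine Primrec.ite (c := fun x : (StrCode × ℕ) × ℕ => [x.1.2] ∈ tuples x.1.1 (colorSym x.2))
    (primrecPred_mem.comp (Primrec.pair ?_ ?_)) ?_ (Primrec.const [])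
  · exact Primrec.list_cons.comp (Primrec.snd.comp Primrec.fst) (Primrec.const [])
  · exact primrec_tuples.comp (Primrec.fst.comp Primrec.fst)
      (Formula.primrec_colorSym.comp Primrec.snd)
  · exact Primrec.list_cons.comp ((Primrec.snd.comp Primrec.fst).pair Primrec.snd)
      (Primrec.const [])

theorem primrec_colorEdges : Primrec colorEdges := by
  refine Primrec.list_flatMap primrec_vertexColors
    (Primrec.list_flatMap (primrec_vertexColors.comp Primrec.fst) ?_)
  refine Primrec.ite (c := fun x : (StrCode × (ℕ × ℕ)) × (ℕ × ℕ) =>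
      [x.1.2.1, x.2.1] ∈ tuples x.1.1 edgeSym)
    (primrecPred_mem.comp (Primrec.pair ?_ ?_)) ?_ (Primrec.const [])
  · exact Primrec.list_cons.comp (Primrec.fst.comp (Primrec.snd.comp Primrec.fst))
      (Primrec.list_cons.comp (Primrec.fst.comp Primrec.snd) (Primrec.const []))
  · exact primrec_tuples.comp (Primrec.fst.comp Primrec.fst) (Primrec.const _)
  · exact Primrec.list_cons.comp ((Primrec.snd.comp (Primrec.snd.comp Primrec.fst)).pair
      (Primrec.snd.comp Primrec.snd)) (Primrec.const [])

theorem starGraph_edge_iff {n : ℕ} {F : SimpleGraph (Fin (n + 1))} {a b : Fin (n + 1)} :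
    (starGraph F).Edge a b ↔ F.Adj a b := by
  constructor
  · rintro (⟨i, j, hij, -, hx⟩ | ⟨i, hR, -⟩)
    · have h2 : [a, b] = [i, j] := hx
      simp only [List.cons.injEq, and_true] at h2
      rwa [h2.1, h2.2]
    · exact absurd (congrArg Prod.snd hR) (by norm_num [edgeSym, colorSym])
  · exact fun h => Or.inl ⟨a, b, h, rfl, rfl⟩

theorem starGraph_color_iff {n : ℕ} {F : SimpleGraph (Fin (n + 1))} {i : ℕ} {a : Fin (n + 1)} :
    (starGraph F).Color i a ↔ (a : ℕ) = i := by
  constructor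
  · rintro (⟨i, j, -, hR, -⟩ | ⟨i', hR, hx⟩)
    · exact absurd (congrArg Prod.snd hR) (by norm_num [edgeSym, colorSym])
    · have h1 : i = i' := congrArg Prod.fst hR
      have h2 : [a] = [i'] := hx
      simp only [List.cons.injEq, and_true] at h2
      rw [h1, h2]
  · rintro rfl
    exact Or.inr ⟨a, rfl, rfl⟩

theorem IsIso.edge_iff {A B : Str Sym} {e : A.carrier ≃ B.carrier}
    (he : ∀ R x, A.rel R x ↔ B.rel R (fun i => e (x i))) (a b : A.carrier) :
    A.Edge a b ↔ B.Edge (e a) (e b) := by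
  rw [Str.Edge, he]
  exact iff_of_eq (congrArg (B.rel edgeSym) (funext fun k => apply_ite e _ _ _))

theorem HomTo.iff_of_isIso {A A' B : Str Sym} (h : IsIso A A') : HomTo A B ↔ HomTo A' B := by
  obtain ⟨hv, e, he⟩ := h
  constructor
  · rintro ⟨f, hf, hr⟩
    refine ⟨fun x => f (e.symm x), hv.symm.trans hf, fun R x hx => hr R _ ((he R _).2 ?_)⟩
    simpa using hx
  · rintro ⟨f, hf, hr⟩
    exact ⟨fun x => f (e x), hv.trans hf, fun R x hx => hr R _ ((he R x).1 hx)⟩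

/-- A description of (an isomorphic copy of) `F*` allows to recover the number of vertices and the
edges of `F`. -/
theorem exists_forest_of_toStr_mem {c : StrCode} {d : ℕ} (hc : c.toStr ∈ starForests d) :
    ∃ F : SimpleGraph (Fin (c.1 + 1)), IsForestOfHeightLE F d ∧ IsIso c.toStr (starGraph F) ∧
      ∀ i j : Fin (c.1 + 1), ((i : ℕ), (j : ℕ)) ∈ colorEdges c ↔ F.Adj i j := by
  obtain ⟨n, F, hF, hiso⟩ := hc
  obtain ⟨hv, e, he⟩ := id hiso
  obtain rfl : n = c.1 := by
    have h : Fintype.card (Fin (c.1 + 1)) = Fintype.card (Fin (n + 1)) := Fintype.card_congr e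
    simp only [Fintype.card_fin] at h
    omega
  refine ⟨F, hF, hiso, fun i j => ?_⟩
  let e' : Fin (c.1 + 1) ≃ Fin (c.1 + 1) := e
  have hcol : ∀ (a : Fin (c.1 + 1)) (i : ℕ), [(a : ℕ)] ∈ tuples c (colorSym i) ↔
      (e' a : ℕ) = i := fun a i =>
    toStr_color_iff.symm.trans ((he _ _).trans starGraph_color_iff)
  have hedge : ∀ a b : Fin (c.1 + 1), [(a : ℕ), (b : ℕ)] ∈ tuples c edgeSym ↔
      F.Adj (e' a) (e' b) := fun a b =>
    toStr_edge_iff.symm.trans ((IsIso.edge_iff he a b).trans starGraph_edge_iff)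
  rw [mem_colorEdges]
  simp only [mem_vertexColors]
  constructor
  · rintro ⟨u, v, ⟨hu, -, hui⟩, ⟨hv', -, hvj⟩, h⟩
    have h1 := (hcol ⟨u, hu⟩ i).1 hui
    have h2 := (hcol ⟨v, hv'⟩ j).1 hvj
    have h3 := (hedge ⟨u, hu⟩ ⟨v, hv'⟩).1 h
    rwa [Fin.ext h1, Fin.ext h2] at h3
  · intro h
    refine ⟨e'.symm i, e'.symm j, ⟨(e'.symm i).2, i.2, ?_⟩, ⟨(e'.symm j).2, j.2, ?_⟩, ?_⟩
    · rw [hcol]; simp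
    · rw [hcol]; simp
    · rw [hedge]; simpa using h

/-- A description of a structure with universe `{0, …, m}`, the edges in a list `E`, the colours
`C_0, …, C_n` given by lists `col i`, and further relations. -/
def starCode (m n : ℕ) (E : List (List ℕ)) (col : ℕ → List (List ℕ))
    (rest : List (Sym × List (List ℕ))) : StrCode :=
  (m, (edgeSym, E) :: ((List.range (n + 1)).map (fun i => (colorSym i, col i)) ++ rest))

section StarCode

variable {m n : ℕ} {E : List (List ℕ)} {col : ℕ → List (List ℕ)}
  {rest : List (Sym × List (List ℕ))}

theorem starCode_voc : (starCode m n E col rest).toStr.voc =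
    starVoc n ∪ (rest.map Prod.fst).toFinset := by
  ext R
  simp [StrCode.toStr, starCode, starVoc, eq_comm]

theorem starCode_edge_iff (hrest : ∀ p ∈ rest, p.1 ≠ edgeSym) {a b : Fin (m + 1)} :
    (starCode m n E col rest).toStr.Edge a b ↔ [(a : ℕ), (b : ℕ)] ∈ E := by
  refine (toStr_edge_iff (c := starCode m n E col rest)).trans (mem_tuples.trans ?_)
  constructor
  · rintro ⟨T, hT, h⟩
    rcases List.mem_cons.1 hT with hT | hT
    · obtain rfl : T = E := congrArg Prod.snd hT
      exact h
    · rcases List.mem_append.1 hT with hT | hT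
      · obtain ⟨i, -, hi⟩ := List.mem_map.1 hT
        exact absurd (congrArg (fun p => p.1.2) hi) (by norm_num [edgeSym, colorSym])
      · exact absurd rfl (hrest _ hT)
  · exact fun h => ⟨E, List.mem_cons_self, h⟩

theorem starCode_color_iff (hrest : ∀ p ∈ rest, p.1.2 ≠ 1) {i : ℕ} {a : Fin (m + 1)} :
    (starCode m n E col rest).toStr.Color i a ↔ i ≤ n ∧ [(a : ℕ)] ∈ col i := by
  refine (toStr_color_iff (c := starCode m n E col rest)).trans (mem_tuples.trans ?_)
  constructor
  · rintro ⟨T, hT, h⟩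
    rcases List.mem_cons.1 hT with hT | hT
    · exact absurd (congrArg (fun p => p.1.2) hT) (by norm_num [edgeSym, colorSym])
    · rcases List.mem_append.1 hT with hT | hT
      · obtain ⟨i', hi', hi⟩ := List.mem_map.1 hT
        simp only [colorSym, Prod.mk.injEq, and_true] at hi
        obtain ⟨rfl, rfl⟩ := hi
        have := List.mem_range.1 hi'
        exact ⟨by omega, h⟩
      · exact absurd rfl (hrest _ hT)
  · rintro ⟨hi, h⟩
    exact ⟨col i, List.mem_cons_of_mem _ (List.mem_append_left _
      (List.mem_map.2 ⟨i, List.mem_range.2 (by omega), rfl⟩)), h⟩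

end StarCode

theorem primrec_starCode {α : Type*} [Primcodable α] {m n : α → ℕ} {E : α → List (List ℕ)}
    {col : α → ℕ → List (List ℕ)} {rest : α → List (Sym × List (List ℕ))} (hm : Primrec m)
    (hn : Primrec n) (hE : Primrec E) (hcol : Primrec₂ col) (hrest : Primrec rest) :
    Primrec fun a => starCode (m a) (n a) (E a) (col a) (rest a) := by
  refine hm.pair (Primrec.list_cons.comp ((Primrec.const _).pair hE)
    (Primrec.list_append.comp (Primrec.list_map (Primrec.list_range.comp (Primrec.succ.comp hn))
      ?_) hrest))
  exact (Formula.primrec_colorSym.comp Primrec.snd).pair hcol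

/-! ### From homomorphism problems to model checking -/

section HomToMC

/-- The description coded by a number. -/
def decodeStr (k : ℕ) : StrCode := (Encodable.decode k).getD (0, [])

theorem primrec_decodeStr : Primrec decodeStr :=
  Primrec.option_getD.comp Primrec.decode (Primrec.const _)

/-- A structure with a single element, which has a loop and no colour. -/
def loopCode (n : ℕ) : StrCode := starCode 0 n [[0, 0]] (fun _ => []) []

theorem primrec_loopCode : Primrec loopCode :=
  primrec_starCode (Primrec.const _) Primrec.id (Primrec.const _) (Primrec.const _)
    (Primrec.const _)

/-- The interpretation that maps `⟨A, B⟩` to the reduct of the disjoint union of `A` and `B` to the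
vocabulary of coloured graphs. -/
def reductInterp (n : ℕ) : Interp PairSym :=
  starInterp 1 n (Formula.eq 0 0) (Formula.rel (Sum.inl edgeSym) (fun i => i.val))
    (fun i => Formula.rel (Sum.inl (colorSym i)) (fun _ => 0)) (by simp [Formula.freeVars])
    (by
      intro x hx
      obtain ⟨i, -, rfl⟩ := Finset.mem_image.1 hx
      exact Finset.mem_range.2 i.2)
    (by
      intro i x hx
      obtain ⟨i, -, rfl⟩ := Finset.mem_image.1 hx
      simp)

theorem primrec_code_reductInterp : Primrec fun n => (reductInterp n).code := by
  refine primrec_code_starInterp 1 Primrec.id ?_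
  have : Primrec fun x : ℕ × ℕ => Nat.pair 0 (Nat.pair
      (Encodable.encode (Sum.inl (colorSym x.2) : PairSym)) (Encodable.encode [0])) :=
    Primrec₂.natPair.comp (Primrec.const 0) (Primrec₂.natPair.comp
      (Primrec.encode.comp (Primrec.sumInl.comp (Formula.primrec_colorSym.comp Primrec.snd)))
      (Primrec.const _))
  exact this

theorem starVoc_subset_pair_voc {n : ℕ} {A B : Str Sym} (h : starVoc n ⊆ A.voc) {R : Sym}
    (hR : R ∈ starVoc n) : Sum.inl R ∈ (pair A B).voc :=
  Finset.mem_union_left _ (Finset.mem_image_of_mem _ (Finset.mem_union_left _ (h hR)))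

theorem colorSym_mem_starVoc {i n : ℕ} (hi : i ≤ n) : colorSym i ∈ starVoc n :=
  Finset.mem_insert_of_mem (Finset.mem_image_of_mem _ (Finset.mem_range.2 (by omega)))

theorem reductInterp_definedOn {n : ℕ} {A B : Str Sym} (h : starVoc n ⊆ A.voc) :
    (reductInterp n).DefinedOn (pair A B) := by
  refine starInterp_definedOn (by simp [Formula.voc]) ?_ (fun i hi => ?_) ?_
  · rw [Formula.voc, Finset.singleton_subset_iff]
    exact starVoc_subset_pair_voc h (Finset.mem_insert_self _ _)
  · rw [Formula.voc, Finset.singleton_subset_iff]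
    exact starVoc_subset_pair_voc h (colorSym_mem_starVoc hi)
  · have := (pair A B).nonempty
    exact ⟨fun _ => Classical.arbitrary _, rfl⟩

/-- The element of `A` that a member of the universe of the reduct stands for. -/
def reductElt {n : ℕ} {A : Str PairSym} (x : (reductInterp n).univSet A) : A.carrier :=
  x.1 (0 : Fin 1)

/-- The member of the universe of the reduct that stands for an element. -/
def toReduct (n : ℕ) {A : Str PairSym} (a : A.carrier) : (reductInterp n).univSet A :=
  ⟨fun _ => a, rfl⟩

section Reduct

variable {n : ℕ}

theorem reductInterp_color {A : Str PairSym} (h : (reductInterp n).DefinedOn A) {i : ℕ}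
    (hi : i ≤ n) (x : (reductInterp n).univSet A) :
    ((reductInterp n).apply A h).Color i x ↔
      A.rel (Sum.inl (colorSym i)) (fun _ => reductElt x) := by
  refine (starInterp_apply_color h hi x).trans ?_
  have := A.nonempty
  exact iff_of_eq (congrArg _ (funext fun _ => tupleAssign_one x.1 (0 : Fin 1)))

theorem reductInterp_edge {A : Str PairSym} (h : (reductInterp n).DefinedOn A)
    (x y : (reductInterp n).univSet A) :
    ((reductInterp n).apply A h).Edge x y ↔
      A.rel (Sum.inl edgeSym) (fun i => if i.val = 0 then reductElt x else reductElt y) := by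
  refine (starInterp_apply_edge h x y).trans ?_
  have := A.nonempty
  refine iff_of_eq (congrArg _ (funext fun i => ?_))
  have h0 := tupleAssign_two_left
    (fun i : Fin 2 => if i.val = 0 then x.1 else y.1) (0 : Fin 1)
  have h1 := tupleAssign_two_right
    (fun i : Fin 2 => if i.val = 0 then x.1 else y.1) (0 : Fin 1)
  match i with
  | ⟨0, _⟩ => exact h0
  | ⟨1, _⟩ => exact h1

variable {A : Str Sym} (h : (reductInterp n).DefinedOn (pair (loopCode n).toStr A))

theorem exists_color_of_reduct_color {i : ℕ} (hi : i ≤ n)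
    (x : (reductInterp n).univSet (pair (loopCode n).toStr A))
    (hx : ((reductInterp n).apply _ h).Color i x) :
    ∃ a, reductElt x = Sum.inr a ∧ A.Color i a := by
  rcases (reductInterp_color h hi x).1 hx with ⟨a, ha, -⟩ | ⟨b, hb, hxb⟩
  · have hc : (loopCode n).toStr.Color i (a (0 : Fin 1)) := by
      have : a = fun _ => a (0 : Fin 1) :=
        funext fun j => congrArg a (Subsingleton.elim (α := Fin 1) _ _)
      rwa [this] at ha
    have := (starCode_color_iff (by simp)).1 hc
    simp at this
  · refine ⟨b (0 : Fin 1), congrFun hxb (0 : Fin 1), ?_⟩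
    have : b = fun _ => b (0 : Fin 1) :=
      funext fun j => congrArg b (Subsingleton.elim (α := Fin 1) _ _)
    rwa [this] at hb

theorem exists_loop_reduct : ∃ b, ((reductInterp n).apply _ h).Edge b b := by
  refine ⟨toReduct n (Sum.inl (0 : Fin 1)), (reductInterp_edge h _ _).2 ?_⟩
  refine Or.inl ⟨fun _ => (0 : Fin 1), ?_, funext fun i => ite_self _⟩
  have : (loopCode n).toStr.Edge (0 : Fin 1) (0 : Fin 1) :=
    (starCode_edge_iff (by simp)).2 (by simp)
  exact Eq.mp (congrArg _ (funext fun _ => ite_self _)) this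

theorem colorHom_reduct_iff (F : SimpleGraph (Fin (n + 1))) :
    ColorHom F ((reductInterp n).apply _ h) ↔ ColorHom F A := by
  constructor
  · rintro ⟨f, hfc, hfe⟩
    choose g hg hgc using fun i : Fin (n + 1) =>
      exists_color_of_reduct_color h (Nat.le_of_lt_succ i.2) _ (hfc i)
    refine ⟨g, hgc, fun i j hij => ?_⟩
    have := (reductInterp_edge h _ _).1 (hfe i j hij)
    rw [hg i, hg j] at this
    refine (pair_rel_inr_iff (A := (loopCode n).toStr) (fun h => absurd h two_ne_zero)).1 ?_
    refine Eq.mp (congrArg _ (funext fun k => ?_)) this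
    exact (apply_ite Sum.inr _ _ _).symm
  · rintro ⟨f, hfc, hfe⟩
    refine ⟨fun i => toReduct n (Sum.inr (f i)), fun i => ?_, fun i j hij => ?_⟩
    · exact (reductInterp_color h (Nat.le_of_lt_succ i.2) _).2 (Or.inr ⟨_, hfc i, rfl⟩)
    · exact (reductInterp_edge h _ _).2
        (Or.inr ⟨_, hfe i j hij, funext fun k => (apply_ite Sum.inr _ _ _).symm⟩)

end Reduct

/-- Homomorphism problems for coloured forests reduce to model checking: the forest is described by
a sentence, and the structure is modified only by adding an isolated loop. -/
theorem pHom_reducible_pMC {q : ℕ} (hq : 1 ≤ q) {Ψ : Set (Formula Sym)}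
    (hΨ : primitivePositiveSentences q 2 ⊆ Ψ) :
    QfapReducible (pHom (starForests (q - 1))) (pMC Ψ) := by
  have hn : Primrec fun k => (decodeStr k).1 := Primrec.fst.comp primrec_decodeStr
  refine ⟨1, fun k => (Formula.forestFormula q (decodeStr k).1 (colorEdges (decodeStr k))).code,
    fun k => loopCode (decodeStr k).1, fun k => reductInterp (decodeStr k).1, ?_, ?_, ?_, ?_, ?_⟩
  · exact ((Formula.primrec_code_forestFormula q).comp
      (hn.pair (primrec_colorEdges.comp primrec_decodeStr))).to_comp
  · exact (primrec_loopCode.comp hn).to_comp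
  · exact (primrec_code_reductInterp.comp hn).to_comp
  · exact fun k => ⟨rfl, starInterp_isQuantifierFree trivial trivial fun _ => trivial⟩
  intro k A hA
  have hmem := hΨ (Formula.forestFormula_mem (n := (decodeStr k).1)
    (E := colorEdges (decodeStr k)) hq)
  have hvoc : (loopCode (decodeStr k).1).toStr.voc = starVoc (decodeStr k).1 :=
    starCode_voc.trans (by simp)
  have hdef := reductInterp_definedOn (B := A) hvoc.ge
  have hvB := starInterp_apply_voc hdef
  refine ⟨hdef, ?_, ?_⟩
  · rw [pMC_voc hmem, Formula.forestFormula_voc]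
    exact hvB
  refine Iff.trans ?_ (pMC_mem_iff hmem).symm
  rw [Formula.forestFormula_voc]
  refine Iff.trans ?_ (and_iff_right hvB).symm
  by_cases hk : ∃ c : StrCode, c.toStr ∈ starForests (q - 1) ∧ Encodable.encode c = k
  · obtain ⟨c, hc, rfl⟩ := hk
    obtain ⟨F, hF, hiso, hE⟩ := exists_forest_of_toStr_mem hc
    have hdec : decodeStr (Encodable.encode c) = c := by
      rw [decodeStr, Encodable.encodek]
      rfl
    rw [pHom_voc hc] at hA
    rw [pHom_mem_iff hc, HomTo.iff_of_isIso hiso, homTo_starGraph_iff]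
    have hv : starVoc c.1 = A.voc := (hA.trans hiso.1).symm
    refine (and_iff_right hv).trans ?_
    have key : ∀ c' : StrCode, c' = c →
        ∀ hdef' : (reductInterp c'.1).DefinedOn (pair (loopCode c'.1).toStr A),
        (ColorHom F A ↔ Formula.Holds ((reductInterp c'.1).apply _ hdef')
          (Formula.forestFormula q c'.1 (colorEdges c'))) := by
      rintro _ rfl hdef'
      exact (colorHom_reduct_iff hdef' F).symm.trans
        (Formula.holds_forestFormula_iff hF hE (exists_loop_reduct hdef')).symm
    exact key _ hdec hdef
  · -- `A` has the empty vocabulary, hence no element of the interpreted structure is coloured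
    rw [pHom_voc_of_not_exists hk] at hA
    constructor
    · rintro ⟨c, hc, hk', -⟩
      exact absurd ⟨c, hc, hk'⟩ hk
    · intro hs
      obtain ⟨b, hb⟩ := Formula.exists_color_of_holds_forestFormula hs
      obtain ⟨a, -, ha⟩ := exists_color_of_reduct_color hdef (Nat.zero_le _) b hb
      have := A.mem_voc _ _ ha
      rw [hA] at this
      exact absurd this (Finset.notMem_empty _)

end HomToMC

/-! ### The structure and the interpretation that set up the game -/

namespace Formula

/-- The quantifier-free formula expressing `Eval`. The variable `0` is reserved, and `i + 1` stands
for the element chosen at depth `i`. -/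
def matrix (q : ℕ) (S : ℕ → ℕ) : List ℕ → Formula Sym → Formula PairSym
  | env, rel R x => rel (Sum.inl R) (fun i => level env (x i) + 1)
  | env, eq x y => eq (level env x + 1) (level env y + 1)
  | env, neg φ => neg (matrix q S env φ)
  | env, and φ ψ =>
      if env.length < q then
        if (S env.length).testBit (positionCode env (code (and φ ψ)))
        then matrix q S env φ else matrix q S env ψ
      else and (matrix q S env φ) (matrix q S env ψ)
  | env, or φ ψ => or (matrix q S env φ) (matrix q S env ψ)
  | env, ex x φ => matrix q S (x :: env) φ
  | _, all _ _ => eq 0 0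

variable {pp : Bool} {r q : ℕ} {S : ℕ → ℕ}

theorem matrix_isQuantifierFree (φ : Formula Sym) :
    ∀ env, (matrix q S env φ).IsQuantifierFree := by
  induction φ with
  | rel R x => exact fun _ => trivial
  | eq x y => exact fun _ => trivial
  | neg φ ih => exact ih
  | and φ ψ ih ih' =>
    intro env
    simp only [matrix]
    split_ifs
    exacts [ih env, ih' env, ⟨ih env, ih' env⟩]
  | or φ ψ ih ih' => exact fun env => ⟨ih env, ih' env⟩
  | ex x φ ih => exact fun env => ih _
  | all x φ ih => exact fun _ => trivial

theorem matrix_voc (φ : Formula Sym) :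
    ∀ env, (matrix q S env φ).voc ⊆ φ.voc.image Sum.inl := by
  induction φ with
  | rel R x => exact fun _ => by simp [matrix, voc]
  | eq x y => exact fun _ => by simp [matrix, voc]
  | neg φ ih => exact ih
  | and φ ψ ih ih' =>
    intro env
    simp only [matrix, voc, Finset.image_union]
    split_ifs
    · exact (ih env).trans Finset.subset_union_left
    · exact (ih' env).trans Finset.subset_union_right
    · exact Finset.union_subset_union (ih env) (ih' env)
  | or φ ψ ih ih' =>
    intro env
    simp only [matrix, voc, Finset.image_union]
    exact Finset.union_subset_union (ih env) (ih' env)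
  | ex x φ ih => exact fun env => ih _
  | all x φ ih => exact fun _ => by simp [matrix, voc]

theorem matrix_freeVars {φ : Formula Sym} : ∀ {env}, env.length ≤ q →
    Admissible pp r q env φ → (matrix q S env φ).freeVars ⊆ Finset.range (q + 1) := by
  induction φ with
  | rel R x =>
    intro env hl h y hy
    obtain ⟨i, -, rfl⟩ := Finset.mem_image.1 hy
    have := level_lt (h.2 i)
    exact Finset.mem_range.2 (by omega)
  | eq x y =>
    intro env hl h z hz
    have h1 := level_lt h.1
    have h2 := level_lt h.2
    simp only [matrix, freeVars, Finset.mem_insert, Finset.mem_singleton] at hz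
    exact Finset.mem_range.2 (by omega)
  | neg φ ih => exact fun hl h => ih hl h.2.2
  | and φ ψ ih ih' =>
    intro env hl h
    simp only [matrix]
    split_ifs
    exacts [ih hl h.1, ih' hl h.2, Finset.union_subset (ih hl h.1) (ih' hl h.2)]
  | or φ ψ ih ih' => exact fun hl h => Finset.union_subset (ih hl h.2.1) (ih' hl h.2.2)
  | ex x φ ih => exact fun hl h => ih (by simpa using h.1) h.2
  | all x φ ih => exact fun _ h => h.elim

theorem sat_matrix {G A : Str Sym} (hG : ∀ R ∈ G.voc, Arity.ar R ≠ 0)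
    {v : ℕ → (pair G A).carrier} {X : ℕ → A.carrier} (hv : ∀ i < q, v (i + 1) = Sum.inr (X i))
    {φ : Formula Sym} : ∀ {env}, env.length ≤ q → Admissible pp r q env φ →
    (Sat (pair G A) v (matrix q S env φ) ↔ Eval A q S X env φ) := by
  have hlev : ∀ {env : List ℕ} {x : ℕ}, env.length ≤ q → x ∈ env →
      v (level env x + 1) = Sum.inr (X (level env x)) := fun hl hx =>
    hv _ ((level_lt hx).trans_le hl)
  induction φ with
  | rel R x =>
    intro env hl h
    have : (fun i => v (level env (x i) + 1)) = fun i => Sum.inr (X (level env (x i))) :=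
      funext fun i => hlev hl (h.2 i)
    simp only [matrix, Sat, Eval]
    refine (iff_of_eq (congrArg _ this)).trans (pair_rel_inr_iff fun h0 hR => hG R hR h0)
  | eq x y =>
    intro env hl h
    simp only [matrix, Sat, Eval]
    rw [hlev hl h.1, hlev hl h.2]
    exact Sum.inr_injective.eq_iff
  | neg φ ih => exact fun hl h => not_congr (ih hl h.2.2)
  | and φ ψ ih ih' =>
    intro env hl h
    simp only [matrix, Eval]
    split_ifs
    exacts [ih hl h.1, ih' hl h.2, and_congr (ih hl h.1) (ih' hl h.2)]
  | or φ ψ ih ih' => exact fun hl h => or_congr (ih hl h.2.1) (ih' hl h.2.2)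
  | ex x φ ih => exact fun hl h => ih (by simpa using h.1) h.2
  | all x φ ih => exact fun _ h => h.elim

/-! ### Computability of the quantifier-free formulas -/

/-- The code of `matrix` for atoms. -/
def matrixAtomCode (env : List ℕ) (n : ℕ) : ℕ :=
  if n.unpair.1 = 0 then
    Nat.pair 0 (Nat.pair (2 * n.unpair.2.unpair.1) (Encodable.encode
      ((Denumerable.ofNat (List ℕ) n.unpair.2.unpair.2).map fun x => level env x + 1)))
  else Nat.pair 1 (Nat.pair (level env n.unpair.2.unpair.1 + 1)
    (level env n.unpair.2.unpair.2 + 1))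

/-- The code of `matrix` for atoms and negated atoms. -/
def matrixBaseCode (x : List ℕ × (ℕ × ℕ)) (n : ℕ) : ℕ :=
  if n.unpair.1 = 2 then Nat.pair 2 (matrixAtomCode x.1 n.unpair.2) else matrixAtomCode x.1 n

/-- The code of `matrix` for connectives and quantifiers; `a` and `b` are the codes for the two
parts. -/
def matrixStepCode (q : ℕ) (x : List ℕ × (ℕ × ℕ)) (n a b : ℕ) : ℕ :=
  if n.unpair.1 = 3 then
    if x.1.length < q then
      if digits x.2.1 (q - 1) x.2.2 x.1.length / 2 ^ positionCode x.1 n % 2 = 1 then a else b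
    else Nat.pair 3 (Nat.pair a b)
  else if n.unpair.1 = 5 then b else Nat.pair 4 (Nat.pair a b)

/-- The parameter of `matrixCode` below a connective or quantifier with code `n`. -/
def matrixNext (x : List ℕ × (ℕ × ℕ)) (n : ℕ) : List ℕ × (ℕ × ℕ) := (nextEnv x.1 n, x.2)

/-- The code of `matrix`; the parameter consists of `env`, the branching number, and a leaf. -/
def matrixCode (q : ℕ) : List ℕ × (ℕ × ℕ) → ℕ → ℕ :=
  codeRec matrixBaseCode matrixNext (matrixStepCode q)

theorem code_matrix_atom {M u : ℕ} {φ : Formula Sym} (h : φ.IsAtom) (env : List ℕ) :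
    matrixAtomCode env φ.code = (matrix q (digits M (q - 1) u) env φ).code := by
  cases φ with
  | rel R x =>
    simp only [matrixAtomCode, code, Nat.unpair_pair, if_true, Denumerable.ofNat_encode, matrix,
      List.map_ofFn]
    rfl
  | eq x y => simp [matrixAtomCode, code, matrix]
  | _ => exact h.elim

theorem code_matrix {M u : ℕ} {φ : Formula Sym} : ∀ {env}, Admissible pp r q env φ →
    matrixCode q (env, (M, u)) φ.code = (matrix q (digits M (q - 1) u) env φ).code := by
  induction φ with
  | rel R x =>
    intro env _
    rw [← code_matrix_atom (by trivial), matrixCode]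
    conv_lhs => rw [code, codeRec_base _ _ _ _ (by norm_num), ← code]
    simp [matrixBaseCode, code]
  | eq x y =>
    intro env _
    rw [← code_matrix_atom (by trivial), matrixCode]
    conv_lhs => rw [code, codeRec_base _ _ _ _ (by norm_num)]
    simp [matrixBaseCode, code]
  | neg φ ih =>
    intro env h
    have h1 := code_matrix_atom (q := q) (M := M) (u := u) h.2.1 env
    rw [matrixCode]
    conv_lhs => rw [code, codeRec_base _ _ _ _ (by norm_num)]
    simp [matrixBaseCode, h1, matrix, code]
  | and φ ψ ih ih' =>
    intro env h
    have h1 := ih h.1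
    have h2 := ih' h.2
    rw [matrixCode] at h1 h2 ⊢
    conv_lhs => rw [code, codeRec_step _ _ _ _ (by norm_num)]
    simp only [Nat.unpair_pair, matrixNext, nextEnv, show (3 : ℕ) ≠ 5 by norm_num, if_false, h1, h2,
      matrixStepCode, if_true, matrix, Nat.testBit_eq_decide_div_mod_eq, decide_eq_true_eq]
    rw [← code]
    split_ifs <;> rfl
  | or φ ψ ih ih' =>
    intro env h
    have h1 := ih h.2.1
    have h2 := ih' h.2.2
    rw [matrixCode] at h1 h2 ⊢
    conv_lhs => rw [code, codeRec_step _ _ _ _ (by norm_num)]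
    simp [matrixNext, nextEnv, h1, h2, matrixStepCode, matrix, code]
  | ex x φ ih =>
    intro env h
    have h1 := ih h.2
    rw [matrixCode] at h1 ⊢
    conv_lhs => rw [code, codeRec_step _ _ _ _ (by norm_num)]
    simp [matrixNext, nextEnv, h1, matrixStepCode, matrix]
  | all x φ ih => exact fun h => h.elim

end Formula

section Computability

theorem primrec_pow : Primrec₂ ((· ^ ·) : ℕ → ℕ → ℕ) :=
  Primrec₂.unpaired'.1 Nat.Primrec.pow

theorem primrec_level : Primrec₂ level := by
  refine Primrec.nat_sub.comp (Primrec.pred.comp (Primrec.list_length.comp Primrec.fst)) ?_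
  exact Primrec.list_idxOf.comp Primrec.snd Primrec.fst

theorem primrec_parent : Primrec₂ parent :=
  Primrec.pred.comp (Primrec.nat_div.comp Primrec.snd Primrec.fst)

theorem primrec_digits (l : ℕ) : Primrec fun x : (ℕ × ℕ) × ℕ => digits x.1.1 l x.1.2 x.2 := by
  refine Primrec.nat_mod.comp (Primrec.nat_iterate
    (Primrec.nat_sub.comp (Primrec.const l) Primrec.snd) (Primrec.snd.comp Primrec.fst) ?_)
    (Primrec.fst.comp Primrec.fst)
  exact primrec_parent.comp (Primrec.fst.comp (Primrec.fst.comp Primrec.fst)) Primrec.snd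

theorem primrec_treeSize : Primrec₂ treeSize := by
  refine (Primrec.nat_rec (f := fun _ : ℕ => 0) (g := fun M x => M * (x.2 + 1))
    (Primrec.const 0) ?_).of_eq fun M j => ?_
  · exact Primrec.nat_mul.comp Primrec.fst (Primrec.succ.comp (Primrec.snd.comp Primrec.snd))
  · induction j with
    | zero => rfl
    | succ j ih => simp only [treeSize, ← ih]

theorem primrec_matrixAtomCode : Primrec₂ Formula.matrixAtomCode := by
  have hn : Primrec fun p : List ℕ × ℕ => p.2.unpair := Primrec.unpair.comp Primrec.snd
  have h1 : Primrec fun p : List ℕ × ℕ => p.2.unpair.2.unpair.1 :=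
    Primrec.fst.comp (Primrec.unpair.comp (Primrec.snd.comp hn))
  have h2 : Primrec fun p : List ℕ × ℕ => p.2.unpair.2.unpair.2 :=
    Primrec.snd.comp (Primrec.unpair.comp (Primrec.snd.comp hn))
  refine Primrec.ite (Primrec.eq.comp (Primrec.fst.comp hn) (Primrec.const 0)) ?_ ?_
  · refine Primrec₂.natPair.comp (Primrec.const 0) (Primrec₂.natPair.comp
      (Primrec.nat_mul.comp (Primrec.const 2) h1) (Primrec.encode.comp (Primrec.list_map
        ((Primrec.ofNat (List ℕ)).comp h2) ?_)))
    exact Primrec.succ.comp (primrec_level.comp (Primrec.fst.comp Primrec.fst) Primrec.snd)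
  · exact Primrec₂.natPair.comp (Primrec.const 1) (Primrec₂.natPair.comp
      (Primrec.succ.comp (primrec_level.comp Primrec.fst h1))
      (Primrec.succ.comp (primrec_level.comp Primrec.fst h2)))

theorem primrec_matrixCode (q : ℕ) : Primrec₂ (Formula.matrixCode q) := by
  have hn : Primrec fun p : (List ℕ × (ℕ × ℕ)) × ℕ => p.2.unpair :=
    Primrec.unpair.comp Primrec.snd
  have henv : Primrec fun p : (List ℕ × (ℕ × ℕ)) × ℕ => p.1.1 := Primrec.fst.comp Primrec.fst
  refine primrec_codeRec ?_ ?_ ?_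
  · refine Primrec.ite (Primrec.eq.comp (Primrec.fst.comp hn) (Primrec.const 2)) ?_ ?_
    · exact Primrec₂.natPair.comp (Primrec.const 2)
        (primrec_matrixAtomCode.comp henv (Primrec.snd.comp hn))
    · exact primrec_matrixAtomCode.comp henv Primrec.snd
  · exact (Formula.primrec_nextEnv.comp henv Primrec.snd).pair (Primrec.snd.comp Primrec.fst)
  · have ht : Primrec fun x : ((List ℕ × (ℕ × ℕ)) × ℕ) × (ℕ × ℕ) => x.1.2.unpair.1 :=
      Primrec.fst.comp (hn.comp Primrec.fst)
    have hl : Primrec fun x : ((List ℕ × (ℕ × ℕ)) × ℕ) × (ℕ × ℕ) => x.1.1.1.length :=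
      Primrec.list_length.comp (henv.comp Primrec.fst)
    have ha : Primrec fun x : ((List ℕ × (ℕ × ℕ)) × ℕ) × (ℕ × ℕ) => x.2.1 :=
      Primrec.fst.comp Primrec.snd
    have hb : Primrec fun x : ((List ℕ × (ℕ × ℕ)) × ℕ) × (ℕ × ℕ) => x.2.2 :=
      Primrec.snd.comp Primrec.snd
    have hdig : Primrec fun x : ((List ℕ × (ℕ × ℕ)) × ℕ) × (ℕ × ℕ) =>
        digits x.1.1.2.1 (q - 1) x.1.1.2.2 x.1.1.1.length :=
      (primrec_digits (q - 1)).comp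
        ((Primrec.snd.comp (Primrec.fst.comp Primrec.fst)).pair hl)
    have hpos : Primrec fun x : ((List ℕ × (ℕ × ℕ)) × ℕ) × (ℕ × ℕ) =>
        Formula.positionCode x.1.1.1 x.1.2 :=
      Primrec.encode.comp ((henv.comp Primrec.fst).pair (Primrec.snd.comp Primrec.fst))
    refine Primrec.ite (Primrec.eq.comp ht (Primrec.const 3)) (Primrec.ite
      (Primrec.nat_lt.comp hl (Primrec.const q)) (Primrec.ite ?_ ha hb) ?_)
      (Primrec.ite (Primrec.eq.comp ht (Primrec.const 5)) hb ?_)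
    · exact Primrec.eq.comp (Primrec.nat_mod.comp (Primrec.nat_div.comp hdig
        (primrec_pow.comp (Primrec.const 2) hpos)) (Primrec.const 2)) (Primrec.const 1)
    · exact Primrec₂.natPair.comp (Primrec.const 3) (Primrec₂.natPair.comp ha hb)
    · exact Primrec₂.natPair.comp (Primrec.const 4) (Primrec₂.natPair.comp ha hb)

end Computability

/-- The edges of the complete forest, in both directions. -/
def forestEdges (M n : ℕ) : List (ℕ × ℕ) :=
  (List.range (n + 1)).flatMap fun u =>
    if M ≤ u then [(u, parent M u), (parent M u, u)] else []

/-- The tuples corresponding to a list of pairs. -/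
def pairTuples (l : List (ℕ × ℕ)) : List (List ℕ) := l.map fun p => [p.1, p.2]

theorem mem_forestEdges {M n : ℕ} (hM : 0 < M) (u v : Fin (n + 1)) :
    ((u : ℕ), (v : ℕ)) ∈ forestEdges M n ↔ (completeForest M n).Adj u v := by
  simp only [forestEdges, List.mem_flatMap, List.mem_range]
  constructor
  · rintro ⟨x, hx, h⟩
    split_ifs at h with hMx
    · have hlt := parent_lt hM hMx
      simp only [List.mem_cons, Prod.mk.injEq, List.not_mem_nil, or_false] at h
      rcases h with ⟨h1, h2⟩ | ⟨h1, h2⟩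
      · refine ⟨fun h => ?_, Or.inl ⟨by omega, by rw [h2, h1]⟩⟩
        subst h
        omega
      · refine ⟨fun h => ?_, Or.inr ⟨by omega, by rw [h2, h1]⟩⟩
        subst h
        omega
    · simp at h
  · rintro ⟨-, ⟨hMu, h⟩ | ⟨hMv, h⟩⟩
    · exact ⟨u, u.2, by simp [hMu, h]⟩
    · exact ⟨v, v.2, by simp [hMv, h]⟩

theorem mem_pairTuples {l : List (ℕ × ℕ)} {u v : ℕ} : [u, v] ∈ pairTuples l ↔ (u, v) ∈ l := by
  simp [pairTuples]

theorem primrec_forestEdges : Primrec₂ forestEdges := by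
  have hu : Primrec fun x : (ℕ × ℕ) × ℕ => parent x.1.1 x.2 :=
    primrec_parent.comp (Primrec.fst.comp Primrec.fst) Primrec.snd
  refine Primrec.list_flatMap (Primrec.list_range.comp (Primrec.succ.comp Primrec.snd)) ?_
  refine Primrec.ite (c := fun x : (ℕ × ℕ) × ℕ => x.1.1 ≤ x.2)
    (Primrec.nat_le.comp (Primrec.fst.comp Primrec.fst) Primrec.snd) ?_ (Primrec.const [])
  exact Primrec.list_cons.comp (Primrec.snd.pair hu)
    (Primrec.list_cons.comp (hu.pair Primrec.snd) (Primrec.const []))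

theorem primrec_pairTuples : Primrec pairTuples := by
  refine Primrec.list_map Primrec.id ?_
  exact Primrec.list_cons.comp (Primrec.fst.comp Primrec.snd)
    (Primrec.list_cons.comp (Primrec.snd.comp Primrec.snd) (Primrec.const []))

/-- The description of `F*` for the complete forest `F`. -/
def forestCode (M n : ℕ) : StrCode :=
  starCode n n (pairTuples (forestEdges M n)) (fun i => [[i]]) []

theorem forestCode_isIso {M n : ℕ} (hM : 0 < M) :
    IsIso (forestCode M n).toStr (starGraph (completeForest M n)) := by
  refine ⟨starCode_voc.trans (by simp [starGraph, starVoc]), Equiv.refl (Fin (n + 1)), ?_⟩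
  intro R x
  have hrel : (forestCode M n).toStr.rel R x ↔
      ∃ T, (R, T) ∈ (forestCode M n).2 ∧ List.ofFn (fun i => (x i : Fin (n + 1)).val) ∈ T :=
    Iff.rfl
  rw [hrel]
  constructor
  · rintro ⟨T, hT, h⟩
    rcases List.mem_cons.1 hT with hT | hT
    · simp only [Prod.mk.injEq] at hT
      obtain ⟨rfl, rfl⟩ := hT
      have h' : [Fin.val (n := n + 1) (x (0 : Fin 2)), Fin.val (n := n + 1) (x (1 : Fin 2))] ∈
        pairTuples (forestEdges M n) := h
      exact Or.inl ⟨_, _, (mem_forestEdges hM _ _).1 (mem_pairTuples.1 h'), rfl, rfl⟩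
    · simp only [List.append_nil, List.mem_map, List.mem_range, Prod.mk.injEq] at hT
      obtain ⟨i, hi, rfl, rfl⟩ := hT
      have h' : [Fin.val (n := n + 1) (x (0 : Fin 1))] ∈ [[i]] := h
      simp only [List.mem_singleton, List.cons.injEq, and_true] at h'
      exact Or.inr ⟨x (0 : Fin 1), congrArg colorSym h'.symm, rfl⟩
  · rintro (⟨i, j, hij, rfl, hx⟩ | ⟨i, rfl, hx⟩)
    · have h0 : x = fun k => if k.val = 0 then i else j := List.ofFn_injective (hx.trans rfl)
      subst h0
      exact ⟨_, List.mem_cons_self, mem_pairTuples.2 ((mem_forestEdges hM i j).2 hij)⟩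
    · refine ⟨[[(i : ℕ)]], List.mem_cons_of_mem _ (List.mem_append_left _
        (List.mem_map.2 ⟨i, List.mem_range.2 i.2, rfl⟩)), ?_⟩
      have h0 : x = fun _ => i := List.ofFn_injective (hx.trans rfl)
      subst h0
      exact List.mem_singleton_self _

/-- The symbol of the relation that holds for the edges whose ends are both on level `i` or
below, the roots being on level `0`; such edges are those that
require the entries with index `i` to be equal. -/
def levelSym (i : ℕ) : Sym := (i + 1, 2)

/-- The part of the edges of the complete forest with both ends on level `i` or below. -/
def levelEdges (M n i : ℕ) : List (ℕ × ℕ) :=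
  (forestEdges M n).flatMap fun p => if treeSize M i ≤ min p.1 p.2 then [p] else []

/-- The coloured complete forest, expanded by the relations `levelSym i`, together with an isolated
element `n + 1` that has a loop (the sentence `forestFormula` requires that there is one). -/
def gameCode (q M n : ℕ) : StrCode :=
  starCode (n + 1) n (pairTuples (forestEdges M n) ++ [[n + 1, n + 1]]) (fun i => [[i]])
    ((List.range q).map fun i => (levelSym i, pairTuples (levelEdges M n i)))

section GameCode

variable {q M n : ℕ}

theorem mem_levelEdges {i u v : ℕ} : (u, v) ∈ levelEdges M n i ↔
    (u, v) ∈ forestEdges M n ∧ treeSize M i ≤ u ∧ treeSize M i ≤ v := by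
  simp only [levelEdges, List.mem_flatMap]
  constructor
  · rintro ⟨p, hp, h⟩
    split_ifs at h with hmin
    · rw [List.mem_singleton] at h
      subst h
      exact ⟨hp, le_min_iff.1 hmin⟩
    · simp at h
  · rintro ⟨h, h1, h2⟩
    exact ⟨_, h, by simp [h1, h2]⟩

theorem primrec_gameCode (q : ℕ) : Primrec₂ (gameCode q) := by
  have hf : Primrec fun x : ℕ × ℕ => forestEdges x.1 x.2 := primrec_forestEdges
  refine primrec_starCode (Primrec.succ.comp Primrec.snd) Primrec.snd ?_ ?_ ?_
  · refine Primrec.list_append.comp (primrec_pairTuples.comp hf) ?_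
    have hs : Primrec fun x : ℕ × ℕ => x.2 + 1 := Primrec.succ.comp Primrec.snd
    exact Primrec.list_cons.comp (Primrec.list_cons.comp hs
      (Primrec.list_cons.comp hs (Primrec.const []))) (Primrec.const [])
  · exact Primrec.list_cons.comp (Primrec.list_cons.comp Primrec.snd (Primrec.const []))
      (Primrec.const [])
  · refine Primrec.list_map (Primrec.const _) (Primrec.pair ?_ (primrec_pairTuples.comp ?_))
    · exact (Primrec.succ.comp Primrec.snd).pair (Primrec.const 2)
    · refine Primrec.list_flatMap (hf.comp Primrec.fst) ?_
      refine Primrec.ite (c := fun x : ((ℕ × ℕ) × ℕ) × (ℕ × ℕ) =>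
        treeSize x.1.1.1 x.1.2 ≤ min x.2.1 x.2.2) (Primrec.nat_le.comp ?_ ?_) ?_
        (Primrec.const [])
      · exact primrec_treeSize.comp (Primrec.fst.comp (Primrec.fst.comp Primrec.fst))
          (Primrec.snd.comp Primrec.fst)
      · exact Primrec.nat_min.comp (Primrec.fst.comp Primrec.snd) (Primrec.snd.comp Primrec.snd)
      · exact Primrec.list_cons.comp Primrec.snd (Primrec.const [])

theorem levelSym_mem_gameCode_voc {i : ℕ} (hi : i < q) :
    levelSym i ∈ (gameCode q M n).toStr.voc := by
  rw [gameCode, starCode_voc]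
  simp only [List.map_map, Finset.mem_union, List.mem_toFinset, List.mem_map, List.mem_range]
  exact Or.inr ⟨i, hi, rfl⟩

theorem starVoc_subset_gameCode_voc : starVoc n ⊆ (gameCode q M n).toStr.voc := by
  rw [gameCode, starCode_voc]
  exact Finset.subset_union_left

theorem gameCode_voc_arity : ∀ R ∈ (gameCode q M n).toStr.voc, Arity.ar R ≠ 0 := by
  intro R hR
  rw [gameCode, starCode_voc, starVoc] at hR
  simp only [Finset.mem_union, Finset.mem_insert, Finset.mem_image, List.mem_toFinset,
    List.mem_map] at hR
  rcases hR with (rfl | ⟨i, -, rfl⟩) | ⟨-, ⟨i, -, rfl⟩, rfl⟩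
  exacts [two_ne_zero, one_ne_zero, two_ne_zero]

theorem gameCode_edge_iff {a b : Fin (n + 1 + 1)} : (gameCode q M n).toStr.Edge a b ↔
    ((a : ℕ), (b : ℕ)) ∈ forestEdges M n ∨ ((a : ℕ) = n + 1 ∧ (b : ℕ) = n + 1) := by
  refine (starCode_edge_iff (m := n + 1) ?_).trans ?_
  · simp only [List.mem_map, forall_exists_index, and_imp]
    rintro p i - rfl h
    exact absurd (congrArg Prod.fst h) (by simp [levelSym, edgeSym])
  · simp [mem_pairTuples]

theorem gameCode_color_iff {i : ℕ} (hi : i ≤ n) {a : Fin (n + 1 + 1)} :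
    (gameCode q M n).toStr.Color i a ↔ (a : ℕ) = i := by
  refine (starCode_color_iff (m := n + 1) ?_).trans ?_
  · simp only [List.mem_map, forall_exists_index, and_imp]
    rintro p i - rfl h
    exact absurd h (by simp [levelSym])
  · simp [hi]

theorem gameCode_levelSym_iff {i : ℕ} (hi : i < q) {a b : Fin (n + 1 + 1)} :
    (gameCode q M n).toStr.rel (levelSym i) (fun k => if k.val = 0 then a else b) ↔
      ((a : ℕ), (b : ℕ)) ∈ forestEdges M n ∧ treeSize M i ≤ a ∧ treeSize M i ≤ b := by
  rw [← mem_levelEdges, ← mem_pairTuples]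
  constructor
  · rintro ⟨T, hT, h⟩
    rcases List.mem_cons.1 hT with hT | hT
    · exact absurd (congrArg (fun p => p.1.1) hT) (by simp [levelSym, edgeSym])
    · rcases List.mem_append.1 hT with hT | hT
      · obtain ⟨j, -, hj⟩ := List.mem_map.1 hT
        exact absurd (congrArg (fun p => p.1.2) hj) (by simp [levelSym, colorSym])
      · obtain ⟨j, -, hj⟩ := List.mem_map.1 hT
        simp only [levelSym, Prod.mk.injEq, and_true, Nat.add_right_cancel_iff] at hj
        obtain ⟨rfl, rfl⟩ := hj
        exact h
  · exact fun h => ⟨_, List.mem_cons_of_mem _ (List.mem_append_right _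
      (List.mem_map.2 ⟨i, List.mem_range.2 hi, rfl⟩)), h⟩

end GameCode

namespace Formula

/-- The formula for the universe: the first component is a node, the others are elements of the
given structure. -/
def gameUniv (q : ℕ) : Formula PairSym :=
  conj (rel (Sum.inr false) (fun _ => 0))
    ((List.range q).map fun i => rel (Sum.inr true) (fun _ => i + 1))

/-- The formula for the edges: the nodes are adjacent, and the entries that belong to common
ancestors are equal. -/
def gameEdge (q : ℕ) : Formula PairSym :=
  conj (rel (Sum.inl edgeSym) (fun k => if k.val = 0 then 0 else q + 1))
    ((List.range q).map fun i => or
      (neg (rel (Sum.inl (levelSym i)) (fun k => if k.val = 0 then 0 else q + 1)))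
      (eq (i + 1) (q + 1 + (i + 1))))

/-- The formula for the colour `C_u`: the node is `u`, and if this is a leaf, then the entries
form a play that is won by the second player. -/
def gameColor (q M : ℕ) (φ : Formula Sym) (u : ℕ) : Formula PairSym :=
  and (rel (Sum.inl (colorSym u)) (fun _ => 0))
    (if treeSize M (q - 1) ≤ u then matrix q (digits M (q - 1) u) [] φ else eq 0 0)

/-- The branching number of the game for a sentence. -/
def branching (φ : Formula Sym) : ℕ := 2 ^ positionBound [] φ.code

theorem branching_pos (φ : Formula Sym) : 0 < branching φ := Nat.two_pow_pos _

end Formula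

open Formula in
/-- The interpretation that maps a structure `A`, together with the structure `gameCode`, to a
coloured graph to which the complete forest maps iff the sentence `φ` is true in `A`. -/
def gameInterp (q M n : ℕ) {r : ℕ} (φ : {φ : Formula Sym // Admissible false r q [] φ}) :
    Interp PairSym :=
  starInterp (q + 1) n (gameUniv q) (gameEdge q) (gameColor q M φ.1)
    (by
      intro x hx
      rcases mem_freeVars_conj.1 hx with hx | ⟨ψ, hψ, hx⟩
      · obtain ⟨i, -, rfl⟩ := Finset.mem_image.1 hx
        simp
      · obtain ⟨i, hi, rfl⟩ := List.mem_map.1 hψ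
        have := List.mem_range.1 hi
        obtain ⟨j, -, rfl⟩ := Finset.mem_image.1 hx
        exact Finset.mem_range.2 (by omega))
    (by
      have hr : ∀ (R : PairSym) (x : ℕ),
          x ∈ (rel R (fun k => if k.val = 0 then 0 else q + 1)).freeVars →
            x < 2 * (q + 1) := by
        intro R x hx
        obtain ⟨i, -, rfl⟩ := Finset.mem_image.1 hx
        split_ifs <;> omega
      intro x hx
      rw [Finset.mem_range]
      rcases mem_freeVars_conj.1 hx with hx | ⟨ψ, hψ, hx⟩
      · exact hr _ x hx
      · obtain ⟨i, hi, rfl⟩ := List.mem_map.1 hψ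
        have := List.mem_range.1 hi
        rcases Finset.mem_union.1 hx with hx | hx
        · exact hr _ x hx
        · simp only [freeVars, Finset.mem_insert, Finset.mem_singleton] at hx
          omega)
    (by
      intro u
      refine Finset.union_subset ?_ ?_
      · intro x hx
        obtain ⟨i, -, rfl⟩ := Finset.mem_image.1 hx
        simp
      · split_ifs
        · exact matrix_freeVars (Nat.zero_le _) φ.2
        · simp [freeVars])

section GameInterp

variable {q M n r : ℕ} {φ : {φ : Formula Sym // Formula.Admissible false r q [] φ}}

theorem gameInterp_isQuantifierFree : (gameInterp q M n φ).IsQuantifierFree := by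
  refine starInterp_isQuantifierFree ?_ ?_ ?_
  · refine Formula.isQuantifierFree_conj.2 ⟨trivial, fun ψ hψ => ?_⟩
    obtain ⟨i, -, rfl⟩ := List.mem_map.1 hψ
    trivial
  · refine Formula.isQuantifierFree_conj.2 ⟨trivial, fun ψ hψ => ?_⟩
    obtain ⟨i, -, rfl⟩ := List.mem_map.1 hψ
    exact ⟨trivial, trivial⟩
  · intro u
    refine ⟨trivial, ?_⟩
    split_ifs
    exacts [Formula.matrix_isQuantifierFree _ _, trivial]

/-- The code of `gameColor`, computed from the branching number, the code of the sentence, and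
a node. -/
theorem primrec_code_gameColor (q r : ℕ) : ∃ f : (ℕ × ℕ) × ℕ → ℕ, Primrec f ∧
    ∀ (M u : ℕ) (φ : Formula Sym), Formula.Admissible false r q [] φ →
      f ((M, φ.code), u) = (Formula.gameColor q M φ u).code := by
  refine ⟨fun x => Nat.pair 3 (Nat.pair
    (Nat.pair 0 (Nat.pair (Encodable.encode (Sum.inl (colorSym x.2) : PairSym))
      (Encodable.encode [0])))
    (if treeSize x.1.1 (q - 1) ≤ x.2 then Formula.matrixCode q ([], (x.1.1, x.2)) x.1.2
      else (Formula.eq (S := PairSym) 0 0).code)), ?_, ?_⟩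
  · have hM : Primrec fun x : (ℕ × ℕ) × ℕ => x.1.1 := Primrec.fst.comp Primrec.fst
    refine Primrec₂.natPair.comp (Primrec.const 3) (Primrec₂.natPair.comp
      (Primrec₂.natPair.comp (Primrec.const 0) (Primrec₂.natPair.comp
        (Primrec.encode.comp (Primrec.sumInl.comp
          (Formula.primrec_colorSym.comp Primrec.snd))) (Primrec.const _)))
      (Primrec.ite (Primrec.nat_le.comp (primrec_treeSize.comp hM (Primrec.const _))
        Primrec.snd) ?_ (Primrec.const _)))
    exact (primrec_matrixCode q).comp ((Primrec.const []).pair (hM.pair Primrec.snd))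
      (Primrec.snd.comp Primrec.fst)
  · intro M u φ hφ
    simp only [Formula.gameColor, Formula.code_matrix hφ, Formula.code]
    split_ifs <;> rfl

theorem primrec_code_gameInterp {α : Type*} [Primcodable α] (q r : ℕ) {M n : α → ℕ}
    {φ : α → {φ : Formula Sym // Formula.Admissible false r q [] φ}} (hM : Primrec M)
    (hn : Primrec n) (hφ : Primrec fun a => (φ a).1.code) :
    Primrec fun a => (gameInterp q (M a) (n a) (φ a)).code := by
  obtain ⟨f, hf, hf'⟩ := primrec_code_gameColor q r
  refine primrec_code_starInterp (q + 1) hn ?_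
  refine (hf.comp (((hM.comp Primrec.fst).pair (hφ.comp Primrec.fst)).pair
    Primrec.snd)).of_eq fun x => ?_
  exact hf' _ _ _ (φ x.1).2

variable {A : Str Sym}

/-- The tuple consisting of a node and a play. -/
def gameElt {C D : Type} (t : C) (a : Fin q → D) : Fin (q + 1) → C ⊕ D :=
  Fin.cons (Sum.inl t) (fun i => Sum.inr (a i))

theorem mem_gameInterp_univSet {G : Str Sym} {x : Fin (q + 1) → (pair G A).carrier} :
    x ∈ (gameInterp q M n φ).univSet (pair G A) ↔
      ∃ (t : G.carrier) (a : Fin q → A.carrier), x = gameElt t a := by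
  have := (pair G A).nonempty
  have h0 : tupleAssign (fun _ : Fin 1 => x) 0 = x 0 := tupleAssign_one x 0
  have hs : ∀ i : Fin q, tupleAssign (fun _ : Fin 1 => x) (i + 1) = x i.succ := fun i =>
    tupleAssign_one x i.succ
  have hiff : x ∈ (gameInterp q M n φ).univSet (pair G A) ↔
      (∃ t : G.carrier, x 0 = Sum.inl t) ∧ ∀ i : Fin q, ∃ a : A.carrier, x i.succ = Sum.inr a := by
    refine Formula.sat_conj.trans (and_congr ?_ ?_)
    · constructor
      · rintro ⟨t, ht⟩
        exact ⟨t, h0.symm.trans (congrFun ht (0 : Fin 1))⟩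
      · rintro ⟨t, ht⟩
        exact ⟨t, funext fun _ => h0.trans ht⟩
    · simp only [List.mem_map, List.mem_range, forall_exists_index, and_imp,
        forall_apply_eq_imp_iff₂]
      refine forall_lt_iff_fin.trans (forall_congr' fun i => ?_)
      constructor
      · rintro ⟨t, ht⟩
        exact ⟨t, (hs i).symm.trans (congrFun ht (0 : Fin 1))⟩
      · rintro ⟨t, ht⟩
        exact ⟨t, funext fun _ => (hs i).trans ht⟩
  rw [hiff]
  constructor
  · rintro ⟨⟨t, ht⟩, h⟩
    choose a ha using h
    refine ⟨t, a, funext fun j => ?_⟩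
    refine Fin.cases ht (fun i => ?_) j
    exact ha i
  · rintro ⟨t, a, rfl⟩
    exact ⟨⟨t, rfl⟩, fun i => ⟨a i, rfl⟩⟩

theorem gameInterp_definedOn (hA : A.voc = φ.1.voc) :
    (gameInterp q M n φ).DefinedOn (pair (gameCode q M n).toStr A) := by
  have hsub : ∀ R ∈ (gameCode q M n).toStr.voc,
      Sum.inl R ∈ (pair (gameCode q M n).toStr A).voc := fun R hR =>
    Finset.mem_union_left _ (Finset.mem_image_of_mem _ (Finset.mem_union_left _ hR))
  have hP : ∀ b, Sum.inr b ∈ (pair (gameCode q M n).toStr A).voc := by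
    intro b
    cases b <;> exact Finset.mem_union_right _ (by simp)
  refine starInterp_definedOn ?_ ?_ ?_ ?_
  · intro R hR
    rcases Formula.mem_voc_conj.1 hR with hR | ⟨ψ, hψ, hR⟩
    · rw [Finset.mem_singleton.1 hR]
      exact hP _
    · obtain ⟨i, -, rfl⟩ := List.mem_map.1 hψ
      rw [Finset.mem_singleton.1 hR]
      exact hP _
  · intro R hR
    rcases Formula.mem_voc_conj.1 hR with hR | ⟨ψ, hψ, hR⟩
    · rw [Finset.mem_singleton.1 hR]
      exact hsub _ (starVoc_subset_gameCode_voc (Finset.mem_insert_self _ _))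
    · obtain ⟨i, hi, rfl⟩ := List.mem_map.1 hψ
      rcases Finset.mem_union.1 hR with hR | hR
      · rw [Finset.mem_singleton.1 hR]
        exact hsub _ (levelSym_mem_gameCode_voc (List.mem_range.1 hi))
      · exact absurd hR (Finset.notMem_empty _)
  · intro u hu R hR
    rcases Finset.mem_union.1 hR with hR | hR
    · rw [Finset.mem_singleton.1 hR]
      exact hsub _ (starVoc_subset_gameCode_voc (colorSym_mem_starVoc hu))
    · split_ifs at hR
      · refine Finset.mem_union_left _ (Finset.image_subset_image ?_ (Formula.matrix_voc _ _ hR))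
        rw [← hA]
        exact Finset.subset_union_right
      · exact absurd hR (Finset.notMem_empty _)
  · have := A.nonempty
    exact ⟨gameElt (0 : Fin (n + 1 + 1)) fun _ => Classical.arbitrary _,
      mem_gameInterp_univSet.2 ⟨_, _, rfl⟩⟩

/-- The element of the interpreted structure given by a node and a play. -/
def toGame {G : Str Sym} (t : G.carrier) (a : Fin q → A.carrier) :
    (gameInterp q M n φ).univSet (pair G A) :=
  ⟨gameElt t a, mem_gameInterp_univSet.2 ⟨t, a, rfl⟩⟩

theorem exists_eq_toGame {G : Str Sym} (x : (gameInterp q M n φ).univSet (pair G A)) :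
    ∃ (t : G.carrier) (a : Fin q → A.carrier), x = toGame t a := by
  obtain ⟨t, a, h⟩ := mem_gameInterp_univSet.1 x.2
  exact ⟨t, a, Subtype.ext h⟩

variable (h : (gameInterp q M n φ).DefinedOn (pair (gameCode q M n).toStr A))

theorem gameInterp_color_iff {u : ℕ} (hu : u ≤ n) (t : Fin (n + 1 + 1)) (a : Fin q → A.carrier)
    (X : ℕ → A.carrier) (hX : ∀ i : Fin q, X i = a i) :
    ((gameInterp q M n φ).apply _ h).Color u
        (toGame (G := (gameCode q M n).toStr) t a) ↔
      (t : ℕ) = u ∧ (treeSize M (q - 1) ≤ u →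
        Formula.Eval A q (digits M (q - 1) u) X [] φ.1) := by
  have := (pair (gameCode q M n).toStr A).nonempty
  refine (starInterp_apply_color h hu _).trans (and_congr ?_ ?_)
  · refine (iff_of_eq (congrArg _ (funext fun _ => ?_))).trans
      ((pair_rel_inl_iff (A := (gameCode q M n).toStr) (R := colorSym u) (a := fun _ => t)
        Nat.one_pos).trans (gameCode_color_iff hu))
    exact tupleAssign_one _ (0 : Fin (q + 1))
  · split_ifs with hle
    · simp only [hle, true_imp_iff]
      refine Formula.sat_matrix gameCode_voc_arity (fun i hi => ?_) (Nat.zero_le _) φ.2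
      refine (tupleAssign_one _ (Fin.succ ⟨i, hi⟩)).trans ?_
      show Sum.inr (a ⟨i, hi⟩) = _
      rw [← hX]
    · simp [hle, Formula.Sat]

theorem gameInterp_edge_iff (t t' : Fin (n + 1 + 1)) (a a' : Fin q → A.carrier) :
    ((gameInterp q M n φ).apply _ h).Edge (toGame (G := (gameCode q M n).toStr) t a)
        (toGame (G := (gameCode q M n).toStr) t' a') ↔
      (gameCode q M n).toStr.Edge t t' ∧ ∀ i : Fin q,
        ((t : ℕ), (t' : ℕ)) ∈ forestEdges M n ∧ treeSize M i ≤ t ∧ treeSize M i ≤ t' →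
          a i = a' i := by
  have := (pair (gameCode q M n).toStr A).nonempty
  refine (starInterp_apply_edge h _ _).trans (Formula.sat_conj.trans ?_)
  set v := tupleAssign (fun i : Fin 2 => if i.val = 0 then
    (toGame (G := (gameCode q M n).toStr) t a : (gameInterp q M n φ).univSet _).1 else
    (toGame (G := (gameCode q M n).toStr) t' a' : (gameInterp q M n φ).univSet _).1) with hv
  have h0 : v 0 = Sum.inl t := tupleAssign_two_left _ (0 : Fin (q + 1))
  have h1 : v (q + 1) = Sum.inl t' := tupleAssign_two_right _ (0 : Fin (q + 1))
  have h2 : ∀ i : Fin q, v (i + 1) = Sum.inr (a i) := fun i => tupleAssign_two_left _ i.succ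
  have h3 : ∀ i : Fin q, v (q + 1 + (i + 1)) = Sum.inr (a' i) := fun i =>
    tupleAssign_two_right _ i.succ
  have hpair : (fun k : Fin 2 => v (if k.val = 0 then 0 else q + 1)) =
      fun k => Sum.inl (if k.val = 0 then t else t') := by
    funext k
    split_ifs
    exacts [h0, h1]
  refine and_congr ?_ ?_
  · refine (iff_of_eq (congrArg _ hpair)).trans ?_
    exact pair_rel_inl_iff (A := (gameCode q M n).toStr) (R := edgeSym) two_pos
  · simp only [List.mem_map, List.mem_range, forall_exists_index, and_imp,
      forall_apply_eq_imp_iff₂]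
    refine forall_lt_iff_fin.trans (forall_congr' fun i => ?_)
    have hl : Formula.Sat (pair (gameCode q M n).toStr A) v (Formula.rel (Sum.inl (levelSym i))
        (fun k => if k.val = 0 then 0 else q + 1)) ↔
        ((t : ℕ), (t' : ℕ)) ∈ forestEdges M n ∧ treeSize M i ≤ t ∧ treeSize M i ≤ t' := by
      refine (iff_of_eq (congrArg _ hpair)).trans ?_
      exact (pair_rel_inl_iff (A := (gameCode q M n).toStr) (R := levelSym i) two_pos).trans
        (gameCode_levelSym_iff i.2)
    have he : Formula.Sat (pair (gameCode q M n).toStr A) v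
        (Formula.eq (i + 1) (q + 1 + (i + 1))) ↔ a i = a' i := by
      show v (i + 1) = v (q + 1 + (i + 1)) ↔ _
      rw [h2, h3]
      exact Sum.inr_injective.eq_iff
    refine (or_congr (not_congr hl) he).trans ?_
    rw [← imp_iff_not_or]
    simp only [and_imp]

theorem exists_loop_game : ∃ b, ((gameInterp q M n φ).apply _ h).Edge b b := by
  have := A.nonempty
  refine ⟨toGame (G := (gameCode q M n).toStr) (Fin.last (n + 1))
    (fun _ => Classical.arbitrary _), ?_⟩
  rw [gameInterp_edge_iff]
  exact ⟨gameCode_edge_iff.2 (Or.inr ⟨rfl, rfl⟩), fun _ _ => rfl⟩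

/-- The complete forest maps to the interpreted structure iff the sentence is true. -/
theorem colorHom_game_iff (hq : 1 ≤ q) (hM : M = Formula.branching φ.1)
    (hn : n + 1 = treeSize M q) :
    ColorHom (completeForest M n) ((gameInterp q M n φ).apply _ h) ↔
      Formula.Holds A φ.1 := by
  have hne := A.nonempty
  have hM0 : 0 < M := hM ▸ Formula.branching_pos _
  rw [Formula.holds_iff_gameWon φ.2 (fun _ => 0) (fun _ => Classical.arbitrary A.carrier)]
  have hMeq : 2 ^ Formula.positionBound [] φ.1.code = M := hM.symm
  rw [hMeq, ← exists_labelling_iff hq hM0 fun S S' X X' hS hX =>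
    (Formula.eval_congr hS hX (Nat.zero_le _) φ.2).1]
  constructor
  · rintro ⟨f, hfc, hfe⟩
    choose t a hta using fun u => exists_eq_toGame (f u)
    let α : ℕ → ℕ → A.carrier := fun u i =>
      if hu : u < n + 1 ∧ i < q then a ⟨u, hu.1⟩ ⟨i, hu.2⟩ else Classical.arbitrary _
    have hα : ∀ (u : Fin (n + 1)) (i : Fin q), α u i = a u i := fun u i =>
      dif_pos ⟨u.2, i.2⟩
    have hcol : ∀ u : Fin (n + 1), Fin.val (n := n + 1 + 1) (t u) = u ∧
        (treeSize M (q - 1) ≤ u → Formula.Eval A q (digits M (q - 1) u) (α u) [] φ.1) := by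
      intro u
      have := hfc u
      rw [hta u] at this
      exact (gameInterp_color_iff h (Nat.le_of_lt_succ u.2) (t u) (a u) (α u) (hα u)).1 this
    refine ⟨α, fun u hu hMu i hi => ?_, fun u hu hleaf => (hcol ⟨u, by omega⟩).2 hleaf⟩
    have hpar := parent_lt hM0 hMu
    have hiq : i < q := (treeSize_strictMono hM0).lt_iff_lt.1 (hi.trans_lt (hpar.trans hu))
    let u' : Fin (n + 1) := ⟨u, by omega⟩
    let p' : Fin (n + 1) := ⟨parent M u, by omega⟩
    have hadj : (completeForest M n).Adj u' p' :=
      ⟨fun h => hpar.ne' (congrArg Fin.val h), Or.inl ⟨hMu, rfl⟩⟩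
    have he := hfe u' p' hadj
    rw [hta u', hta p'] at he
    have he' := ((gameInterp_edge_iff h (t u') (t p') (a u') (a p')).1 he).2 ⟨i, hiq⟩
    rw [(hcol u').1, (hcol p').1] at he'
    have heq := he' ⟨(mem_forestEdges hM0 u' p').2 hadj, hi.trans hpar.le, hi⟩
    rw [← hα, ← hα] at heq
    exact heq
  · rintro ⟨α, hα, hleaf⟩
    refine ⟨fun u => toGame (G := (gameCode q M n).toStr) (Fin.castSucc u) (fun i => α u i),
      fun u => ?_, fun u v huv => ?_⟩
    · refine (gameInterp_color_iff h (Nat.le_of_lt_succ u.2) (Fin.castSucc u) _ (α u)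
        (fun _ => rfl)).2 ⟨rfl, fun hl => hleaf u (hn ▸ u.2) hl⟩
    · refine (gameInterp_edge_iff h (Fin.castSucc u) (Fin.castSucc v) _ _).2 ⟨?_, ?_⟩
      · exact gameCode_edge_iff.2 (Or.inl ((mem_forestEdges hM0 u v).2 huv))
      · rintro i ⟨-, h1, h2⟩
        obtain ⟨-, ⟨hMu, hv⟩ | ⟨hMv, hu⟩⟩ := huv
        · have := hα u (hn ▸ u.2) hMu i (hv ▸ h2)
          rwa [← hv] at this
        · have := hα v (hn ▸ v.2) hMv i (hu ▸ h1)
          rw [← hu] at this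
          exact this.symm

end GameInterp

/-! ### The reductions of model checking problems -/

theorem primrec_forestCode : Primrec₂ forestCode := by
  refine primrec_starCode Primrec.snd Primrec.snd
    (primrec_pairTuples.comp (primrec_forestEdges : Primrec fun x : ℕ × ℕ => _)) ?_
    (Primrec.const [])
  exact Primrec.list_cons.comp (Primrec.list_cons.comp Primrec.snd (Primrec.const []))
    (Primrec.const [])

namespace Formula

/-- An existential sentence in the empty vocabulary that is false in all structures. -/
def falseSentence : Formula Sym := ex 0 (neg (eq 0 0))

theorem not_holds_falseSentence (A : Str Sym) : ¬ Holds A falseSentence := by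
  intro h
  have := A.nonempty
  obtain ⟨a, ha⟩ := h fun _ => Classical.arbitrary _
  exact ha rfl

open Classical in
/-- The sentence with code `k` that is admissible for `pp`, `r`, and `q`; a false sentence if there
is none. -/
noncomputable def ofCode (pp : Bool) (r : ℕ) {q : ℕ} (hq : 1 ≤ q) (k : ℕ) :
    {φ : Formula Sym // Admissible false r q [] φ} :=
  if h : ∃ φ, φ.code = k ∧ Admissible pp r q [] φ then
    ⟨h.choose, h.choose_spec.2.to_existential⟩
  else ⟨falseSentence, by simp [falseSentence, Admissible, IsAtom]; omega⟩

variable {pp : Bool} {r q : ℕ} {hq : 1 ≤ q}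

theorem ofCode_code {φ : Formula Sym} (hφ : Admissible pp r q [] φ) :
    (ofCode pp r hq φ.code).1 = φ := by
  have h : ∃ ψ, ψ.code = φ.code ∧ Admissible pp r q [] ψ := ⟨φ, rfl, hφ⟩
  rw [ofCode, dif_pos h]
  exact code_injective h.choose_spec.1

theorem ofCode_of_not_exists {k : ℕ} (h : ¬ ∃ φ, φ.code = k ∧ Admissible pp r q [] φ) :
    (ofCode pp r hq k).1 = falseSentence := by
  rw [ofCode, dif_neg h]

theorem primrec_code_ofCode : Primrec fun k => (ofCode pp r hq k).1.code := by
  refine (Primrec.ite (c := fun k => check pp r q [] k = true)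
    (Primrec.eq.comp ((primrec_check pp r q).comp (Primrec.const []) Primrec.id)
      (Primrec.const true)) Primrec.id (Primrec.const falseSentence.code)).of_eq fun k => ?_
  split_ifs with h
  · obtain ⟨φ, rfl, hφ⟩ := (check_iff k []).1 h
    rw [ofCode_code hφ]
    rfl
  · rw [ofCode_of_not_exists fun hk => h ((check_iff k []).2 hk)]

variable {Φ : Set (Formula Sym)}

theorem pMC_voc_eq_ofCode (hΦ : ∀ φ, Admissible pp r q [] φ ↔ φ ∈ Φ) (k : ℕ) :
    (pMC Φ).voc k = (ofCode pp r hq k).1.voc := by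
  by_cases h : ∃ φ, φ.code = k ∧ Admissible pp r q [] φ
  · obtain ⟨φ, rfl, hφ⟩ := h
    rw [ofCode_code hφ, pMC_voc ((hΦ φ).1 hφ)]
  · rw [ofCode_of_not_exists h, pMC_voc_of_not_exists]
    · rfl
    · rintro ⟨φ, hφ, hk⟩
      exact h ⟨φ, hk, (hΦ φ).2 hφ⟩

theorem pMC_mem_iff_holds_ofCode (hΦ : ∀ φ, Admissible pp r q [] φ ↔ φ ∈ Φ) {k : ℕ}
    {A : Str Sym} (hA : A.voc = (pMC Φ).voc k) :
    (pMC Φ).mem A k ↔ Holds A (ofCode pp r hq k).1 := by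
  by_cases h : ∃ φ, φ.code = k ∧ Admissible pp r q [] φ
  · obtain ⟨φ, rfl, hφ⟩ := h
    rw [ofCode_code hφ, pMC_mem_iff ((hΦ φ).1 hφ)]
    rw [pMC_voc ((hΦ φ).1 hφ)] at hA
    exact and_iff_right hA
  · rw [ofCode_of_not_exists h, iff_false_right (not_holds_falseSentence A)]
    rintro ⟨φ, hφ, hk, -⟩
    exact h ⟨φ, hk, (hΦ φ).2 hφ⟩

end Formula

/-- Model checking of existential sentences reduces to every problem that contains, for all
complete forests `F` of `q` levels, the question whether `F` maps to a given structure. -/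
theorem pMC_reducible {pp : Bool} {r q : ℕ} (hq : 1 ≤ q) {Φ : Set (Formula Sym)}
    (hΦ : ∀ φ, Formula.Admissible pp r q [] φ ↔ φ ∈ Φ) {R : ParamProblem} {p : ℕ → ℕ → ℕ}
    (hp : Primrec₂ p)
    (hR : ∀ M n, 0 < M → n + 1 = treeSize M q → R.voc (p M n) = starVoc n ∧
      ∀ B : Str Sym, B.voc = starVoc n → (∃ b, B.Edge b b) →
        (R.mem B (p M n) ↔ ColorHom (completeForest M n) B)) :
    QfapReducible (pMC Φ) R := by
  have hφ := Formula.primrec_code_ofCode (pp := pp) (r := r) (hq := hq)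
  have hM : Primrec fun k => Formula.branching (Formula.ofCode pp r hq k).1 :=
    primrec_pow.comp (Primrec.const 2)
      (Formula.primrec_positionBound.comp (Primrec.const []) hφ)
  have hn : Primrec fun k => treeSize (Formula.branching (Formula.ofCode pp r hq k).1) q - 1 :=
    Primrec.pred.comp (primrec_treeSize.comp hM (Primrec.const q))
  refine ⟨q + 1, fun k => p _ _, fun k => gameCode q _ _, fun k => gameInterp q _ _ _,
    (hp.comp hM hn).to_comp, ((primrec_gameCode q).comp hM hn).to_comp,
    (primrec_code_gameInterp q r hM hn hφ).to_comp, fun k => ⟨rfl, gameInterp_isQuantifierFree⟩,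
    fun k A hA => ?_⟩
  have hM0 := Formula.branching_pos (Formula.ofCode pp r hq k).1
  have hsize : treeSize (Formula.branching (Formula.ofCode pp r hq k).1) q - 1 + 1 =
      treeSize (Formula.branching (Formula.ofCode pp r hq k).1) q := by
    have := treeSize_strictMono hM0 (show 0 < q from hq)
    omega
  have hdef := gameInterp_definedOn (q := q)
    (M := Formula.branching (Formula.ofCode pp r hq k).1)
    (n := treeSize (Formula.branching (Formula.ofCode pp r hq k).1) q - 1)
    (hA.trans (Formula.pMC_voc_eq_ofCode (hq := hq) hΦ k))
  obtain ⟨hv, hmem⟩ := hR _ _ hM0 hsize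
  have hvB := starInterp_apply_voc hdef
  refine ⟨hdef, hvB.trans hv.symm, ?_⟩
  rw [Formula.pMC_mem_iff_holds_ofCode (hq := hq) hΦ hA]
  exact (colorHom_game_iff hdef hq rfl hsize).symm.trans
    (hmem _ hvB (exists_loop_game hdef)).symm

theorem pMC_reducible_pHom {pp : Bool} {r q : ℕ} (hq : 1 ≤ q) {Φ : Set (Formula Sym)}
    (hΦ : ∀ φ, Formula.Admissible pp r q [] φ ↔ φ ∈ Φ) :
    QfapReducible (pMC Φ) (pHom (starForests (q - 1))) := by
  refine pMC_reducible hq hΦ (p := fun M n => Encodable.encode (forestCode M n))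
    (Primrec.encode.comp primrec_forestCode) fun M n hM hn => ?_
  have hiso := forestCode_isIso (n := n) hM
  have hmem : (forestCode M n).toStr ∈ starForests (q - 1) :=
    ⟨n, _, completeForest_isForest hM hn, hiso⟩
  refine ⟨(pHom_voc hmem).trans hiso.1, fun B hB _ => ?_⟩
  rw [pHom_mem_iff hmem, HomTo.iff_of_isIso hiso, homTo_starGraph_iff]
  exact and_iff_right hB.symm

theorem pMC_reducible_pMC {pp : Bool} {r q : ℕ} (hq : 1 ≤ q) {Φ Ψ : Set (Formula Sym)}
    (hΦ : ∀ φ, Formula.Admissible pp r q [] φ ↔ φ ∈ Φ)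
    (hΨ : primitivePositiveSentences q 2 ⊆ Ψ) : QfapReducible (pMC Φ) (pMC Ψ) := by
  refine pMC_reducible hq hΦ
    (p := fun M n => (Formula.forestFormula q n (forestEdges M n)).code) ?_
    fun M n hM hn => ?_
  · exact (Formula.primrec_code_forestFormula q).comp (Primrec.snd.pair primrec_forestEdges)
  have hmem := hΨ (Formula.forestFormula_mem (n := n) (E := forestEdges M n) hq)
  refine ⟨(pMC_voc hmem).trans (Formula.forestFormula_voc q), fun B hB hloop => ?_⟩
  rw [pMC_mem_iff hmem, Formula.forestFormula_voc,
    Formula.holds_forestFormula_iff (completeForest_isForest hM hn) (mem_forestEdges hM) hloop]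
  exact and_iff_right hB

theorem primitivePositiveSentences_subset {q r : ℕ} (hr : 2 ≤ r) :
    primitivePositiveSentences q 2 ⊆ existentialSentences q r := by
  intro φ hφ
  obtain ⟨h1, h2, h3, h4⟩ := (Formula.admissible_false_iff _).1
    ((Formula.admissible_true_iff _).2 hφ).to_existential
  exact ⟨h1, h2, h3, fun R hR => (h4 R hR).trans hr⟩

end QFRed

theorem theorem7p1 (q r : ℕ) (hq : 1 ≤ q) (hr : 2 ≤ r) :
    QFRed.QfapEquivalent
        (QFRed.pMC (QFRed.existentialSentences q r))
        (QFRed.pMC (QFRed.primitivePositiveSentences q 2)) ∧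
      QFRed.QfapEquivalent
        (QFRed.pMC (QFRed.primitivePositiveSentences q 2))
        (QFRed.pHom (QFRed.starForests (q - 1))) ∧
      QFRed.QfapEquivalent
        (QFRed.pMC (QFRed.existentialSentences q r))
        (QFRed.pHom (QFRed.starForests (q - 1))) := by
  have hE : ∀ φ, QFRed.Formula.Admissible false r q [] φ ↔
      φ ∈ QFRed.existentialSentences q r := QFRed.Formula.admissible_false_iff
  have hP : ∀ φ, QFRed.Formula.Admissible true 2 q [] φ ↔
      φ ∈ QFRed.primitivePositiveSentences q 2 := QFRed.Formula.admissible_true_iff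
  have hPE := QFRed.primitivePositiveSentences_subset (q := q) hr
  exact ⟨⟨QFRed.pMC_reducible_pMC hq hE subset_rfl, QFRed.pMC_reducible_pMC hq hP hPE⟩,
    ⟨QFRed.pMC_reducible_pHom hq hP, QFRed.pHom_reducible_pMC hq subset_rfl⟩,
    ⟨QFRed.pMC_reducible_pHom hq hE, QFRed.pHom_reducible_pMC hq hPE⟩⟩
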